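/- **Setting.** Let $d,\alpha\in\mathbb N=\{1,2,\dots\}$, $\gamma>0$, let $\mathbb A$ be a standard Borel space with a probability measure $\Theta$, and for $1\le j\le\alpha$ let $\varphi_j:(\mathbb R^d\times\mathbb A)^{j+1}\to[0,1]$ be measurable, symmetric and translation-invariant, i.e. $\varphi_j((x_0+t,a_0),\dots,(x_j+t,a_j))=\varphi_j((x_0,a_0),\dots,(x_j,a_j))$ for all $t\in\mathbb R^d$. Let $\mathbb M=\prod_{j=1}^{\alpha}[0,1]^{\mathbb N^{2j}}$ with the product $\mathbb Q$ of uniform distributions. Let $\Psi$ be a Poisson process on $\mathbb R^d\times\mathbb A\times[0,1]\times\mathbb M$ with intensity measure $\gamma\lambda_d\otimes\Theta\otimes\mathcal U([0,1])\otimes\mathbb Q$, where $\lambda_d$ is Lebesgue measure and $\mathcal U([0,1])$ is the uniform distribution, and let $V\sim\Theta$ and $U\sim\mathbb Q$ be such that $V,U,\Psi$ are independent. A simplicial complex is a family of nonempty finite sets (simplices) closed under passing to nonempty subsets; its vertices are its $0$-simplices. **Random complex.** Fix an enumeration $z_0=\mathbf 0,z_1,z_2,\dots$ of $\mathbb Z^d$.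 For a locally finite counting measure $\psi$ on $\mathbb R^d\times\mathbb A\times[0,1]\times\mathbb M$, the coordinates of a point $(x,a,t,u)$ of $\psi$ are $(k,i)$ if $x\in[0,1)^d+z_k$ and the point is the $i$-th smallest with respect to $t$ among the points of $\psi$ with position in $[0,1)^d+z_k$. For points $(x_i,a_i,t_i,u^{(i)})$, $0\le i\le j$, of $\psi$ with $t_0<\dots<t_j$ and $\rho=\{(x_0,a_0),\dots,(x_j,a_j)\}$, $1\le j\le\alpha$, let $u(\rho)$ be the component of $u^{(j)}$ whose index consists of the coordinates of the points numbered $0,\dots,j-1$. The vertices of the complex $T(\psi)$ are the pairs $(x,a)$ belonging to points of $\psi$, and a nonempty finite vertex set $\sigma$ is a simplex of $T(\psi)$ if and only if every $\rho\subseteq\sigma$ with $|\rho|\ge2$ satisfies $|\rho|\le\alpha+1$ and $u(\rho)\le\varphi_{|\rho|-1}(\rho)$. (Configurations in which several points share a position or a time have probability zero.) Put $\Delta^{\mathbf 0}=T(\Psi+\delta_{(\mathbf 0,V,1,U)})$, and for $W\subseteq\mathbb R^d$ let $\Delta^{\mathbf 0}_W$ be its restriction to simplices with vertices in $W\times\mathbb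 A$. For a real functional $f$ of finite simplicial complexes with vertices in $\mathbb R^d\times\mathbb A$ and a bounded Borel set $W$ put $$\Lambda f(W)=f(\Delta^{\mathbf 0}_W)-f(\Delta^{\mathbf 0}_{W\setminus\{\mathbf 0\}}).$$ **Definitions.** Cubes are the half-open cubes $\prod_{i=1}^d[c_i,c_i+s)$, $s>0$. A sequence of cubes tends to $\mathbb R^d$ if every bounded set is contained in all but finitely many of its members. The functional $f$ is *weakly stabilizing* if it is invariant under translations of the complex in $\mathbb R^d$, every $\Lambda f(W)$ with $W$ a cube is a random variable (measurable up to null sets), and there is one real random variable $Z$ such that $\Lambda f(W_n)\to Z$ in probability for every sequence of cubes $(W_n)$ tending to $\mathbb R^d$. It satisfies the *moment condition* if for some $\varepsilon>0$ $$\sup\big\{\mathbb E\big[|\Lambda f(W)|^{2+\varepsilon}\big] : W \text{ a cube},\ \mathbf 0\in W\big\}<\infty .$$ Let $\pi(a)=\gamma\int_{\mathbb R^d}\int_{\mathbb A}\varphi_1((\mathbf 0,a),(y,b))\,\Theta(\mathrm db)\,\mathrm dy$ for $a\in\mathbb A$. An induced subcomplex of $K$ is the restriction of $K$ to the simplices with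 vertices in a given subset of the vertex set of $K$. Two complexes are isomorphic if a bijection between their vertex sets maps simplices to simplices in both directions. **Proposition.** Let $L$ be a connected finite simplicial complex on $r+1$ vertices for some $r\in\mathbb N_0$. For a finite simplicial complex $K$ let $g_L(K)$ be the number of induced subcomplexes of $K$ isomorphic to $L$, and let $h_L(K)$ be the number of connected components of $K$ isomorphic to $L$. 1. If the $\Theta$-essential supremum over $a\in\mathbb A$ of $\int_{\mathbb R^d}\int_{\mathbb A}\varphi_1((\mathbf 0,a),(y,b))\,\Theta(\mathrm db)\,\mathrm dy$ is finite, then $g_L$ is weakly stabilizing and satisfies the moment condition. 2. If $\mathbb E[\pi(V)^3]<\infty$, then $h_L$ is weakly stabilizing and satisfies the moment condition. -/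

import Mathlib

open MeasureTheory ProbabilityTheory Filter Topology
open scoped NNReal ENNReal

namespace RCM

/-! ### Simplicial complexes

A simplicial complex is a down-closed family of nonempty finite sets; its vertices are the points
that span a `0`-simplex. -/

section Complexes

variable {X Y : Type*}

/-- The vertex set of a complex. -/
def vertexSet (K : PreAbstractSimplicialComplex X) : Set X := {v | ({v} : Finset X) ∈ K.faces}

/-- The restriction of a complex to the simplices all of whose vertices lie in `S`. -/
def restrict (K : PreAbstractSimplicialComplex X) (S : Set X) : PreAbstractSimplicialComplex X where
  faces := {σ | σ ∈ K.faces ∧ (σ : Set X) ⊆ S}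
  isRelLowerSet_faces := fun _ h =>
    ⟨(K.isRelLowerSet_faces h.1).1, fun _ hts ht =>
      ⟨(K.isRelLowerSet_faces h.1).2 hts ht, (Finset.coe_subset.2 hts).trans h.2⟩⟩

/-- Two complexes are isomorphic if a bijection between their vertex sets maps simplices to
simplices, in both directions. -/
def Isomorphic (K : PreAbstractSimplicialComplex X) (L : PreAbstractSimplicialComplex Y) : Prop :=
  ∃ e : vertexSet K ≃ vertexSet L, ∀ σ : Finset (vertexSet K),
    σ.map (Function.Embedding.subtype _) ∈ K.faces ↔
      (σ.map e.toEmbedding).map (Function.Embedding.subtype _) ∈ L.faces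

/-- The graph formed by the vertices and edges of a complex. -/
def skeletonGraph (K : PreAbstractSimplicialComplex X) : SimpleGraph (vertexSet K) where
  Adj v w := v ≠ w ∧ ∃ σ ∈ K.faces, (v : X) ∈ σ ∧ (w : X) ∈ σ
  symm := ⟨fun _ _ h => ⟨h.1.symm, h.2.imp fun _ hσ => ⟨hσ.1, hσ.2.2, hσ.2.1⟩⟩⟩
  loopless := ⟨fun _ h => h.1 rfl⟩

/-- A complex is connected if it is nonempty and any two vertices are joined by a path of edges. -/
def IsConnected (K : PreAbstractSimplicialComplex X) : Prop := (skeletonGraph K).Connected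

/-- `g_L(K)`: the number of induced subcomplexes of `K` that are isomorphic to `L`. -/
noncomputable def inducedCount (L : PreAbstractSimplicialComplex Y)
    (K : PreAbstractSimplicialComplex X) : ℝ :=
  ({K' | (∃ I ⊆ vertexSet K, K' = restrict K I) ∧ Isomorphic K' L} :
    Set (PreAbstractSimplicialComplex X)).ncard

/-- `h_L(K)`: the number of connected components of `K` that are isomorphic to `L`. -/
noncomputable def componentCount (L : PreAbstractSimplicialComplex Y)
    (K : PreAbstractSimplicialComplex X) : ℝ :=
  ({K' | (∃ C : (skeletonGraph K).ConnectedComponent,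
      K' = restrict K (Subtype.val '' C.supp)) ∧ Isomorphic K' L} :
    Set (PreAbstractSimplicialComplex X)).ncard

end Complexes

/-! ### Poisson processes -/

/-- `ℝ^d` with coordinates; only its Lebesgue measure and its bounded sets are used. -/
abbrev Loc (d : ℕ) : Type := Fin d → ℝ

/-- A locally finite counting measure on `ℝ^d × S`: values in `ℕ ∪ {∞}`, finite on `B × S` for
bounded Borel sets `B`. -/
def IsLocFiniteCounting {d : ℕ} {S : Type*} [MeasurableSpace S] (η : Measure (Loc d × S)) : Prop :=
  (∀ B, MeasurableSet B → ∃ n : ℕ∞, η B = (n : ℝ≥0∞)) ∧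
    ∀ B : Set (Loc d), MeasurableSet B → Bornology.IsBounded B → η (B ×ˢ Set.univ) < ∞

/-- `Ψ` is a Poisson process on `ℝ^d × S` with intensity measure `μ` (a Poisson variable with
parameter `∞` is the constant `∞`). -/
structure IsPoissonProcess {Ω : Type*} [MeasurableSpace Ω] (P : Measure Ω) {d : ℕ} {S : Type*}
    [MeasurableSpace S] (Ψ : Ω → Measure (Loc d × S)) (μ : Measure (Loc d × S)) : Prop where
  measurable : Measurable Ψ
  counting : ∀ ω, IsLocFiniteCounting (Ψ ω)
  law : ∀ B, MeasurableSet B → μ B ≠ ∞ →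
    P.map (fun ω => Ψ ω B) = (poissonMeasure (μ B).toNNReal).map (fun n : ℕ => (n : ℝ≥0∞))
  law_top : ∀ B, MeasurableSet B → μ B = ∞ → ∀ᵐ ω ∂P, Ψ ω B = ∞
  indep : ∀ (m : ℕ) (B : Fin m → Set (Loc d × S)), (∀ i, MeasurableSet (B i)) →
    Pairwise (fun i j => Disjoint (B i) (B j)) → iIndepFun (fun i ω => Ψ ω (B i)) P

/-! ### The random connection model -/

/-- The space `[0,1]^(ℕ^2) × ⋯ × [0,1]^(ℕ^(2α))`. The index `j : Fin α` stands for the simplex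
dimension `j + 1`, and an element of `ℕ^(2(j+1))` is written as `j + 1` pairs. -/
abbrev AuxMark (α : ℕ) : Type := (Σ j : Fin α, (Fin (j + 1) → ℕ × ℕ)) → unitInterval

/-- The product of uniform distributions on `AuxMark α`. -/
noncomputable def auxLaw (α : ℕ) : Measure (AuxMark α) :=
  Measure.infinitePi fun _ => (volume : Measure unitInterval)

/-- Marked points `(x, a, t, u)` with position `x`, mark `a`, time `t` and auxiliary mark `u`. -/
abbrev Pt (d : ℕ) (A : Type*) (α : ℕ) : Type _ := Loc d × (A × (unitInterval × AuxMark α))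

/-- The intensity measure `γ λ_d ⊗ Θ ⊗ U([0,1]) ⊗ Q`. -/
noncomputable def intensity (d : ℕ) {A : Type*} [MeasurableSpace A] (α : ℕ) (γ : ℝ≥0)
    (Θ : Measure A) : Measure (Pt d A α) :=
  (γ • (volume : Measure (Loc d))).prod
    (Θ.prod ((volume : Measure unitInterval).prod (auxLaw α)))

/-- Connection functions: `φ j` is the function `φ_{j+1}` on `j + 2` marked positions; each one is
measurable, symmetric and translation-invariant with values in `[0,1]`. -/
structure IsConnectionFamily {d : ℕ} {A : Type*} [MeasurableSpace A] {α : ℕ}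
    (φ : ∀ j : Fin α, (Fin (j + 2) → Loc d × A) → unitInterval) : Prop where
  measurable : ∀ j : Fin α, Measurable (φ j)
  symmetric : ∀ (j : Fin α) (s : Equiv.Perm (Fin (j + 2))) (x : Fin (j + 2) → Loc d × A),
    φ j (x ∘ s) = φ j x
  translation_invariant : ∀ (j : Fin α) (x : Fin (j + 2) → Loc d × A) (t : Loc d),
    φ j (fun i => ((x i).1 + t, (x i).2)) = φ j x

section Model

variable {d : ℕ} {A : Type*} [MeasurableSpace A] {α : ℕ}

/-- The vertex `(x, a)` of the point `(x, a, t, u)`. -/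
def vertexOf (p : Pt d A α) : Loc d × A := (p.1, p.2.1)

/-- The time component `t` of the point `(x, a, t, u)`. -/
def timeOf (p : Pt d A α) : unitInterval := p.2.2.1

/-- The auxiliary mark `u` of the point `(x, a, t, u)`. -/
def auxOf (p : Pt d A α) : AuxMark α := p.2.2.2

/-- The points of a counting measure, that is, its atoms. -/
def points (ψ : Measure (Pt d A α)) : Set (Pt d A α) := {p | ψ {p} ≠ 0}

/-- For an enumeration `z` of `ℤ^d`, the number `k` of the cube `[0,1)^d + z k` containing `x`. -/
noncomputable def cubeIndex (z : ℕ ≃ (Fin d → ℤ)) (x : Loc d) : ℕ := z.symm fun i => ⌊x i⌋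

/-- The coordinates `(k, i)` of a point `p` of `ψ`: `p` lies over the `k`-th unit cube, and it is
the `i`-th earliest point of `ψ` over that cube. -/
noncomputable def coords (z : ℕ ≃ (Fin d → ℤ)) (ψ : Measure (Pt d A α)) (p : Pt d A α) : ℕ × ℕ :=
  (cubeIndex z p.1,
    {q | q ∈ points ψ ∧ cubeIndex z q.1 = cubeIndex z p.1 ∧ timeOf q ≤ timeOf p}.ncard)

/-- The simplex `ρ` with at least two vertices passes its test `u(ρ) ≤ φ(ρ)`: its dimension `j + 1`
is at most `α`, and if its points are `p 0, …, p (j+1)` in the order of time, then `u(ρ)` is the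
component of the auxiliary mark of the latest point that is indexed by the coordinates of the
earlier ones. -/
def Accepted (z : ℕ ≃ (Fin d → ℤ)) (φ : ∀ j : Fin α, (Fin (j + 2) → Loc d × A) → unitInterval)
    (ψ : Measure (Pt d A α)) (ρ : Finset (Loc d × A)) : Prop :=
  ∃ (j : Fin α) (p : Fin (j + 2) → Pt d A α),
    (∀ i, p i ∈ points ψ) ∧ StrictMono (fun i => timeOf (p i)) ∧
    ρ.card = j + 2 ∧ (ρ : Set (Loc d × A)) = Set.range (fun i => vertexOf (p i)) ∧
    auxOf (p (Fin.last (j + 1))) ⟨j, fun i => coords z ψ (p i.castSucc)⟩ ≤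
      φ j (fun i => vertexOf (p i))

/-- The simplicial complex `T(ψ)` built from the points of `ψ`. -/
def complexOf (z : ℕ ≃ (Fin d → ℤ)) (φ : ∀ j : Fin α, (Fin (j + 2) → Loc d × A) → unitInterval)
    (ψ : Measure (Pt d A α)) : PreAbstractSimplicialComplex (Loc d × A) where
  faces := {σ | σ.Nonempty ∧ (∀ v ∈ σ, ∃ p ∈ points ψ, vertexOf p = v) ∧
    ∀ ρ ⊆ σ, 2 ≤ ρ.card → Accepted z φ ψ ρ}
  isRelLowerSet_faces := fun _ h =>
    ⟨h.1, fun _ hts ht => ⟨ht, fun v hv => h.2.1 v (hts hv), fun ρ hρ => h.2.2 ρ (hρ.trans hts)⟩⟩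

/-- The difference operator `Λ_p f(Δ_W) = f(Δ^p_W) - f(Δ^p_{W \ {x}})`, where
`Δ^p = T(ψ + δ_p)` and `x` is the position of `p`. -/
noncomputable def diffOp (z : ℕ ≃ (Fin d → ℤ))
    (φ : ∀ j : Fin α, (Fin (j + 2) → Loc d × A) → unitInterval)
    (f : PreAbstractSimplicialComplex (Loc d × A) → ℝ)
    (ψ : Measure (Pt d A α)) (p : Pt d A α) (W : Set (Loc d)) : ℝ :=
  f (restrict (complexOf z φ (ψ + Measure.dirac p)) (W ×ˢ Set.univ)) -
    f (restrict (complexOf z φ (ψ + Measure.dirac p)) ((W \ {p.1}) ×ˢ Set.univ))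

/-- The random variable `Λ_{(0,V,1,U)} f(Δ_W)`. -/
noncomputable def originDiff {Ω : Type*} (z : ℕ ≃ (Fin d → ℤ))
    (φ : ∀ j : Fin α, (Fin (j + 2) → Loc d × A) → unitInterval)
    (Ψ : Ω → Measure (Pt d A α)) (V : Ω → A) (U : Ω → AuxMark α)
    (f : PreAbstractSimplicialComplex (Loc d × A) → ℝ) (W : Set (Loc d)) (ω : Ω) : ℝ :=
  diffOp z φ f (Ψ ω) (0, V ω, 1, U ω) W

/-! ### Weak stabilization -/

open Classical in
/-- The translate `K + t`. -/
noncomputable def translate (K : PreAbstractSimplicialComplex (Loc d × A)) (t : Loc d) :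
    PreAbstractSimplicialComplex (Loc d × A) :=
  K.map fun v => (v.1 + t, v.2)

/-- Translation-invariance of a functional of finite complexes. -/
def TranslationInvariant (f : PreAbstractSimplicialComplex (Loc d × A) → ℝ) : Prop :=
  ∀ K : PreAbstractSimplicialComplex (Loc d × A), K.faces.Finite → ∀ t, f K = f (translate K t)

/-- Half-open cubes in `ℝ^d`. -/
def IsCube (W : Set (Loc d)) : Prop :=
  ∃ (c : Loc d) (s : ℝ), 0 < s ∧ W = {x | ∀ i, c i ≤ x i ∧ x i < c i + s}

/-- A sequence of sets tends to `ℝ^d` if it eventually contains every bounded set. -/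
def TendsToSpace (W : ℕ → Set (Loc d)) : Prop :=
  ∀ B : Set (Loc d), Bornology.IsBounded B → ∃ N, ∀ n ≥ N, B ⊆ W n

/-- Weakly stabilizing functionals: `f` is translation-invariant, the differences
`Λ_{(0,V,1,U)} f(Δ_W)` are random variables, and they converge in probability to the same real
random variable along all sequences of cubes tending to `ℝ^d`. -/
def WeaklyStabilizing {Ω : Type*} [MeasurableSpace Ω] (P : Measure Ω) (z : ℕ ≃ (Fin d → ℤ))
    (φ : ∀ j : Fin α, (Fin (j + 2) → Loc d × A) → unitInterval)
    (Ψ : Ω → Measure (Pt d A α)) (V : Ω → A) (U : Ω → AuxMark α)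
    (f : PreAbstractSimplicialComplex (Loc d × A) → ℝ) : Prop :=
  TranslationInvariant f ∧
  (∀ W, IsCube W → AEMeasurable (originDiff z φ Ψ V U f W) P) ∧
  ∃ Z : Ω → ℝ, Measurable Z ∧ ∀ W : ℕ → Set (Loc d), (∀ n, IsCube (W n)) → TendsToSpace W →
    TendstoInMeasure P (fun n => originDiff z φ Ψ V U f (W n)) atTop Z

/-- The moment condition: for some `ε > 0`, the moments of order `2 + ε` of
`Λ_{(0,V,1,U)} f(Δ_W)` are bounded uniformly in the cubes `W` containing the origin. -/
def MomentCondition {Ω : Type*} [MeasurableSpace Ω] (P : Measure Ω) (z : ℕ ≃ (Fin d → ℤ))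
    (φ : ∀ j : Fin α, (Fin (j + 2) → Loc d × A) → unitInterval)
    (Ψ : Ω → Measure (Pt d A α)) (V : Ω → A) (U : Ω → AuxMark α)
    (f : PreAbstractSimplicialComplex (Loc d × A) → ℝ) : Prop :=
  ∃ ε : ℝ, 0 < ε ∧
    (⨆ (W : Set (Loc d)) (_ : IsCube W ∧ (0 : Loc d) ∈ W),
      ∫⁻ ω, ENNReal.ofReal (|originDiff z φ Ψ V U f W ω| ^ (2 + ε)) ∂P) < ∞

/-- `∫∫ φ_1((0,a),(y,b)) Θ(db) dy` as an extended non-negative number. -/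
noncomputable def edgeIntegral (hα : 0 < α)
    (φ : ∀ j : Fin α, (Fin (j + 2) → Loc d × A) → unitInterval) (Θ : Measure A) (a : A) : ℝ≥0∞ :=
  ∫⁻ y : Loc d, ∫⁻ b, ENNReal.ofReal (φ ⟨0, hα⟩ ![((0 : Loc d), a), (y, b)] : ℝ) ∂Θ

/-- The mixing parameter `π(a) = γ ∫∫ φ_1((0,a),(y,b)) Θ(db) dy`. -/
noncomputable def mixingParameter (hα : 0 < α) (γ : ℝ≥0)
    (φ : ∀ j : Fin α, (Fin (j + 2) → Loc d × A) → unitInterval) (Θ : Measure A) (a : A) : ℝ≥0∞ :=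
  γ * edgeIntegral hα φ Θ a

end Model

end RCM

/-! Almost surely all points are simple, positions and times are pairwise distinct, no point lies at
the origin and none has time 1. On such a configuration deleting the position of the origin from the
window deletes exactly the vertex `o` of the added point, and both difference operators become
combinatorial quantities at `o`.

For `g_L` the difference is the number of vertex sets in the window that contain `o` and induce a
copy of `L`. It stops changing once the window contains all copies through `o`, provided that these
are finitely many. For `h_L` it is the number (0 or 1) of components through `o` isomorphic to `L`,
minus the number of components of type `L` of the complex without `o` that are adjacent to `o`;
hence its modulus is at most 1 plus the degree of `o`. Whether a vertex lies in a component with the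
vertex number of `L`, and in which one, is decided by a finite connected set with at most one vertex
more, so this difference also stabilizes if the degree is finite (`exists_finite_stable`,
`exists_compSets_sub_eq`).

Everything thus reduces to third moments, that is, ε = 1. Three copies of `L` through `o` have a
connected union with at most 3r further vertices. It can be listed so that each vertex is joined to
`o` or to an earlier one, and the three copies are recovered from three subsets of the list; the
third power is therefore bounded by weighted numbers of trees rooted at `o` (`encard_pow_three_le`).
The same argument bounds the third power of the degree by numbers of stars with at most three
leaves.

The expected number of trees is computed with the multivariate Mecke equation, which is derived here
from independent Poisson counts (`mecke`, `mecke_tuple`). Given positions, marks and times, the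
coordinates of the points are fixed, and distinct edges are tested with distinct components of the
auxiliary marks. So the edges of a tree are present with at most the product of the values of `φ_1`
as probability (`pi_auxLaw_treeTuples_le`). Integrating out the leaves one after the other gives a
power of γ times the essential supremum (`lintegral_tree_le`); for a star one gets a power of π(V)
with exponent at most 3 (`lintegral_star`). Simplices of higher dimension play no role in these
bounds.

For measurability, the vertices of a copy are sorted by time, so that both functionals become
integrals of measurable indicators with respect to powers of the counting measure. -/

set_option linter.unusedSectionVars false

namespace RCM

universe u

/-! ### Locally finite counting measures -/

section LocFin

variable {d : ℕ} {S : Type u} [MeasurableSpace S]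

/-- The measurable space of locally finite counting measures. -/
abbrev LocFin (d : ℕ) (S : Type*) [MeasurableSpace S] : Type _ :=
  {η : Measure (Loc d × S) // IsLocFiniteCounting η}

/-- The cylinder over the ball of radius `n`. -/
def box (d : ℕ) (S : Type*) (n : ℕ) : Set (Loc d × S) := Metric.ball (0 : Loc d) n ×ˢ Set.univ

lemma measurableSet_box (n : ℕ) : MeasurableSet (box d S n) :=
  measurableSet_ball.prod MeasurableSet.univ

lemma iUnion_box : ⋃ n, box d S n = Set.univ := by
  refine Set.eq_univ_of_forall fun x => ?_
  obtain ⟨n, hn⟩ := exists_nat_gt (dist x.1 0)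
  exact Set.mem_iUnion.2 ⟨n, hn, trivial⟩

lemma LocFin.box_lt_top (η : LocFin d S) (n : ℕ) : η.1 (box d S n) < ∞ :=
  η.2.2 _ measurableSet_ball Metric.isBounded_ball

lemma LocFin.one_le (η : LocFin d S) {B : Set (Loc d × S)} (hB : MeasurableSet B)
    (h : η.1 B ≠ 0) : 1 ≤ η.1 B := by
  obtain ⟨n, hn⟩ := η.2.1 B hB
  rw [hn] at h ⊢
  have : n ≠ 0 := by rintro rfl; simp at h
  exact_mod_cast Order.one_le_iff_ne_zero.2 this

/-- The cylinders over spherical shells, a countable partition of the space. -/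
def shell (d : ℕ) (S : Type*) : ℕ → Set (Loc d × S) := disjointed (box d S)

lemma measurableSet_shell (n : ℕ) : MeasurableSet (shell d S n) :=
  MeasurableSet.disjointed measurableSet_box n

lemma shell_subset_box (n : ℕ) : shell d S n ⊆ box d S n := disjointed_subset _ _

lemma sum_restrict_shell (η : Measure (Loc d × S)) :
    Measure.sum (fun n => η.restrict (shell d S n)) = η := by
  rw [← Measure.restrict_iUnion (s := shell d S) (disjoint_disjointed _) measurableSet_shell]
  simp [shell, iUnion_disjointed, iUnion_box]

/-- The summands must be uniformly bounded, so the parameter space is cut according to the integer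
part of the total mass. -/
lemma isSFiniteKernel_of_isFiniteMeasure {Γ X : Type*} [MeasurableSpace Γ] [MeasurableSpace X]
    (κ : Kernel Γ X) (h : ∀ a, IsFiniteMeasure (κ a)) : IsSFiniteKernel κ := by
  classical
  have hm : Measurable fun a => ⌊(κ a Set.univ).toReal⌋₊ :=
    (κ.measurable_coe MeasurableSet.univ).ennreal_toReal.nat_floor
  let s : ℕ → Set Γ := fun n => {a | ⌊(κ a Set.univ).toReal⌋₊ = n}
  have hs : ∀ n, MeasurableSet (s n) := fun n => hm (measurableSet_singleton n)
  have hfin : ∀ n, IsFiniteKernel (Kernel.piecewise (hs n) κ 0) := fun n =>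
    ⟨⟨ENNReal.ofReal (n + 1), ENNReal.ofReal_lt_top, fun a => by
      rw [Kernel.piecewise_apply]
      split_ifs with ha
      · rw [← ENNReal.ofReal_toReal (measure_ne_top (κ a) Set.univ)]
        refine ENNReal.ofReal_le_ofReal ?_
        have := Nat.lt_floor_add_one (κ a Set.univ).toReal
        have h2 : ⌊(κ a Set.univ).toReal⌋₊ = n := ha
        rw [h2] at this
        exact this.le
      · simp⟩⟩
  have : κ = Kernel.sum fun n => Kernel.piecewise (hs n) κ 0 := by
    ext a B hB
    rw [Kernel.sum_apply' _ _ hB, tsum_eq_single ⌊(κ a Set.univ).toReal⌋₊]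
    · rw [Kernel.piecewise_apply, if_pos (show a ∈ s _ from rfl)]
    · intro n hn
      rw [Kernel.piecewise_apply, if_neg (show a ∉ s n from fun h => hn (Eq.symm h))]
      simp
  rw [this]
  exact Kernel.isSFiniteKernel_sum (hκs := fun n => inferInstance)

/-- A measurable family of locally finite counting measures as a kernel. -/
noncomputable def LocFin.kernel {Γ : Type*} [MeasurableSpace Γ] (η : Γ → LocFin d S)
    (hη : Measurable η) : Kernel Γ (Loc d × S) where
  toFun γ := (η γ).1
  measurable' := measurable_subtype_coe.comp hη

/-- On each shell the measures are finite, though not uniformly in the parameter. S-finiteness gives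
the measurability of integrals with parameters and Tonelli's theorem. -/
instance {Γ : Type*} [MeasurableSpace Γ] (η : Γ → LocFin d S) (hη : Measurable η) :
    IsSFiniteKernel (LocFin.kernel η hη) := by
  have : LocFin.kernel η hη =
      Kernel.sum fun n => (LocFin.kernel η hη).restrict (measurableSet_shell (d := d) (S := S) n) := by
    ext a : 1
    rw [Kernel.sum_apply]
    simp_rw [Kernel.restrict_apply]
    exact (sum_restrict_shell _).symm
  rw [this]
  refine Kernel.isSFiniteKernel_sum (hκs := fun n => isSFiniteKernel_of_isFiniteMeasure _ fun a => ⟨?_⟩)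
  rw [Kernel.restrict_apply, Measure.restrict_apply MeasurableSet.univ, Set.univ_inter]
  exact (measure_mono (shell_subset_box n)).trans_lt ((η a).box_lt_top n)

lemma measurable_lintegral_locFin {Γ : Type*} [MeasurableSpace Γ] {η : Γ → LocFin d S}
    (hη : Measurable η) {f : Γ → Loc d × S → ℝ≥0∞} (hf : Measurable (Function.uncurry f)) :
    Measurable fun γ => ∫⁻ p, f γ p ∂(η γ).1 :=
  Measurable.lintegral_kernel_prod_right (κ := LocFin.kernel η hη) hf

lemma measurable_apply_locFin {Γ : Type*} [MeasurableSpace Γ] {η : Γ → LocFin d S}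
    (hη : Measurable η) {B : Set (Γ × (Loc d × S))} (hB : MeasurableSet B) :
    Measurable fun γ => (η γ).1 {p | (γ, p) ∈ B} :=
  Kernel.measurable_kernel_prodMk_left (κ := LocFin.kernel η hη) hB

/-- The integral of `h` over ordered tuples with respect to the power of a measure. -/
noncomputable def tupleInt {X : Type*} [MeasurableSpace X] :
    (m : ℕ) → ((Fin m → X) → ℝ≥0∞) → Measure X → ℝ≥0∞
  | 0, h, _ => h Fin.elim0
  | m + 1, h, η => ∫⁻ p, tupleInt m (fun x => h (Fin.cons p x)) η ∂η

lemma measurable_finCons {X : Type*} [MeasurableSpace X] (m : ℕ) :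
    Measurable fun q : X × (Fin m → X) => (Fin.cons q.1 q.2 : Fin (m + 1) → X) := by
  refine measurable_pi_lambda _ fun i => ?_
  refine Fin.cases ?_ (fun j => ?_) i
  · simpa using measurable_fst
  · simp only [Fin.cons_succ]
    exact (measurable_pi_apply j).comp measurable_snd

/-- The parameter space is quantified inside the induction, because the first point of the tuple
becomes a parameter of the remaining integral. -/
lemma measurable_tupleInt (m : ℕ) : ∀ {Γ : Type u} [MeasurableSpace Γ] {η : Γ → LocFin d S}
    (_ : Measurable η) {h : Γ → (Fin m → Loc d × S) → ℝ≥0∞}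
    (_ : Measurable (Function.uncurry h)), Measurable fun γ => tupleInt m (h γ) (η γ).1 := by
  induction m with
  | zero =>
    intro Γ _ η _ h hh
    exact hh.comp (measurable_id.prodMk measurable_const)
  | succ m ih =>
    intro Γ _ η hη h hh
    refine measurable_lintegral_locFin hη ?_
    refine ih (Γ := Γ × (Loc d × S)) (η := fun q => η q.1) (hη.comp measurable_fst)
      (h := fun q x => h q.1 (Fin.cons q.2 x)) ?_
    refine hh.comp ((measurable_fst.comp measurable_fst).prodMk ?_)
    exact (measurable_finCons m).comp
      ((measurable_snd.comp measurable_fst).prodMk measurable_snd)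

lemma tupleInt_zero_fun {X : Type*} [MeasurableSpace X] (m : ℕ) (η : Measure X) :
    tupleInt m (fun _ => 0) η = 0 := by
  induction m with
  | zero => rfl
  | succ m ih => simp [tupleInt, ih]

/-- Only tuples that use `p` feel the additional atom, and `h` vanishes there. This removes the
point just added when the Mecke equation is iterated. -/
lemma tupleInt_add_dirac (m : ℕ) (η : LocFin d S) (p : Loc d × S) :
    ∀ {h : (Fin m → Loc d × S) → ℝ≥0∞}, Measurable h → (∀ x i, x i = p → h x = 0) →
    tupleInt m h (η.1 + Measure.dirac p) = tupleInt m h η.1 := by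
  induction m with
  | zero => intro h _ _; rfl
  | succ m ih =>
    intro h hm h0
    have hq : ∀ q, tupleInt m (fun x => h (Fin.cons q x)) (η.1 + Measure.dirac p) =
        tupleInt m (fun x => h (Fin.cons q x)) η.1 := fun q =>
      ih (hm.comp ((measurable_finCons m).comp (measurable_const.prodMk measurable_id)))
        fun x i hi => h0 _ i.succ (by simpa using hi)
    simp only [tupleInt, hq]
    rw [lintegral_add_measure]
    have hmeas : Measurable fun q => tupleInt m (fun x => h (Fin.cons q x)) η.1 :=
      measurable_tupleInt m (Γ := Loc d × S) (η := fun _ => η) measurable_const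
        (h := fun q x => h (Fin.cons q x)) (hm.comp (measurable_finCons m))
    rw [lintegral_dirac' _ hmeas]
    have : (fun x : Fin m → Loc d × S => h (Fin.cons p x)) = fun _ => 0 :=
      funext fun x => h0 _ 0 (by simp)
    rw [this, tupleInt_zero_fun, add_zero]

/-- The atoms of a measure. -/
def atoms {X : Type*} [MeasurableSpace X] (η : Measure X) : Set X := {p | η {p} ≠ 0}

/-! ### Counting measures on standard Borel spaces are sums over their atoms. -/

section Standard

variable [StandardBorelSpace S]

lemma LocFin.finite_atoms_inter (η : LocFin d S) {B : Set (Loc d × S)}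
    (hfin : η.1 B < ∞) : (atoms η.1 ∩ B).Finite := by
  by_contra hinf
  obtain ⟨n, hn⟩ := ENNReal.exists_nat_gt hfin.ne
  obtain ⟨F, hF, hc⟩ := Set.Infinite.exists_subset_card_eq hinf n
  have h1 : (n : ℝ≥0∞) ≤ η.1 (F : Set _) := by
    rw [← MeasureTheory.sum_measure_singleton, ← hc]
    rw [← nsmul_one, ← Finset.sum_const]
    exact Finset.sum_le_sum fun p hp => η.one_le (measurableSet_singleton p) (hF hp).1
  exact absurd (h1.trans (measure_mono fun p hp => (hF hp).2)) (not_le.2 hn)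

lemma LocFin.countable_atoms (η : LocFin d S) : (atoms η.1).Countable := by
  have : atoms η.1 = ⋃ n, atoms η.1 ∩ box d S n := by
    rw [← Set.inter_iUnion, iUnion_box, Set.inter_univ]
  rw [this]
  exact Set.countable_iUnion fun n => (η.finite_atoms_inter (η.box_lt_top n)).countable

/-- If the complement of the atoms had positive mass, it would have a part `T` of smallest positive
integer mass. The normalized restriction to `T` takes only the values 0 and 1, so in a standard
Borel space it is a Dirac measure, whose point would be an atom in `T`. -/
lemma LocFin.measure_compl_atoms (η : LocFin d S) : η.1 (atoms η.1)ᶜ = 0 := by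
  classical
  by_contra hne
  have hmA : MeasurableSet (atoms η.1)ᶜ := η.countable_atoms.measurableSet.compl
  obtain ⟨k, hk⟩ : ∃ k, η.1 ((atoms η.1)ᶜ ∩ box d S k) ≠ 0 := by
    by_contra! h
    apply hne
    rw [← Set.inter_univ (atoms η.1)ᶜ, ← iUnion_box, Set.inter_iUnion]
    exact measure_iUnion_null h
  have hex : ∃ n : ℕ, n ≠ 0 ∧ ∃ T ⊆ (atoms η.1)ᶜ, MeasurableSet T ∧ η.1 T = n := by
    have hT := hmA.inter (measurableSet_box (d := d) (S := S) k)
    obtain ⟨n, hn⟩ := η.2.1 _ hT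
    have hlt : η.1 ((atoms η.1)ᶜ ∩ box d S k) < ∞ :=
      (measure_mono Set.inter_subset_right).trans_lt (η.box_lt_top k)
    have hn' : n ≠ ⊤ := by rintro rfl; simp [hn] at hlt
    lift n to ℕ using hn'
    refine ⟨n, ?_, _, Set.inter_subset_left, hT, by simpa using hn⟩
    rintro rfl
    simp [hn] at hk
  obtain ⟨hn0, T, hTA, hT, hTn⟩ := Nat.find_spec hex
  set n := Nat.find hex
  have hn0' : (n : ℝ≥0∞) ≠ 0 := by exact_mod_cast hn0
  -- By minimality a measurable part of `T` has mass 0 or the full mass `n`.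
  have hzo : IsZeroOneMeasure ((n : ℝ≥0∞)⁻¹ • η.1.restrict T) := by
    refine ⟨fun s hs => ?_⟩
    rw [Measure.smul_apply, Measure.restrict_apply hs, smul_eq_mul]
    by_cases h0 : η.1 (s ∩ T) = 0
    · simp [h0]
    · right
      obtain ⟨j, hj⟩ := η.2.1 _ (hs.inter hT)
      have hle : η.1 (s ∩ T) ≤ n := hTn ▸ measure_mono Set.inter_subset_right
      have hj' : j ≠ ⊤ := by rintro rfl; rw [hj] at hle; simp at hle
      lift j to ℕ using hj'
      have hjn : j ≤ n := by rw [hj] at hle; simpa using hle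
      have hnj : n ≤ j := Nat.find_min' hex ⟨by rintro rfl; simp [hj] at h0, s ∩ T,
        Set.inter_subset_right.trans hTA, hs.inter hT, by simpa using hj⟩
      have : j = n := le_antisymm hjn hnj
      rw [hj, this]
      simpa using ENNReal.inv_mul_cancel hn0' (ENNReal.natCast_ne_top n)
  have hnz : NeZero ((n : ℝ≥0∞)⁻¹ • η.1.restrict T) := ⟨fun h => by
    have := congrArg (fun ν => ν Set.univ) h
    simp [hTn, hn0] at this⟩
  obtain ⟨x, hx⟩ := IsZeroOneMeasure.exists_eq_dirac
    (μ := (n : ℝ≥0∞)⁻¹ • η.1.restrict T)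
  have hx1 := congrArg (fun ν => ν {x}) hx
  simp only [Measure.smul_apply, Measure.restrict_apply (measurableSet_singleton x), smul_eq_mul,
    Measure.dirac_apply' _ (measurableSet_singleton x)] at hx1
  have hxT : x ∈ T := by
    by_contra hxT
    have : ({x} ∩ T : Set (Loc d × S)) = ∅ := by
      ext y; simp only [Set.mem_inter_iff, Set.mem_singleton_iff, Set.mem_empty_iff_false,
        iff_false, not_and]
      rintro rfl; exact hxT
    simp [this] at hx1
  refine hTA hxT fun h0 => ?_
  have : η.1 ({x} ∩ T) = 0 := measure_mono_null Set.inter_subset_left h0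
  simp [this] at hx1

/-- A counting measure is simple if all its atoms have mass one. -/
def IsSimple {X : Type*} [MeasurableSpace X] (η : Measure X) : Prop := ∀ p ∈ atoms η, η {p} = 1

lemma LocFin.lintegral_eq_tsum (η : LocFin d S) (hs : IsSimple η.1) (f : Loc d × S → ℝ≥0∞) :
    ∫⁻ p, f p ∂η.1 = ∑' p : atoms η.1, f p := by
  have h : η.1.restrict (atoms η.1) = η.1 :=
    Measure.restrict_eq_self_of_ae_mem (by
      rw [ae_iff]; exact η.measure_compl_atoms)
  conv_lhs => rw [← h]
  rw [lintegral_countable _ η.countable_atoms]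
  exact tsum_congr fun p => by rw [hs _ p.2, mul_one]

lemma LocFin.tupleInt_eq_tsum (η : LocFin d S) (hs : IsSimple η.1) (m : ℕ) :
    ∀ h : (Fin m → Loc d × S) → ℝ≥0∞,
      tupleInt m h η.1 = ∑' x : Fin m → atoms η.1, h fun i => x i := by
  induction m with
  | zero =>
    intro h
    rw [tsum_eq_single Fin.elim0 (fun x hx => absurd (Subsingleton.elim _ _) hx)]
    exact congrArg h (Subsingleton.elim _ _)
  | succ m ih =>
    intro h
    simp only [tupleInt, ih]
    rw [η.lintegral_eq_tsum hs, ← ENNReal.tsum_prod,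
      ← (Fin.consEquiv fun _ : Fin (m + 1) => atoms η.1).tsum_eq]
    refine tsum_congr fun q => congrArg h (funext fun i => ?_)
    refine Fin.cases ?_ (fun j => ?_) i <;> simp [Fin.consEquiv]

lemma LocFin.measure_eq_encard (η : LocFin d S) (hs : IsSimple η.1) {B : Set (Loc d × S)}
    (hB : MeasurableSet B) : η.1 B = ((atoms η.1 ∩ B).encard : ℝ≥0∞) := by
  rw [← lintegral_indicator_one hB, η.lintegral_eq_tsum hs]
  rw [← ENNReal.tsum_set_one, tsum_subtype (atoms η.1), tsum_subtype (atoms η.1 ∩ B) fun _ => (1 : ℝ≥0∞)]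
  refine tsum_congr fun p => ?_
  by_cases h1 : p ∈ atoms η.1 <;> by_cases h2 : p ∈ B <;> simp [h1, h2]

/-- Turns counts of tuples in a fixed configuration into quantities to which the Mecke equation
applies; `T` need not be measurable. -/
lemma LocFin.encard_le_tupleInt (η : LocFin d S) (hs : IsSimple η.1) (m : ℕ)
    (h : (Fin m → Loc d × S) → ℝ≥0∞) (T : Set (Fin m → Loc d × S))
    (hT : ∀ x ∈ T, (∀ i, x i ∈ atoms η.1) ∧ 1 ≤ h x) :
    (T.encard : ℝ≥0∞) ≤ tupleInt m h η.1 := by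
  rw [η.tupleInt_eq_tsum hs, ← ENNReal.tsum_set_one]
  let e : T → (Fin m → atoms η.1) := fun x i => ⟨x.1 i, (hT x.1 x.2).1 i⟩
  have he : Function.Injective e := fun x y hxy => Subtype.ext <| funext fun i =>
    congrArg Subtype.val (congrFun hxy i)
  refine le_trans ?_ (ENNReal.tsum_comp_le_tsum_of_injective he _)
  exact ENNReal.tsum_le_tsum fun x => (hT x.1 x.2).2

end Standard

end LocFin

/-! ### The Mecke equation -/

/-- The Mecke equation of a single Poisson variable, from n p(n) = r p(n-1) for its weights p. -/
lemma lintegral_poissonMeasure_mul (r : ℝ≥0) (g : ℕ → ℝ≥0∞) :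
    ∫⁻ n, (n : ℝ≥0∞) * g n ∂(poissonMeasure r) = r * ∫⁻ n, g (n + 1) ∂(poissonMeasure r) := by
  have h : ∀ f : ℕ → ℝ≥0∞, ∫⁻ n, f n ∂(poissonMeasure r) =
      ∑' n, f n * ENNReal.ofReal (Real.exp (-r) * r ^ n / n.factorial) := fun f => by
    rw [lintegral_countable']
    simp_rw [poissonMeasure_singleton]
  rw [h, h, tsum_eq_zero_add' ENNReal.summable, ← ENNReal.tsum_mul_left]
  simp only [Nat.cast_zero, zero_mul, zero_add]
  refine tsum_congr fun n => ?_
  have : ((n + 1 : ℕ) : ℝ≥0∞) * ENNReal.ofReal (Real.exp (-r) * r ^ (n + 1) / (n + 1).factorial)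
      = r * ENNReal.ofReal (Real.exp (-r) * r ^ n / n.factorial) := by
    rw [← ENNReal.ofReal_natCast, ← ENNReal.ofReal_coe_nnreal,
      ← ENNReal.ofReal_mul (by positivity), ← ENNReal.ofReal_mul (by positivity)]
    congr 1
    rw [Nat.factorial_succ]
    push_cast
    have := Nat.factorial_pos n
    field_simp
    ring
  calc _ = g (n + 1) * (((n + 1 : ℕ) : ℝ≥0∞) *
        ENNReal.ofReal (Real.exp (-r) * r ^ (n + 1) / (n + 1).factorial)) := by ring
    _ = _ := by rw [this]; ring

section Mecke

variable {Ω : Type*} [MeasurableSpace Ω] {P : Measure Ω} [IsProbabilityMeasure P]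
  {d : ℕ} {S : Type u} [MeasurableSpace S] {Ψ : Ω → Measure (Loc d × S)}
  {μ : Measure (Loc d × S)}

/-- The Mecke equation for functions of the numbers of points in the cells of a finite
partition. -/
lemma IsPoissonProcess.lintegral_cell (hΨ : IsPoissonProcess P Ψ μ) {ι : Type*} [Fintype ι]
    [DecidableEq ι] [MeasurableSpace ι] [MeasurableSingletonClass ι] {c : Loc d × S → ι}
    (hc : Measurable c) (a₀ : ι) (hfin : μ (c ⁻¹' {a₀}) ≠ ∞) {G : (ι → ℝ≥0∞) → ℝ≥0∞}
    (hG : Measurable G) :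
    ∫⁻ ω, Ψ ω (c ⁻¹' {a₀}) * G (fun a => Ψ ω (c ⁻¹' {a})) ∂P =
      μ (c ⁻¹' {a₀}) * ∫⁻ ω, G (fun a => Ψ ω (c ⁻¹' {a}) + if a = a₀ then 1 else 0) ∂P := by
  have hA : ∀ a, MeasurableSet (c ⁻¹' {a}) := fun a => hc (measurableSet_singleton a)
  let X : ι → Ω → ℝ≥0∞ := fun a ω => Ψ ω (c ⁻¹' {a})
  have hX : ∀ a, Measurable (X a) := fun a => (Measure.measurable_coe (hA a)).comp hΨ.measurable
  have hind : iIndepFun X P := by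
    have h1 := hΨ.indep (Fintype.card ι) (fun i => c ⁻¹' {(Fintype.equivFin ι).symm i})
      (fun i => hA _) (fun i j hij => by
        refine Disjoint.preimage _ (Set.disjoint_singleton.2 fun h => hij ?_)
        exact (Fintype.equivFin ι).symm.injective h)
    have h2 := h1.precomp (Fintype.equivFin ι).injective
    simpa [Function.comp_def] using! h2
  let T : Finset ι := Finset.univ.erase a₀
  let Y : Ω → (T → ℝ≥0∞) := fun ω a => X a ω
  have hY : Measurable Y := measurable_pi_lambda _ fun a => hX a
  have hXY : IndepFun (X a₀) Y P := by
    have h1 := hind.indepFun_finset {a₀} T (by simp [T]) hX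
    exact h1.comp (φ := fun v : (({a₀} : Finset ι) → ℝ≥0∞) => v ⟨a₀, by simp⟩)
      (ψ := id) (measurable_pi_apply _) measurable_id
  -- `R` reassembles all counts from the count in the cell `a₀` and the counts in the other cells,
  -- which are independent of each other.
  let R : ℝ≥0∞ × (T → ℝ≥0∞) → (ι → ℝ≥0∞) := fun q a =>
    if h : a ∈ T then q.2 ⟨a, h⟩ else q.1
  have hR : Measurable R := by
    refine measurable_pi_lambda _ fun a => ?_
    by_cases h : a ∈ T
    · simp only [R, h, dite_true]; exact (measurable_pi_apply _).comp measurable_snd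
    · simp only [R, h, dite_false]; exact measurable_fst
  have hRX : ∀ ω, R (X a₀ ω, Y ω) = fun a => X a ω := fun ω => by
    funext a
    by_cases h : a ∈ T
    · simp [R, h, Y]
    · have : a = a₀ := by simpa [T] using h
      simp [R, T, this]
  have hRX' : ∀ ω, R (X a₀ ω + 1, Y ω) = fun a => X a ω + if a = a₀ then 1 else 0 := fun ω => by
    funext a
    by_cases h : a = a₀
    · simp [R, T, h]
    · simp [R, T, h, Y]
  have hlaw : P.map (fun ω => (X a₀ ω, Y ω)) = (P.map (X a₀)).prod (P.map Y) :=
    (indepFun_iff_map_prod_eq_prod_map_map (hX a₀).aemeasurable hY.aemeasurable).1 hXY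
  have key : ∀ F : ℝ≥0∞ × (T → ℝ≥0∞) → ℝ≥0∞, Measurable F →
      ∫⁻ ω, F (X a₀ ω, Y ω) ∂P = ∫⁻ y, ∫⁻ n : ℕ, F ((n : ℝ≥0∞), y)
        ∂(poissonMeasure (μ (c ⁻¹' {a₀})).toNNReal) ∂(P.map Y) := fun F hF => by
    have : IsProbabilityMeasure (P.map Y) := Measure.isProbabilityMeasure_map hY.aemeasurable
    rw [← lintegral_map hF ((hX a₀).prodMk hY), hlaw, hΨ.law _ (hA a₀) hfin,
      lintegral_prod_symm _ hF.aemeasurable]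
    refine lintegral_congr fun y => ?_
    exact lintegral_map (f := fun x => F (x, y))
      (hF.comp (measurable_id.prodMk measurable_const)) (by fun_prop)
  have h1 := key (fun q => q.1 * G (R q)) (measurable_fst.mul (hG.comp hR))
  have h2 := key (fun q => G (R (q.1 + 1, q.2)))
    (hG.comp (hR.comp ((measurable_fst.add_const 1).prodMk measurable_snd)))
  simp only [hRX, hRX'] at h1 h2
  change ∫⁻ ω, X a₀ ω * G (fun a => X a ω) ∂P = _ * ∫⁻ ω, G (fun a => X a ω + _) ∂P
  rw [h1, h2, ← lintegral_const_mul' _ _ hfin]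
  refine lintegral_congr fun y => ?_
  rw [lintegral_poissonMeasure_mul _ fun n => G (R ((n : ℝ≥0∞), y)), ENNReal.coe_toNNReal hfin]
  simp

/-- A locally finite counting measure with an additional point. -/
noncomputable def LocFin.add (η : LocFin d S) (p : Loc d × S) : LocFin d S :=
  ⟨η.1 + Measure.dirac p, by
    refine ⟨fun B hB => ?_, fun B hB hb => ?_⟩
    · obtain ⟨n, hn⟩ := η.2.1 B hB
      classical
      refine ⟨n + if p ∈ B then 1 else 0, ?_⟩
      rw [Measure.add_apply, hn, Measure.dirac_apply' _ hB]
      by_cases h : p ∈ B <;> simp [h]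
    · rw [Measure.add_apply]
      exact ENNReal.add_lt_top.2 ⟨η.2.2 B hB hb, measure_lt_top _ _⟩⟩

lemma measurable_locFin_add :
    Measurable fun q : LocFin d S × (Loc d × S) => q.1.add q.2 := by
  refine Measurable.subtype_mk (Measure.measurable_of_measurable_coe _ fun B hB => ?_)
  simp only [Measure.add_apply]
  exact ((Measure.measurable_coe hB).comp (measurable_subtype_coe.comp measurable_fst)).add
    ((Measure.measurable_coe hB).comp (Measure.measurable_dirac.comp measurable_snd))

/-- The Poisson process as a random element of the space of locally finite counting measures. -/
def IsPoissonProcess.toLocFin (hΨ : IsPoissonProcess P Ψ μ) (ω : Ω) : LocFin d S :=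
  ⟨Ψ ω, hΨ.counting ω⟩

lemma IsPoissonProcess.measurable_toLocFin (hΨ : IsPoissonProcess P Ψ μ) :
    Measurable hΨ.toLocFin := hΨ.measurable.subtype_mk

/-- The map that sends a counting measure to its values on all measurable sets. -/
def LocFin.values (η : LocFin d S) (B : {B : Set (Loc d × S) // MeasurableSet B}) : ℝ≥0∞ := η.1 B

/-- The evaluations generate the σ-algebra, so the cylinder sets form a generating π-system on which
measures can be compared. -/
lemma comap_values : MeasurableSpace.comap (LocFin.values (d := d) (S := S)) MeasurableSpace.pi =
    (inferInstance : MeasurableSpace (LocFin d S)) := by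
  apply le_antisymm
  · rw [← measurable_iff_comap_le]
    exact measurable_pi_lambda _ fun B =>
      (Measure.measurable_coe B.2).comp measurable_subtype_coe
  · change MeasurableSpace.comap Subtype.val _ ≤ _
    rw [← measurable_iff_comap_le]
    refine Measure.measurable_of_measurable_coe _ fun B hB => ?_
    exact (measurable_pi_apply (⟨B, hB⟩ : {B : Set (Loc d × S) // MeasurableSet B})).comp
      (comap_measurable LocFin.values)

/-- The cylinder sets of counting measures. -/
def cylinders (d : ℕ) (S : Type u) [MeasurableSpace S] : Set (Set (LocFin d S)) :=
  {D | ∃ t ∈ measurableCylinders fun _ : {B : Set (Loc d × S) // MeasurableSet B} => ℝ≥0∞,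
    LocFin.values ⁻¹' t = D}

lemma isPiSystem_cylinders : IsPiSystem (cylinders d S) :=
  isPiSystem_measurableCylinders.comap _

lemma generateFrom_cylinders : MeasurableSpace.generateFrom (cylinders d S) =
    (inferInstance : MeasurableSpace (LocFin d S)) := by
  refine Eq.trans ?_ comap_values
  rw [show (MeasurableSpace.pi : MeasurableSpace
    ({B : Set (Loc d × S) // MeasurableSet B} → ℝ≥0∞)) = _ from
    generateFrom_measurableCylinders.symm, MeasurableSpace.comap_generateFrom]
  rfl

/-- The Mecke equation for functions of the numbers of points in finitely many sets. -/
lemma IsPoissonProcess.lintegral_finite (hΨ : IsPoissonProcess P Ψ μ) {κ : Type*} [Fintype κ]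
    {E : Set (Loc d × S)} (hE : MeasurableSet E) (hfin : μ E ≠ ∞) {B : κ → Set (Loc d × S)}
    (hB : ∀ k, MeasurableSet (B k)) {G : (κ → ℝ≥0∞) → ℝ≥0∞} (hG : Measurable G) :
    ∫⁻ ω, Ψ ω E * G (fun k => Ψ ω (B k)) ∂P =
      ∫⁻ p in E, ∫⁻ ω, G (fun k => Ψ ω (B k) + Measure.dirac p (B k)) ∂P ∂μ := by
  classical
  let B' : Option κ → Set (Loc d × S) := fun o => o.elim E B
  have hB' : ∀ o, MeasurableSet (B' o) := fun o => by cases o; exacts [hE, hB _]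
  -- A point is coded by the pattern of the sets among `E` and the `B k` that contain it. The cells
  -- of this code are disjoint, and every count is a sum over cells.
  let c : Loc d × S → (Option κ → Bool) := fun x o => decide (x ∈ B' o)
  have hc : Measurable c := measurable_pi_lambda _ fun o =>
    measurable_to_bool (by
      have : (fun x => c x o) ⁻¹' {true} = B' o := by ext x; simp [c]
      rw [this]; exact hB' o)
  have hA : ∀ a, MeasurableSet (c ⁻¹' {a}) := fun a => hc (measurableSet_singleton a)
  have hsum : ∀ (ν : Measure (Loc d × S)) (o : Option κ),
      ν (B' o) = ∑ a, if a o then ν (c ⁻¹' {a}) else 0 := fun ν o => by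
    rw [← Finset.sum_filter, ← measure_biUnion_finset]
    · congr 1
      ext x
      simp [c]
    · intro a _ b _ hab
      exact Disjoint.preimage _ (Set.disjoint_singleton.2 hab)
    · exact fun a _ => hA a
  let G' : ((Option κ → Bool) → ℝ≥0∞) → ℝ≥0∞ :=
    fun v => G fun k => ∑ a, if a (some k) then v a else 0
  have hG' : Measurable G' := by
    refine hG.comp (measurable_pi_lambda _ fun k => Finset.measurable_fun_sum _ fun a _ => ?_)
    split_ifs
    · exact measurable_pi_apply a
    · exact measurable_const
  -- Only cells inside `E` receive the additional point, so finite intensity is needed for these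
  -- alone.
  have hcell : ∀ a, a none = true → μ (c ⁻¹' {a}) ≠ ∞ := fun a ha =>
    ((measure_mono fun x hx => by
      have : c x none = true := by rw [show c x = a from hx, ha]
      exact of_decide_eq_true this).trans_lt hfin.lt_top).ne
  have hmeasΨ : ∀ C, MeasurableSet C → Measurable fun ω => Ψ ω C := fun C hC =>
    (Measure.measurable_coe hC).comp hΨ.measurable
  have hL : ∀ ω, Ψ ω E * G (fun k => Ψ ω (B k)) = ∑ a, if a none then
      Ψ ω (c ⁻¹' {a}) * G' (fun a => Ψ ω (c ⁻¹' {a})) else 0 := fun ω => by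
    have h1 : G (fun k => Ψ ω (B k)) = G' (fun a => Ψ ω (c ⁻¹' {a})) := by
      simp only [G']
      congr 1
      funext k
      exact hsum (Ψ ω) (some k)
    rw [h1, show Ψ ω E = _ from hsum (Ψ ω) none, Finset.sum_mul]
    exact Finset.sum_congr rfl fun a _ => by split_ifs <;> simp
  simp_rw [hL]
  rw [lintegral_finsetSum']
  swap
  · intro a _
    split_ifs
    · exact ((hmeasΨ _ (hA a)).mul
        (hG'.comp (measurable_pi_lambda _ fun a => hmeasΨ _ (hA a)))).aemeasurable
    · exact aemeasurable_const
  let F : (Option κ → Bool) → ℝ≥0∞ := fun a =>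
    ∫⁻ ω, G (fun k => Ψ ω (B k) + if a (some k) then 1 else 0) ∂P
  have hR : ∀ p, ∫⁻ ω, G (fun k => Ψ ω (B k) + Measure.dirac p (B k)) ∂P = F (c p) := fun p => by
    refine lintegral_congr fun ω => ?_
    congr 1
    funext k
    rw [Measure.dirac_apply' _ (hB k)]
    by_cases h : p ∈ B k <;> simp [c, B', h]
  simp_rw [hR]
  rw [← lintegral_map (μ := μ.restrict E) (f := F) (Measurable.of_discrete) hc, lintegral_fintype]
  refine Finset.sum_congr rfl fun a _ => ?_
  rw [Measure.map_apply hc (measurableSet_singleton a), Measure.restrict_apply (hA a)]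
  by_cases ha : a none = true
  · have h2 : c ⁻¹' {a} ∩ E = c ⁻¹' {a} := Set.inter_eq_left.2 fun x hx => by
      have : c x none = true := by rw [show c x = a from hx, ha]
      exact of_decide_eq_true this
    simp only [ha, if_true]
    rw [hΨ.lintegral_cell hc a (hcell a ha) hG', h2, mul_comm]
    congr 1
    refine lintegral_congr fun ω => ?_
    simp only [G']
    congr 1
    funext k
    rw [show Ψ ω (B k) = _ from hsum (Ψ ω) (some k)]
    -- One more point in the cell `a` raises exactly the counts of those `B k` that contain this
    -- cell.
    have : (if a (some k) = true then (1 : ℝ≥0∞) else 0) =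
        ∑ b, if b (some k) then (if b = a then 1 else 0) else 0 := by
      rw [Finset.sum_eq_single a]
      · simp
      · intro b _ hb; simp [hb]
      · simp
    rw [this, ← Finset.sum_add_distrib]
    exact Finset.sum_congr rfl fun b _ => by split_ifs <;> simp
  · have h2 : c ⁻¹' {a} ∩ E = ∅ := by
      ext x
      simp only [Set.mem_inter_iff, Set.mem_preimage, Set.mem_singleton_iff,
        Set.mem_empty_iff_false, iff_false, not_and]
      rintro rfl hx
      exact ha (decide_eq_true (show x ∈ B' none from hx))
    simp [ha, h2]

/-- On a shell both sides are finite measures. They agree on products of a cylinder set with a Borel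
set by `lintegral_finite`, hence everywhere. -/
lemma IsPoissonProcess.mecke_shell (hΨ : IsPoissonProcess P Ψ μ)
    (hμ : ∀ n, μ (box d S n) < ∞) (n : ℕ) :
    (P.map hΨ.toLocFin) ⊗ₘ
      ((LocFin.kernel id measurable_id).restrict (measurableSet_shell (d := d) (S := S) n)) =
    ((P.map hΨ.toLocFin).prod (μ.restrict (shell d S n))).map
      (fun q => (q.1.add q.2, q.2)) := by
  have hfinn : μ (shell d S n) < ∞ := (measure_mono (shell_subset_box n)).trans_lt (hμ n)
  have : IsFiniteMeasure (μ.restrict (shell d S n)) := ⟨by simpa using hfinn⟩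
  have : IsProbabilityMeasure (P.map hΨ.toLocFin) :=
    Measure.isProbabilityMeasure_map hΨ.measurable_toLocFin.aemeasurable
  have hadd : Measurable fun q : LocFin d S × (Loc d × S) => (q.1.add q.2, q.2) :=
    measurable_locFin_add.prodMk measurable_snd
  have key : ∀ t ∈ measurableCylinders fun _ : {B : Set (Loc d × S) // MeasurableSet B} => ℝ≥0∞,
      ∀ B₀ : Set (Loc d × S), MeasurableSet B₀ →
      ((P.map hΨ.toLocFin) ⊗ₘ ((LocFin.kernel id measurable_id).restrict
        (measurableSet_shell (d := d) (S := S) n))) ((LocFin.values ⁻¹' t) ×ˢ B₀) =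
      ((P.map hΨ.toLocFin).prod (μ.restrict (shell d S n))).map
        (fun q => (q.1.add q.2, q.2)) ((LocFin.values ⁻¹' t) ×ˢ B₀) := by
    intro t ht B₀ hB₀
    obtain ⟨s, T, hT, rfl⟩ := (mem_measurableCylinders _).1 ht
    have hcyl : MeasurableSet (LocFin.values ⁻¹' cylinder s T : Set (LocFin d S)) := by
      have := MeasurableSpace.measurableSet_generateFrom (s := cylinders d S) ⟨_, ht, rfl⟩
      rwa [generateFrom_cylinders] at this
    have hE : MeasurableSet (B₀ ∩ shell d S n) := hB₀.inter (measurableSet_shell n)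
    have hm := hΨ.lintegral_finite hE
      ((measure_mono Set.inter_subset_right).trans_lt hfinn).ne (B := fun k : s => k.1.1)
      (fun k => k.1.2) (G := T.indicator 1) (measurable_one.indicator hT)
    rw [Measure.compProd_apply_prod hcyl hB₀, ← lintegral_indicator hcyl,
      lintegral_map _ hΨ.measurable_toLocFin]
    swap
    · exact (Kernel.measurable_coe _ hB₀).indicator hcyl
    rw [Measure.map_apply hadd (hcyl.prod hB₀), Measure.prod_apply_symm (hadd (hcyl.prod hB₀))]
    refine Eq.trans ?_ (hm.trans ?_)
    · refine lintegral_congr fun ω => ?_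
      by_cases h : hΨ.toLocFin ω ∈ LocFin.values ⁻¹' cylinder s T
      · have h' : (fun k : s => Ψ ω k.1.1) ∈ T := h
        rw [Set.indicator_of_mem h, Set.indicator_of_mem h', Kernel.restrict_apply,
          Measure.restrict_apply hB₀]
        simp; rfl
      · have h' : (fun k : s => Ψ ω k.1.1) ∉ T := h
        rw [Set.indicator_of_notMem h, Set.indicator_of_notMem h', mul_zero]
    · rw [← lintegral_indicator hE, ← lintegral_indicator (measurableSet_shell n)]
      refine lintegral_congr fun p => ?_
      by_cases hp : p ∈ shell d S n
      swap
      · rw [Set.indicator_of_notMem hp, Set.indicator_of_notMem fun h => hp h.2]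
      by_cases hp0 : p ∈ B₀
      swap
      · rw [Set.indicator_of_notMem fun h => hp0 h.1, Set.indicator_of_mem hp]
        have : (fun x : LocFin d S => (x, p)) ⁻¹' ((fun q : LocFin d S × (Loc d × S) =>
          (q.1.add q.2, q.2)) ⁻¹' ((LocFin.values ⁻¹' cylinder s T) ×ˢ B₀)) = ∅ := by
          ext; simp [hp0]
        simp [this]
      rw [Set.indicator_of_mem (show p ∈ B₀ ∩ shell d S n from ⟨hp0, hp⟩), Set.indicator_of_mem hp]
      have hpre : (fun x : LocFin d S => (x, p)) ⁻¹' ((fun q : LocFin d S × (Loc d × S) =>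
          (q.1.add q.2, q.2)) ⁻¹' ((LocFin.values ⁻¹' cylinder s T) ×ˢ B₀)) =
          (fun x : LocFin d S => x.add p) ⁻¹' (LocFin.values ⁻¹' cylinder s T) := by
        ext; simp [hp0]
      have hmp : Measurable fun x : LocFin d S => x.add p :=
        measurable_locFin_add.comp (measurable_id.prodMk measurable_const)
      rw [hpre, Measure.map_apply hΨ.measurable_toLocFin (hmp hcyl),
        ← lintegral_indicator_one (hΨ.measurable_toLocFin (hmp hcyl))]
      rfl
  refine Eq.symm <| ext_of_generate_finite (Set.image2 (· ×ˢ ·) (cylinders d S) {B | MeasurableSet B})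
    (generateFrom_eq_prod generateFrom_cylinders MeasurableSpace.generateFrom_measurableSet ?_
      isCountablySpanning_measurableSet).symm
    (isPiSystem_cylinders.prod MeasurableSpace.isPiSystem_measurableSet) ?_ ?_
  · exact ⟨fun _ => Set.univ, fun _ => ⟨Set.univ, univ_mem_measurableCylinders _, rfl⟩,
      Set.iUnion_const _⟩
  · rintro _ ⟨_, ⟨t, ht, rfl⟩, B, hB, rfl⟩
    exact (key t ht B hB).symm
  · have := key Set.univ (univ_mem_measurableCylinders _) Set.univ MeasurableSet.univ
    simpa using this.symm

/-- The Mecke equation. -/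
theorem IsPoissonProcess.mecke (hΨ : IsPoissonProcess P Ψ μ) (hμ : ∀ n, μ (box d S n) < ∞)
    {H : LocFin d S → Loc d × S → ℝ≥0∞} (hH : Measurable (Function.uncurry H)) :
    ∫⁻ ω, ∫⁻ p, H (hΨ.toLocFin ω) p ∂(Ψ ω) ∂P =
      ∫⁻ p, ∫⁻ ω, H ((hΨ.toLocFin ω).add p) p ∂P ∂μ := by
  have : SigmaFinite μ := ⟨⟨box d S, fun _ => trivial, hμ, iUnion_box⟩⟩
  have : IsProbabilityMeasure (P.map hΨ.toLocFin) :=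
    Measure.isProbabilityMeasure_map hΨ.measurable_toLocFin.aemeasurable
  have hadd : Measurable fun q : LocFin d S × (Loc d × S) => (q.1.add q.2, q.2) :=
    measurable_locFin_add.prodMk measurable_snd
  have hshell : ∀ n, ∫⁻ ω, ∫⁻ p in shell d S n, H (hΨ.toLocFin ω) p ∂(Ψ ω) ∂P =
      ∫⁻ p in shell d S n, ∫⁻ ω, H ((hΨ.toLocFin ω).add p) p ∂P ∂μ := fun n => by
    have h := congrArg (fun ν => ∫⁻ q, Function.uncurry H q ∂ν) (hΨ.mecke_shell hμ n)
    have hcomp : ∀ q : LocFin d S × (Loc d × S),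
      Function.uncurry H (q.1.add q.2, q.2) = H (q.1.add q.2) q.2 := fun _ => rfl
    beta_reduce at h
    rw [Measure.lintegral_compProd hH, lintegral_map hH hadd, lintegral_congr hcomp,
      lintegral_prod_symm (fun q : LocFin d S × (Loc d × S) => H (q.1.add q.2) q.2)
        (hH.comp hadd).aemeasurable,
      lintegral_map (Measurable.lintegral_kernel_prod_right' hH) hΨ.measurable_toLocFin] at h
    simp only [Kernel.restrict_apply, Function.uncurry] at h
    refine Eq.trans h (lintegral_congr fun p => ?_)
    exact lintegral_map (f := fun η : LocFin d S => H (η.add p) p) (hH.comp ((measurable_locFin_add.comp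
      (measurable_id.prodMk measurable_const)).prodMk measurable_const)) hΨ.measurable_toLocFin
  have hL : ∀ ω, ∫⁻ p, H (hΨ.toLocFin ω) p ∂(Ψ ω) =
      ∑' n, ∫⁻ p in shell d S n, H (hΨ.toLocFin ω) p ∂(Ψ ω) := fun ω => by
    rw [← lintegral_sum_measure, sum_restrict_shell]
  simp_rw [hL]
  rw [lintegral_tsum]
  · simp_rw [hshell]
    rw [← lintegral_sum_measure, sum_restrict_shell]
  · intro n
    have := (Measurable.lintegral_kernel_prod_right' (κ := (LocFin.kernel id measurable_id).restrict
        (measurableSet_shell (d := d) (S := S) n)) hH).comp hΨ.measurable_toLocFin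
    simp only [Kernel.restrict_apply] at this
    exact this.aemeasurable

lemma IsPoissonProcess.lintegral_apply (hΨ : IsPoissonProcess P Ψ μ)
    (hμ : ∀ n, μ (box d S n) < ∞) {B : Set (Loc d × S)} (hB : MeasurableSet B) :
    ∫⁻ ω, Ψ ω B ∂P = μ B := by
  have := hΨ.mecke hμ (H := fun _ => B.indicator 1) ((measurable_one.indicator hB).comp measurable_snd)
  simpa [lintegral_indicator_one hB] using! this

end Mecke

/-! ### Simplicity of the Poisson process and the multivariate Mecke equation -/

section MeckeTuple

variable {Ω : Type*} [MeasurableSpace Ω] {P : Measure Ω} [IsProbabilityMeasure P]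
  {d : ℕ} {S : Type u} [MeasurableSpace S] {Ψ : Ω → Measure (Loc d × S)}
  {μ : Measure (Loc d × S)}

/-- Almost surely, no two points of a Poisson process lie in the same fibre of a map with null
fibres, and all points are simple. -/
theorem IsPoissonProcess.ae_fiber_eq_one [StandardBorelSpace S] (hΨ : IsPoissonProcess P Ψ μ)
    (hμ : ∀ n, μ (box d S n) < ∞) {T : Type*} [MeasurableSpace T] [MeasurableEq T]
    {τ : Loc d × S → T} (hτ : Measurable τ) (hnull : ∀ p, μ {q | τ q = τ p} = 0) :
    ∀ᵐ ω ∂P, ∀ p ∈ atoms (Ψ ω), Ψ ω {q | τ q = τ p} = 1 := by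
  have hfib : ∀ p, MeasurableSet {q | τ q = τ p} := fun p =>
    measurableSet_eq_fun hτ measurable_const
  -- `H` is the mass of the fibre through `p`, at least 1 at every atom. By the Mecke equation its
  -- expected sum over a shell is the integral of μ(fibre) + 1 = 1, which is also the expected
  -- number of points there. Since this number is finite, `H` equals 1 at almost every point.
  let H : LocFin d S → Loc d × S → ℝ≥0∞ := fun η p => η.1 {q | τ q = τ p}
  have hH : Measurable (Function.uncurry H) :=
    measurable_apply_locFin (Γ := LocFin d S × (Loc d × S)) (η := Prod.fst) measurable_fst
      (B := {r | τ r.2 = τ r.1.2})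
      (measurableSet_eq_fun (hτ.comp measurable_snd) (hτ.comp (measurable_snd.comp measurable_fst)))
  have h1 : ∀ ω, ∀ᵐ p ∂(Ψ ω), 1 ≤ H (hΨ.toLocFin ω) p := fun ω => by
    refine measure_mono_null ?_ (hΨ.toLocFin ω).measure_compl_atoms
    intro p hp hpa
    refine hp (((hΨ.toLocFin ω).one_le (measurableSet_singleton p) hpa).trans
      (measure_mono fun q hq => ?_))
    rw [Set.mem_singleton_iff.1 hq]; rfl
  have hshell : ∀ n, ∀ᵐ ω ∂P, ∀ᵐ p ∂((Ψ ω).restrict (shell d S n)), 1 = H (hΨ.toLocFin ω) p := by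
    intro n
    have hms := measurableSet_shell (d := d) (S := S) n
    have hm := hΨ.mecke hμ (H := fun η => (shell d S n).indicator (H η)) (by
      have : (Function.uncurry fun η => (shell d S n).indicator (H η)) =
          (Prod.snd ⁻¹' shell d S n).indicator (Function.uncurry H) := by
        ext ⟨η, p⟩; by_cases h : p ∈ shell d S n <;> simp [h]
      rw [this]
      exact hH.indicator (measurable_snd hms))
    have hR : ∫⁻ p, ∫⁻ ω, (shell d S n).indicator (H ((hΨ.toLocFin ω).add p)) p ∂P ∂μ =
        μ (shell d S n) := by
      rw [← lintegral_indicator_one hms]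
      refine lintegral_congr fun p => ?_
      by_cases hp : p ∈ shell d S n
      · simp only [Set.indicator_of_mem hp, H, LocFin.add, Measure.add_apply]
        rw [lintegral_add_right _ measurable_const, Measure.dirac_apply' _ (hfib p)]
        have := hΨ.lintegral_apply hμ (hfib p)
        rw [show ∫⁻ ω, (hΨ.toLocFin ω).1 {q | τ q = τ p} ∂P = _ from this, hnull]
        simp
      · simp [hp]
    simp_rw [lintegral_indicator hms] at hm
    rw [hR] at hm
    have hfin : μ (shell d S n) < ∞ := (measure_mono (shell_subset_box n)).trans_lt (hμ n)
    have hlow : ∀ ω, Ψ ω (shell d S n) ≤ ∫⁻ p in shell d S n, H (hΨ.toLocFin ω) p ∂(Ψ ω) :=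
      fun ω => by
        rw [← setLIntegral_one]
        exact lintegral_mono_ae (ae_restrict_of_ae (h1 ω))
    have hmeas : Measurable fun ω => ∫⁻ p in shell d S n, H (hΨ.toLocFin ω) p ∂(Ψ ω) := by
      have := (Measurable.lintegral_kernel_prod_right'
        (κ := (LocFin.kernel id measurable_id).restrict hms) hH).comp hΨ.measurable_toLocFin
      simp only [Kernel.restrict_apply] at this
      exact this
    have heq := ae_eq_of_ae_le_of_lintegral_le (μ := P) (f := fun ω => Ψ ω (shell d S n))
      (ae_of_all _ hlow) (by rw [hΨ.lintegral_apply hμ hms]; exact hfin.ne) hmeas.aemeasurable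
      (by rw [hm, hΨ.lintegral_apply hμ hms])
    filter_upwards [heq] with ω hω
    have hΨfin : Ψ ω (shell d S n) < ∞ :=
      (measure_mono (shell_subset_box n)).trans_lt ((hΨ.toLocFin ω).box_lt_top n)
    have h3 := ae_eq_of_ae_le_of_lintegral_le (μ := (Ψ ω).restrict (shell d S n))
      (f := fun _ => 1) (g := H (hΨ.toLocFin ω)) (ae_restrict_of_ae (h1 ω)) (by simpa using hΨfin.ne)
      (hH.comp (measurable_const.prodMk measurable_id)).aemeasurable (by rw [← hω]; simp)
    exact h3
  filter_upwards [ae_all_iff.2 hshell] with ω hω p hp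
  have hpu : p ∈ ⋃ n, shell d S n := by rw [shell, iUnion_disjointed, iUnion_box]; trivial
  obtain ⟨n, hn⟩ := Set.mem_iUnion.1 hpu
  have h := hω n
  rw [ae_restrict_iff' (measurableSet_shell n)] at h
  by_contra hne
  refine hp (measure_mono_null (Set.singleton_subset_iff.2 ?_) (ae_iff.1 h))
  simp only [Set.mem_ofPred_eq, Classical.not_imp]
  exact ⟨hn, fun h => hne h.symm⟩

/-- A locally finite counting measure with finitely many additional points. -/
noncomputable def LocFin.addTuple : {m : ℕ} → LocFin d S → (Fin m → Loc d × S) → LocFin d S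
  | 0, η, _ => η
  | _ + 1, η, x => (LocFin.addTuple η (Fin.tail x)).add (x 0)

lemma LocFin.addTuple_val {m : ℕ} (η : LocFin d S) (x : Fin m → Loc d × S) :
    (η.addTuple x).1 = η.1 + ∑ i, Measure.dirac (x i) := by
  induction m with
  | zero => simp [LocFin.addTuple]
  | succ m ih =>
    simp only [LocFin.addTuple, LocFin.add, ih, Fin.sum_univ_succ, Fin.tail]
    rw [add_assoc, add_comm (∑ i : Fin m, _)]

lemma measurable_finTail {X : Type*} [MeasurableSpace X] (m : ℕ) :
    Measurable fun x : Fin (m + 1) → X => (Fin.tail x : Fin m → X) :=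
  measurable_pi_lambda _ fun i => measurable_pi_apply i.succ

lemma measurable_addTuple (m : ℕ) :
    Measurable fun q : LocFin d S × (Fin m → Loc d × S) => q.1.addTuple q.2 := by
  induction m with
  | zero => exact measurable_fst
  | succ m ih =>
    exact measurable_locFin_add.comp ((ih.comp (measurable_fst.prodMk
      ((measurable_finTail m).comp measurable_snd))).prodMk
      ((measurable_pi_apply 0).comp measurable_snd))

lemma lintegral_pi_insertNth {X : Type*} [MeasurableSpace X] (ν : Measure X) [SigmaFinite ν]
    {m : ℕ} (i : Fin (m + 1)) {f : (Fin (m + 1) → X) → ℝ≥0∞} (hf : Measurable f) :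
    ∫⁻ x, f x ∂(Measure.pi fun _ => ν) =
      ∫⁻ p, ∫⁻ x, f (i.insertNth p x) ∂(Measure.pi fun _ : Fin m => ν) ∂ν := by
  have h := (measurePreserving_piFinSuccAbove (fun _ : Fin (m + 1) => ν) i).symm
  exact (h.lintegral_comp hf).symm.trans (lintegral_prod _ (hf.comp h.measurable).aemeasurable)

lemma lintegral_pi_cons {X : Type*} [MeasurableSpace X] (ν : Measure X) [SigmaFinite ν] (m : ℕ)
    {f : (Fin (m + 1) → X) → ℝ≥0∞} (hf : Measurable f) :
    ∫⁻ x, f x ∂(Measure.pi fun _ => ν) =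
      ∫⁻ p, ∫⁻ x, f (Fin.cons p x) ∂(Measure.pi fun _ : Fin m => ν) ∂ν := by
  simpa using lintegral_pi_insertNth ν 0 hf

/-- The multivariate Mecke equation, for functions that vanish at tuples with repetitions. -/
theorem IsPoissonProcess.mecke_tuple (hΨ : IsPoissonProcess P Ψ μ)
    (hμ : ∀ n, μ (box d S n) < ∞) [SigmaFinite μ] (m : ℕ) :
    ∀ {H : LocFin d S → (Fin m → Loc d × S) → ℝ≥0∞} (_ : Measurable (Function.uncurry H))
      (_ : ∀ η x, ¬ Function.Injective x → H η x = 0),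
    ∫⁻ ω, tupleInt m (H (hΨ.toLocFin ω)) (Ψ ω) ∂P =
      ∫⁻ x, ∫⁻ ω, H ((hΨ.toLocFin ω).addTuple x) x ∂P ∂(Measure.pi fun _ : Fin m => μ) := by
  induction m with
  | zero =>
    intro H hH _
    rw [Measure.pi_of_empty _ Fin.elim0, lintegral_dirac']
    · rfl
    · exact Measurable.of_discrete
  | succ m ih =>
    intro H hH h0
    have hcons : ∀ p, Measurable fun q : LocFin d S × (Fin m → Loc d × S) =>
        H (q.1.add p) (Fin.cons p q.2) := fun p =>
      hH.comp ((measurable_locFin_add.comp (measurable_fst.prodMk measurable_const)).prodMk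
        ((measurable_finCons m).comp (measurable_const.prodMk measurable_snd)))
    have hm := hΨ.mecke hμ (H := fun η p => tupleInt m (fun x => H η (Fin.cons p x)) η.1)
      (measurable_tupleInt m (Γ := LocFin d S × (Loc d × S)) (η := Prod.fst) measurable_fst
        (h := fun q x => H q.1 (Fin.cons q.2 x))
        (hH.comp ((measurable_fst.comp measurable_fst).prodMk ((measurable_finCons m).comp
          ((measurable_snd.comp measurable_fst).prodMk measurable_snd)))))
    refine Eq.trans hm ?_
    have hmeas : Measurable fun x : Fin (m + 1) → Loc d × S =>
        ∫⁻ ω, H ((hΨ.toLocFin ω).addTuple x) x ∂P := by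
      refine Measurable.lintegral_prod_right' (f := fun q : (Fin (m + 1) → Loc d × S) × Ω =>
        H ((hΨ.toLocFin q.2).addTuple q.1) q.1) ?_
      exact hH.comp (((measurable_addTuple (m + 1)).comp
        ((hΨ.measurable_toLocFin.comp measurable_snd).prodMk measurable_fst)).prodMk measurable_fst)
    rw [lintegral_pi_cons μ m hmeas]
    refine lintegral_congr fun p => ?_
    -- A second use of `p` would be a repetition, so the added point disappears from the integrating
    -- measure and the induction hypothesis applies.
    have hrem : ∀ ω, tupleInt m (fun x => H ((hΨ.toLocFin ω).add p) (Fin.cons p x))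
        ((hΨ.toLocFin ω).add p).1 =
        tupleInt m (fun x => H ((hΨ.toLocFin ω).add p) (Fin.cons p x)) (Ψ ω) := fun ω =>
      tupleInt_add_dirac m (hΨ.toLocFin ω) p
        ((hcons p).comp (measurable_const.prodMk measurable_id)) fun x i hi =>
          h0 _ _ fun hinj => by
            have := hinj (a₁ := i.succ) (a₂ := 0) (by simpa using hi)
            exact absurd this (Fin.succ_ne_zero i)
    simp_rw [hrem]
    exact ih (H := fun η x => H (η.add p) (Fin.cons p x)) (hcons p) fun η x hx =>
      h0 _ _ fun hinj => hx fun i j hij => by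
        have := hinj (a₁ := i.succ) (a₂ := j.succ) (by simpa using hij)
        exact Fin.succ_injective _ this

end MeckeTuple

/-! ### Spanned sets of a symmetric relation -/

section Spans

variable {X : Type*} {E : X → X → Prop}

/-- Every proper part of `I` that contains `o` has an edge to the rest of `I`. -/
def Spans (E : X → X → Prop) (o : X) (I : Set X) : Prop :=
  ∀ J ⊆ I, o ∈ J → J ≠ I → ∃ v ∈ J, ∃ w ∈ I \ J, E v w

/-- No edge leads from `I` to the part of `S` outside `I`. -/
def ClosedIn (E : X → X → Prop) (S I : Set X) : Prop := ∀ v ∈ I, ∀ w ∈ S, E v w → w ∈ I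

lemma ClosedIn.mono {S S' I : Set X} (h : ClosedIn E S I) (hS : S' ⊆ S) : ClosedIn E S' I :=
  fun v hv w hw => h v hv w (hS hw)

/-- Connectedness is phrased by cuts: a proper part misses some point of `I` or of `J`, and the cut
induced on that set is crossed by an edge. -/
lemma Spans.union {o : X} {I J : Set X} (hI : Spans E o I) (hJ : Spans E o J) (hoI : o ∈ I)
    (hoJ : o ∈ J) : Spans E o (I ∪ J) := by
  intro K hK hoK hne
  by_cases hIK : I ⊆ K
  · have hJK : ¬ J ⊆ K := fun h => hne (hK.antisymm (Set.union_subset hIK h))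
    obtain ⟨v, hv, w, hw, hvw⟩ := hJ (K ∩ J) Set.inter_subset_right ⟨hoK, hoJ⟩
      fun h => hJK (Set.inter_eq_right.1 h)
    exact ⟨v, hv.1, w, ⟨Or.inr hw.1, fun h => hw.2 ⟨h, hw.1⟩⟩, hvw⟩
  · obtain ⟨v, hv, w, hw, hvw⟩ := hI (K ∩ I) Set.inter_subset_right ⟨hoK, hoI⟩
      fun h => hIK (Set.inter_eq_right.1 h)
    exact ⟨v, hv.1, w, ⟨Or.inl hw.1, fun h => hw.2 ⟨h, hw.1⟩⟩, hvw⟩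

lemma Spans.insert {o u w : X} {I : Set X} (hI : Spans E o I) (hoI : o ∈ I) (hu : u ∈ I)
    (huw : E u w) : Spans E o (insert w I) := by
  intro K hK hoK hne
  by_cases hIK : I ⊆ K
  · refine ⟨u, hIK hu, w, ⟨Set.mem_insert _ _, fun hw => hne (hK.antisymm ?_)⟩, huw⟩
    exact Set.insert_subset hw hIK
  · obtain ⟨v, hv, w, hw, hvw⟩ := hI (K ∩ I) Set.inter_subset_right ⟨hoK, hoI⟩
      fun h => hIK (Set.inter_eq_right.1 h)
    exact ⟨v, hv.1, w, ⟨Or.inr hw.1, fun h => hw.2 ⟨h, hw.1⟩⟩, hvw⟩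

lemma spans_singleton (o : X) : Spans E o {o} := fun _ hJ hoJ hne =>
  absurd (hJ.antisymm (Set.singleton_subset_iff.2 hoJ)) hne

/-- Otherwise `I ∩ D` would be a cut of `D`, and the edge crossing it would leave `I` inside `S`. -/
lemma Spans.subset_of_closedIn {v : X} {D S I : Set X} (hD : Spans E v D) (hvD : v ∈ D)
    (hDS : D ⊆ S) (hI : ClosedIn E S I) (hvI : v ∈ I) : D ⊆ I := by
  by_contra h
  obtain ⟨a, ha, b, hb, hab⟩ := hD (I ∩ D) Set.inter_subset_right ⟨hvI, hvD⟩
    fun h' => h (Set.inter_eq_right.1 h')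
  exact hb.2 ⟨hI a ha.1 b (hDS hb.1) hab, hb.1⟩

/-- Tuples of distinct points different from `o`, each of them joined to `o` or an earlier one. -/
def growTuples (E : X → X → Prop) (o : X) (m : ℕ) : Set (Fin m → X) :=
  {x | Function.Injective (Fin.cons o x : Fin (m + 1) → X) ∧
    ∀ i : Fin m, ∃ j : Fin (m + 1), j < i.succ ∧ E ((Fin.cons o x : Fin (m + 1) → X) j) (x i)}

lemma snoc_mem_growTuples {o w : X} {m : ℕ} {x : Fin m → X} (hx : x ∈ growTuples E o m)
    {j : Fin (m + 1)} (hjw : E ((Fin.cons o x : Fin (m + 1) → X) j) w)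
    (hw : w ∉ Set.range (Fin.cons o x : Fin (m + 1) → X)) :
    (Fin.snoc x w : Fin (m + 1) → X) ∈ growTuples E o (m + 1) := by
  have hcs : (Fin.cons o (Fin.snoc x w : Fin (m + 1) → X) : Fin (m + 2) → X) =
      Fin.snoc (Fin.cons o x : Fin (m + 1) → X) w :=
    Fin.cons_snoc_eq_snoc_cons o x w
  refine ⟨?_, fun i => ?_⟩
  · rw [hcs]
    exact Fin.snoc_injective_iff.2 ⟨hx.1, hw⟩
  · rw [hcs]
    refine Fin.lastCases ?_ (fun i => ?_) i
    · exact ⟨j.castSucc, by rw [Fin.succ_last]; exact Fin.castSucc_lt_last _, by simpa using hjw⟩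
    · obtain ⟨k, hk, hE⟩ := hx.2 i
      refine ⟨k.castSucc, ?_, by simpa using hE⟩
      rw [Fin.lt_def] at hk ⊢
      simpa using hk

/-- The list is grown greedily: as long as it does not exhaust `I`, the cut between the listed
points and the rest is crossed by an edge, whose end is the next entry. -/
lemma Spans.exists_growTuples {o : X} {I : Set X} (hI : Spans E o I) (hoI : o ∈ I)
    (hfin : I.Finite) : ∃ x ∈ growTuples E o (I.ncard - 1),
      I = Set.range (Fin.cons o x : Fin (I.ncard - 1 + 1) → X) := by
  have hcard : ∀ {m : ℕ} {x : Fin m → X}, x ∈ growTuples E o m →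
      (Set.range (Fin.cons o x : Fin (m + 1) → X)).ncard = m + 1 := fun {m x} hx => by
    rw [← Set.image_univ, Set.ncard_image_of_injective _ hx.1]
    simp [Set.ncard_univ]
  have claim : ∀ m, m + 1 ≤ I.ncard → ∃ x ∈ growTuples E o m,
      Set.range (Fin.cons o x : Fin (m + 1) → X) ⊆ I := by
    intro m
    induction m with
    | zero =>
      intro _
      refine ⟨Fin.elim0, ⟨fun i j _ => Subsingleton.elim (α := Fin 1) i j, fun i => i.elim0⟩, ?_⟩
      rintro _ ⟨i, rfl⟩
      refine Fin.cases ?_ (fun j => j.elim0) i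
      simpa using hoI
    | succ m ih =>
      intro hm
      obtain ⟨x, hx, hxI⟩ := ih (by omega)
      obtain ⟨v, ⟨j, rfl⟩, w, hw, hvw⟩ := hI _ hxI ⟨0, by simp⟩ fun h => by
        have := hcard hx
        rw [h] at this
        omega
      refine ⟨Fin.snoc x w, snoc_mem_growTuples hx hvw hw.2, ?_⟩
      rw [Fin.cons_snoc_eq_snoc_cons o x w, Fin.range_snoc]
      exact Set.insert_subset hw.1 hxI
  have hpos : 0 < I.ncard := (Set.ncard_pos hfin).2 ⟨o, hoI⟩
  obtain ⟨x, hx, hxI⟩ := claim (I.ncard - 1) (by omega)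
  refine ⟨x, hx, (Set.eq_of_subset_of_ncard_le hxI ?_ hfin).symm⟩
  rw [hcard hx]
  omega

/-- The third power of the number of spanned sets of `r + 1` points is bounded by numbers of
growing tuples of length at most `3 r`. -/
lemma encard_pow_three_le {o : X} {r : ℕ} (F : Set (Set X))
    (hF : ∀ I ∈ F, o ∈ I ∧ Spans E o I ∧ I.Finite ∧ I.ncard = r + 1) :
    F.encard ^ 3 ≤ ∑ m ∈ Finset.range (3 * r + 1), (growTuples E o m).encard * (8 : ℕ∞) ^ m := by
  -- Three subsets of the indices select three sets of entries, each completed by `o`. There are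
  -- (2^m)^3 = 8^m such choices.
  let g : (m : ℕ) → (Fin m → X) × (Set (Fin m) × (Set (Fin m) × Set (Fin m))) →
      Set X × (Set X × Set X) := fun m q =>
    (insert o (q.1 '' q.2.1), insert o (q.1 '' q.2.2.1), insert o (q.1 '' q.2.2.2))
  have hsub : F ×ˢ (F ×ˢ F) ⊆ ⋃ m ∈ Finset.range (3 * r + 1),
      g m '' (growTuples E o m ×ˢ Set.univ) := by
    rintro ⟨I, J, K⟩ ⟨hI, hJ, hK⟩
    obtain ⟨hoI, hsI, hfI, hcI⟩ := hF I hI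
    obtain ⟨hoJ, hsJ, hfJ, hcJ⟩ := hF J hJ
    obtain ⟨hoK, hsK, hfK, hcK⟩ := hF K hK
    have hs := (hsI.union hsJ hoI hoJ).union hsK (Or.inl hoI) hoK
    obtain ⟨x, hx, hU⟩ := hs.exists_growTuples (Or.inr hoK) ((hfI.union hfJ).union hfK)
    -- The three sets share `o` and have `r` further points each.
    have hcard : (I ∪ J ∪ K).ncard - 1 < 3 * r + 1 := by
      have hU' : I ∪ J ∪ K = insert o ((I \ {o}) ∪ (J \ {o}) ∪ (K \ {o})) := by
        ext y
        by_cases hy : y = o <;> simp [hy, hoI]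
      have e : ∀ I : Set X, o ∈ I → I.ncard = r + 1 → (I \ {o}).ncard = r := fun I h1 h2 => by
        rw [Set.ncard_sdiff_singleton_of_mem h1, h2]; rfl
      have h1 := Set.ncard_insert_le o ((I \ {o}) ∪ (J \ {o}) ∪ (K \ {o}))
      have h2 := Set.ncard_union_le ((I \ {o}) ∪ (J \ {o})) (K \ {o})
      have h3 := Set.ncard_union_le (I \ {o}) (J \ {o})
      rw [e I hoI hcI, e J hoJ hcJ] at h3
      rw [e K hoK hcK] at h2
      rw [hU']
      omega
    have hrep : ∀ I' : Set X, o ∈ I' → I' ⊆ I ∪ J ∪ K → insert o (x '' (x ⁻¹' I')) = I' := by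
      intro I' ho' hsub'
      refine Set.Subset.antisymm ?_ fun y hy => ?_
      · exact Set.insert_subset ho' (Set.image_preimage_subset _ _)
      · have := hsub' hy
        rw [hU] at this
        obtain ⟨i, hi⟩ := this
        revert hi
        refine Fin.cases ?_ (fun j => ?_) i
        · intro hi; left; simpa using hi.symm
        · intro hi
          right
          exact ⟨j, by simpa [← hi] using hy, by simpa using hi⟩
    refine Set.mem_biUnion (Finset.mem_coe.2 (Finset.mem_range.2 hcard)) ⟨(x, x ⁻¹' I, x ⁻¹' J, x ⁻¹' K), ⟨hx, trivial⟩, ?_⟩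
    simp only [g]
    rw [hrep I hoI fun _ h => Or.inl (Or.inl h), hrep J hoJ fun _ h => Or.inl (Or.inr h),
      hrep K hoK fun _ h => Or.inr h]
  calc F.encard ^ 3 = (F ×ˢ (F ×ˢ F)).encard := by
        rw [Set.encard_prod, Set.encard_prod]; ring
    _ ≤ _ := Set.encard_le_encard hsub
    _ ≤ _ := Finset.set_encard_biUnion_le _ _
    _ ≤ _ := Finset.sum_le_sum fun m _ => by
        refine (Set.encard_image_le _ _).trans ?_
        rw [Set.encard_prod]
        refine mul_le_mul' le_rfl (le_of_eq ?_)
        rw [Set.encard_univ, ENat.card_eq_coe_fintype_card]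
        simp only [Fintype.card_prod, Fintype.card_set, Fintype.card_fin]
        rw [show (8 : ℕ∞) = ((8 : ℕ) : ℕ∞) by rfl, ← Nat.cast_pow]
        congr 1
        rw [show 8 = 2 * (2 * 2) by rfl, mul_pow, mul_pow]

variable {L : Set (Set X)} {o : X}

lemma ncard_sub_ncard_of_subset {S : Set X} (hfin : {I ∈ L | I ⊆ S}.Finite) :
    ({I ∈ L | I ⊆ S}.ncard : ℝ) - {I ∈ L | I ⊆ S \ {o}}.ncard =
      {I ∈ L | I ⊆ S ∧ o ∈ I}.ncard := by
  have hU : {I ∈ L | I ⊆ S} = {I ∈ L | I ⊆ S \ {o}} ∪ {I ∈ L | I ⊆ S ∧ o ∈ I} := by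
    ext I
    simp only [Set.mem_ofPred_eq, Set.mem_union, Set.subset_sdiff, Set.disjoint_singleton_right]
    tauto
  have hd : Disjoint {I ∈ L | I ⊆ S \ {o}} {I ∈ L | I ⊆ S ∧ o ∈ I} :=
    Set.disjoint_left.2 fun I h1 h2 => (h1.2 h2.2.2).2 rfl
  have hf1 := hfin.subset (hU ▸ Set.subset_union_left)
  have hf2 := hfin.subset (hU ▸ Set.subset_union_right)
  rw [hU, Set.ncard_union_eq hd hf1 hf2]
  push_cast
  ring

/-- The members of `L` that are components of `S`. -/
def compSets (E : X → X → Prop) (L : Set (Set X)) (S : Set X) : Set (Set X) :=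
  {I ∈ L | I ⊆ S ∧ ClosedIn E S I}

/-- A member that avoids `o` and has no edge to `o` is a component of `S` if and only if it is one
of `S \ {o}`. These cancel; what remains is the component of `o` and those components that `o` would
enlarge. -/
lemma compSets_sub {S : Set X} (hoS : o ∈ S)
    (hfin : (compSets E L S).Finite) (hfin' : (compSets E L (S \ {o})).Finite) :
    ((compSets E L S).ncard : ℝ) - (compSets E L (S \ {o})).ncard =
      {I ∈ compSets E L S | o ∈ I}.ncard -
        {I ∈ compSets E L (S \ {o}) | ∃ v ∈ I, E v o}.ncard := by
  have h1 : compSets E L S = {I ∈ compSets E L S | o ∈ I} ∪ {I ∈ compSets E L S | o ∉ I} := by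
    ext I; simp only [Set.mem_union, Set.mem_ofPred_eq]; tauto
  have h2 : compSets E L (S \ {o}) = {I ∈ compSets E L (S \ {o}) | ∃ v ∈ I, E v o} ∪
      {I ∈ compSets E L S | o ∉ I} := by
    ext I
    simp only [Set.mem_union, Set.mem_ofPred_eq, compSets, Set.subset_sdiff,
      Set.disjoint_singleton_right]
    constructor
    · rintro ⟨hL, ⟨hS, ho⟩, hc⟩
      by_cases hv : ∃ v ∈ I, E v o
      · exact Or.inl ⟨⟨hL, ⟨hS, ho⟩, hc⟩, hv⟩
      · refine Or.inr ⟨⟨hL, hS, fun v hvI w hw hvw => ?_⟩, ho⟩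
        by_cases hwo : w = o
        · subst hwo; exact absurd ⟨v, hvI, hvw⟩ hv
        · exact hc v hvI w ⟨hw, hwo⟩ hvw
    · rintro (⟨h, -⟩ | ⟨⟨hL, hS, hc⟩, ho⟩)
      · exact h
      · exact ⟨hL, ⟨hS, ho⟩, hc.mono Set.sdiff_subset⟩
  have hd1 : Disjoint {I ∈ compSets E L S | o ∈ I} {I ∈ compSets E L S | o ∉ I} :=
    Set.disjoint_left.2 fun I h1 h2 => h2.2 h1.2
  have hd2 : Disjoint {I ∈ compSets E L (S \ {o}) | ∃ v ∈ I, E v o}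
      {I ∈ compSets E L S | o ∉ I} :=
    Set.disjoint_left.2 fun I ⟨_, v, hv, hvo⟩ h2 => h2.2 (h2.1.2.2 v hv o hoS hvo)
  have e1 := Set.ncard_union_eq hd1 (hfin.subset (Set.sep_subset _ _))
    (hfin.subset (Set.sep_subset _ _))
  have e2 := Set.ncard_union_eq hd2 (hfin'.subset (Set.sep_subset _ _))
    (hfin.subset (Set.sep_subset _ _))
  rw [← h1] at e1
  rw [← h2] at e2
  rw [e1, e2]
  push_cast
  ring

lemma compSets_eq_of_mem (hspan : ∀ I ∈ L, ∀ v ∈ I, Spans E v I) {S I I' : Set X} {v : X}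
    (hI : I ∈ compSets E L S) (hI' : I' ∈ compSets E L S) (hv : v ∈ I) (hv' : v ∈ I') : I = I' :=
  ((hspan I hI.1 v hv).subset_of_closedIn hv hI.2.1 hI'.2.2 hv').antisymm
    ((hspan I' hI'.1 v hv').subset_of_closedIn hv' hI'.2.1 hI.2.2 hv)

/-- At most one component contains `o`. The components adjacent to `o` are pairwise disjoint, so
choosing in each a neighbour of `o` is injective. -/
lemma abs_compSets_sub_le {S : Set X} (hoS : o ∈ S)
    (hspan : ∀ I ∈ L, ∀ v ∈ I, Spans E v I)
    (hfin : (compSets E L S).Finite) (hfin' : (compSets E L (S \ {o})).Finite)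
    (hdeg : {v ∈ S \ {o} | E v o}.Finite) :
    |((compSets E L S).ncard : ℝ) - (compSets E L (S \ {o})).ncard| ≤
      1 + {v ∈ S \ {o} | E v o}.ncard := by
  rw [compSets_sub hoS hfin hfin']
  have hA : {I ∈ compSets E L S | o ∈ I}.ncard ≤ 1 := by
    rw [Set.ncard_le_one (hfin.subset (Set.sep_subset _ _))]
    exact fun I hI I' hI' => compSets_eq_of_mem hspan hI.1 hI'.1 hI.2 hI'.2
  have hB : {I ∈ compSets E L (S \ {o}) | ∃ v ∈ I, E v o}.ncard ≤
      {v ∈ S \ {o} | E v o}.ncard := by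
    classical
    let f : Set X → X := fun I => if h : ∃ v ∈ I, E v o then h.choose else o
    have hf : ∀ I, (∃ v ∈ I, E v o) → f I ∈ I ∧ E (f I) o := fun I h => by
      simp only [f, h, dite_true]; exact h.choose_spec
    refine Set.ncard_le_ncard_of_injOn f ?_ ?_ hdeg
    · exact fun I hI => ⟨hI.1.2.1 (hf I hI.2).1, (hf I hI.2).2⟩
    · intro I hI I' hI' h
      exact compSets_eq_of_mem hspan hI.1 hI'.1 (hf I hI.2).1 (h ▸ (hf I' hI'.2).1)
  have hA' : ({I ∈ compSets E L S | o ∈ I}.ncard : ℝ) ≤ 1 := by exact_mod_cast hA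
  have hB' : ({I ∈ compSets E L (S \ {o}) | ∃ v ∈ I, E v o}.ncard : ℝ) ≤
      {v ∈ S \ {o} | E v o}.ncard := by exact_mod_cast hB
  rw [abs_le]
  constructor <;> linarith [Nat.cast_nonneg (α := ℝ) {I ∈ compSets E L S | o ∈ I}.ncard,
    Nat.cast_nonneg (α := ℝ) {I ∈ compSets E L (S \ {o}) | ∃ v ∈ I, E v o}.ncard]

/-- The component of a point, as far as it belongs to `L`, does not change any more once the
window contains a certain finite set. -/
lemma exists_finite_stable (hspan : ∀ I ∈ L, ∀ v ∈ I, Spans E v I) {k : ℕ}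
    (hcard : ∀ I ∈ L, I.Finite ∧ I.ncard = k) {S₀ : Set X} {v : X} (hv : v ∈ S₀) :
    ∃ D : Set X, D.Finite ∧ D ⊆ S₀ ∧ ∀ S, D ⊆ S → S ⊆ S₀ →
      {I ∈ compSets E L S | v ∈ I} = {I ∈ compSets E L S₀ | v ∈ I} := by
  classical
  -- `D` is a connected set around `v` of largest size up to `k + 1`. If the size is at most `k`,
  -- then `D` cannot be enlarged and is the component of `v`; if it is `k + 1`, the component of `v`
  -- is too large to belong to `L`, in every window containing `D`.
  let Q : ℕ → Prop := fun n => ∃ D ⊆ S₀, D.Finite ∧ v ∈ D ∧ Spans E v D ∧ D.ncard = n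
  have hQ1 : Q 1 := ⟨{v}, by simpa using hv, Set.finite_singleton v, rfl, spans_singleton v,
    Set.ncard_singleton v⟩
  have hQ := Nat.findGreatest_spec (P := Q) (n := k + 1) (by omega) hQ1
  set n := Nat.findGreatest Q (k + 1)
  obtain ⟨D, hDS₀, hDf, hvD, hD, hDn⟩ := hQ
  have hclosed : n ≤ k → ClosedIn E S₀ D := by
    intro hnk u hu w hw huw
    by_contra hwD
    have hQ' : Q (n + 1) := ⟨insert w D, Set.insert_subset hw hDS₀, hDf.insert w,
      Or.inr hvD, hD.insert hvD hu huw, by rw [Set.ncard_insert_of_notMem hwD hDf, hDn]⟩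
    have : n + 1 ≤ n := Nat.le_findGreatest (by omega) hQ'
    omega
  refine ⟨D, hDf, hDS₀, fun S hDS hSS₀ => ?_⟩
  have hmain : ∀ S', D ⊆ S' → S' ⊆ S₀ → ∀ I ∈ compSets E L S', v ∈ I →
      I = D ∧ ClosedIn E S₀ D := by
    intro S' hDS' hS' I hI hvI
    have hDI : D ⊆ I := hD.subset_of_closedIn hvD hDS' hI.2.2 hvI
    have hnk : n ≤ k := by
      rw [← hDn, ← (hcard I hI.1).2]
      exact Set.ncard_le_ncard hDI (hcard I hI.1).1
    have hc := hclosed hnk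
    exact ⟨((hspan I hI.1 v hvI).subset_of_closedIn hvI (hI.2.1.trans hS') hc hvD).antisymm hDI, hc⟩
  ext I
  constructor
  · rintro ⟨hI, hvI⟩
    obtain ⟨rfl, hc⟩ := hmain S hDS hSS₀ I hI hvI
    exact ⟨⟨hI.1, hDS₀, hc⟩, hvI⟩
  · rintro ⟨hI, hvI⟩
    obtain ⟨rfl, hc⟩ := hmain S₀ hDS₀ le_rfl I hI hvI
    exact ⟨⟨hI.1, hDS, hc.mono hSS₀⟩, hvI⟩

/-- The difference is determined by the component of `o` and, after deletion of `o`, by the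
components of its neighbours. Finitely many applications of `exists_finite_stable` suffice. -/
lemma exists_compSets_sub_eq (hspan : ∀ I ∈ L, ∀ v ∈ I, Spans E v I) {k : ℕ}
    (hcard : ∀ I ∈ L, I.Finite ∧ I.ncard = k)
    (hdeg : {v | v ≠ o ∧ E v o}.Finite) :
    ∃ D : Set X, D.Finite ∧ ∃ c : ℝ, ∀ S, D ⊆ S → (compSets E L S).Finite →
      (compSets E L (S \ {o})).Finite →
      ((compSets E L S).ncard : ℝ) - (compSets E L (S \ {o})).ncard = c := by
  obtain ⟨D₀, hD₀, -, h₀⟩ := exists_finite_stable (E := E) hspan hcard (Set.mem_univ o)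
  have hex : ∀ v : {v | v ≠ o ∧ E v o}, ∃ D : Set X, D.Finite ∧ D ⊆ Set.univ \ {o} ∧
      ∀ S, D ⊆ S → S ⊆ Set.univ \ {o} → {I ∈ compSets E L S | v.1 ∈ I} =
        {I ∈ compSets E L (Set.univ \ {o}) | v.1 ∈ I} := fun v =>
    exists_finite_stable hspan hcard ⟨trivial, v.2.1⟩
  choose D hDf hDo hD using hex
  have := hdeg.to_subtype
  refine ⟨insert o (D₀ ∪ ⋃ v, D v), (hD₀.union (Set.finite_iUnion hDf)).insert o,
    {I ∈ compSets E L Set.univ | o ∈ I}.ncard -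
      {I ∈ compSets E L (Set.univ \ {o}) | ∃ v ∈ I, E v o}.ncard, fun S hS hf hf' => ?_⟩
  have hoS : o ∈ S := hS (Set.mem_insert _ _)
  rw [compSets_sub hoS hf hf',
    h₀ S ((Set.subset_union_left.trans (Set.subset_insert _ _)).trans hS) (Set.subset_univ _)]
  congr 3
  ext I
  have hiff : ∀ v, v ≠ o → E v o → (I ∈ compSets E L (S \ {o}) ∧ v ∈ I ↔
      I ∈ compSets E L (Set.univ \ {o}) ∧ v ∈ I) := fun v hv hvo => by
    have h := hD ⟨v, hv, hvo⟩ (S \ {o}) (fun y hy => ⟨hS (Or.inr (Or.inr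
      (Set.mem_iUnion.2 ⟨_, hy⟩))), (hDo _ hy).2⟩)
      (Set.sdiff_subset_sdiff_left (Set.subset_univ _))
    exact Set.ext_iff.1 h I
  constructor
  · rintro ⟨hI, v, hv, hvo⟩
    exact ⟨((hiff v (hI.2.1 hv).2 hvo).1 ⟨hI, hv⟩).1, v, hv, hvo⟩
  · rintro ⟨hI, v, hv, hvo⟩
    exact ⟨((hiff v (hI.2.1 hv).2 hvo).2 ⟨hI, hv⟩).1, v, hv, hvo⟩

end Spans

/-! ### Simplicial complexes and their subcomplexes -/

section ComplexFacts

variable {X Y Z : Type*}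

lemma face_subset {K : PreAbstractSimplicialComplex X} {σ τ : Finset X} (hσ : σ ∈ K.faces)
    (h : τ ⊆ σ) (hτ : τ.Nonempty) : τ ∈ K.faces := (K.isRelLowerSet_faces hσ).2 h hτ

lemma face_nonempty {K : PreAbstractSimplicialComplex X} {σ : Finset X} (hσ : σ ∈ K.faces) :
    σ.Nonempty := (K.isRelLowerSet_faces hσ).1

lemma mem_vertexSet_of_mem {K : PreAbstractSimplicialComplex X} {σ : Finset X} (hσ : σ ∈ K.faces)
    {v : X} (hv : v ∈ σ) : v ∈ vertexSet K :=
  face_subset hσ (Finset.singleton_subset_iff.2 hv) (Finset.singleton_nonempty v)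

lemma vertexSet_restrict (K : PreAbstractSimplicialComplex X) (S : Set X) :
    vertexSet (restrict K S) = vertexSet K ∩ S := by
  ext v; simp [vertexSet, restrict]

lemma restrict_restrict (K : PreAbstractSimplicialComplex X) (S I : Set X) :
    restrict (restrict K S) I = restrict K (S ∩ I) := by
  ext σ; simp [restrict, and_assoc]

lemma restrict_univ (K : PreAbstractSimplicialComplex X) : restrict K Set.univ = K := by
  ext σ; simp [restrict]

/-- Allows counting vertex sets in place of induced subcomplexes. -/
lemma restrict_injOn (K : PreAbstractSimplicialComplex X) :
    Set.InjOn (restrict K) {I | I ⊆ vertexSet K} := fun I hI J hJ h => by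
  have := congrArg vertexSet h
  rwa [vertexSet_restrict, vertexSet_restrict, Set.inter_eq_right.2 hI,
    Set.inter_eq_right.2 hJ] at this

/-- Two vertices of a common simplex. -/
def Edge (K : PreAbstractSimplicialComplex X) (v w : X) : Prop := ∃ σ ∈ K.faces, v ∈ σ ∧ w ∈ σ

lemma Edge.symm {K : PreAbstractSimplicialComplex X} {v w : X} (h : Edge K v w) : Edge K w v :=
  h.imp fun _ hσ => ⟨hσ.1, hσ.2.2, hσ.2.1⟩

lemma Edge.mem_right {K : PreAbstractSimplicialComplex X} {v w : X} (h : Edge K v w) :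
    w ∈ vertexSet K := by
  obtain ⟨σ, hσ, -, hw⟩ := h
  exact mem_vertexSet_of_mem hσ hw

lemma edge_iff [DecidableEq X] {K : PreAbstractSimplicialComplex X} {v w : X} :
    Edge K v w ↔ {v, w} ∈ K.faces := by
  constructor
  · rintro ⟨σ, hσ, hv, hw⟩
    exact face_subset hσ (Finset.insert_subset hv (Finset.singleton_subset_iff.2 hw)) (by simp)
  · exact fun h => ⟨_, h, by simp, by simp⟩

lemma edge_restrict {K : PreAbstractSimplicialComplex X} {S : Set X} {v w : X} :
    Edge (restrict K S) v w ↔ Edge K v w ∧ v ∈ S ∧ w ∈ S := by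
  classical
  constructor
  · rintro ⟨σ, hσ, hv, hw⟩
    exact ⟨⟨σ, hσ.1, hv, hw⟩, hσ.2 hv, hσ.2 hw⟩
  · rintro ⟨h, hv, hw⟩
    rw [edge_iff] at h ⊢
    refine ⟨h, ?_⟩
    simp [Set.insert_subset_iff, hv, hw]

lemma Isomorphic.symm {K : PreAbstractSimplicialComplex X} {L : PreAbstractSimplicialComplex Y}
    (h : Isomorphic K L) : Isomorphic L K := by
  obtain ⟨e, he⟩ := h
  refine ⟨e.symm, fun σ => ?_⟩
  rw [he (σ.map e.symm.toEmbedding)]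
  simp [Finset.map_map]

lemma Isomorphic.trans {K : PreAbstractSimplicialComplex X} {L : PreAbstractSimplicialComplex Y}
    {M : PreAbstractSimplicialComplex Z} (h : Isomorphic K L) (h' : Isomorphic L M) :
    Isomorphic K M := by
  obtain ⟨e, he⟩ := h
  obtain ⟨e', he'⟩ := h'
  refine ⟨e.trans e', fun σ => ?_⟩
  rw [he, he']
  simp [Finset.map_map, Equiv.trans_toEmbedding]

/-- An isomorphism from a map that is injective on the vertices. -/
lemma isomorphic_of_injOn [DecidableEq Y] {K : PreAbstractSimplicialComplex X}
    {L : PreAbstractSimplicialComplex Y} (f : X → Y) (hf : Set.InjOn f (vertexSet K))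
    (hV : f '' vertexSet K = vertexSet L)
    (hF : ∀ σ : Finset X, (σ : Set X) ⊆ vertexSet K → (σ ∈ K.faces ↔ σ.image f ∈ L.faces)) :
    Isomorphic K L := by
  refine ⟨(Equiv.Set.imageOfInjOn f _ hf).trans (Equiv.setCongr hV), fun σ => ?_⟩
  rw [hF _ (by simp)]
  have : (σ.map (Function.Embedding.subtype (· ∈ vertexSet K))).image f =
      (σ.map ((Equiv.Set.imageOfInjOn f _ hf).trans (Equiv.setCongr hV)).toEmbedding).map
        (Function.Embedding.subtype (· ∈ vertexSet L)) := by
    ext y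
    simp only [Finset.mem_image, Finset.mem_map]
    constructor
    · rintro ⟨_, ⟨a, ha, rfl⟩, rfl⟩
      exact ⟨_, ⟨a, ha, rfl⟩, rfl⟩
    · rintro ⟨_, ⟨a, ha, rfl⟩, rfl⟩
      exact ⟨_, ⟨a, ha, rfl⟩, rfl⟩
  exact iff_of_eq (congrArg (· ∈ L.faces) this)

/-- The vertex sets of the induced subcomplexes that are isomorphic to `L`. -/
def copies (K : PreAbstractSimplicialComplex X) (L : PreAbstractSimplicialComplex Y) :
    Set (Set X) := {I | I ⊆ vertexSet K ∧ Isomorphic (restrict K I) L}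

/-- A path in `L` between the images of a point of `J` and a point outside `J` has a step that
leaves the image of `J`. The isomorphism carries this step back to an edge of `K`. -/
lemma spans_of_mem_copies {K : PreAbstractSimplicialComplex X} {L : PreAbstractSimplicialComplex Y}
    (hL : IsConnected L) {I : Set X} (hI : I ∈ copies K L) {v : X} : Spans (Edge K) v I := by
  classical
  obtain ⟨hIK, e, he⟩ := hI
  intro J hJ hvJ hne
  obtain ⟨w, hwI, hwJ⟩ : ∃ w ∈ I, w ∉ J := by
    by_contra! h
    exact hne (hJ.antisymm h)
  have hV : ∀ u ∈ I, u ∈ vertexSet (restrict K I) := fun u hu => by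
    rw [vertexSet_restrict]; exact ⟨hIK hu, hu⟩
  obtain ⟨p⟩ := hL.preconnected (e ⟨v, hV v (hJ hvJ)⟩) (e ⟨w, hV w hwI⟩)
  obtain ⟨δ, -, h1, h2⟩ := p.exists_boundary_dart {y | (e.symm y).1 ∈ J} (by simpa using hvJ)
    (by simpa using hwJ)
  refine ⟨_, h1, _, ⟨?_, h2⟩, ?_⟩
  · exact ((Set.ext_iff.1 (vertexSet_restrict K I) _).1 (e.symm δ.snd).2).2
  · have hadj := δ.adj.2
    have hE : Edge L (δ.fst : Y) (δ.snd : Y) := hadj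
    rw [edge_iff] at hE
    have := (he {e.symm δ.fst, e.symm δ.snd}).2 (by
      simpa [Finset.map_insert, Finset.map_singleton] using hE)
    have h3 : Edge (restrict K I) (e.symm δ.fst).1 (e.symm δ.snd).1 :=
      ⟨_, this, by simp, by simp⟩
    exact (edge_restrict.1 h3).1

lemma ncard_of_mem_copies {K : PreAbstractSimplicialComplex X}
    {L : PreAbstractSimplicialComplex Y} (hL : (vertexSet L).Finite) {I : Set X}
    (hI : I ∈ copies K L) : I.Finite ∧ I.ncard = (vertexSet L).ncard := by
  obtain ⟨hIK, e, he⟩ := hI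
  have hV : vertexSet (restrict K I) = I := by
    rw [vertexSet_restrict, Set.inter_eq_right.2 hIK]
  rw [← hV]
  have := hL.to_subtype
  have := Finite.of_equiv _ e.symm
  exact ⟨Set.toFinite _, Nat.card_congr e⟩

lemma finite_vertexSet {L : PreAbstractSimplicialComplex Y} (hL : L.faces.Finite) :
    (vertexSet L).Finite :=
  Set.Finite.preimage (Finset.singleton_injective.injOn) hL

lemma copies_nonempty {K : PreAbstractSimplicialComplex X} {L : PreAbstractSimplicialComplex Y}
    (hL : IsConnected L) {I : Set X} (hI : I ∈ copies K L) : I.Nonempty := by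
  obtain ⟨hIK, e, he⟩ := hI
  obtain ⟨y⟩ := hL.nonempty
  exact ⟨_, ((Set.ext_iff.1 (vertexSet_restrict K I) _).1 (e.symm y).2).2⟩

lemma inducedCount_restrict (L : PreAbstractSimplicialComplex Y)
    (K : PreAbstractSimplicialComplex X) (S : Set X) :
    inducedCount L (restrict K S) = {I ∈ copies K L | I ⊆ S}.ncard := by
  rw [inducedCount, ← Set.InjOn.ncard_image (f := restrict K) (s := {I ∈ copies K L | I ⊆ S})]
  · congr 2
    ext K'
    simp only [Set.mem_ofPred_eq, Set.mem_image, copies, vertexSet_restrict, restrict_restrict,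
      Set.subset_inter_iff]
    constructor
    · rintro ⟨⟨I, hI, rfl⟩, hL⟩
      rw [Set.inter_eq_right.2 hI.2] at hL ⊢
      exact ⟨I, ⟨⟨hI.1, hL⟩, hI.2⟩, rfl⟩
    · rintro ⟨I, ⟨⟨hI, hL⟩, hIS⟩, rfl⟩
      exact ⟨⟨I, ⟨hI, hIS⟩, by rw [Set.inter_eq_right.2 hIS]⟩, hL⟩
  · exact (restrict_injOn K).mono fun I hI => hI.1.1

/-- A copy of a connected complex is a component of the window exactly if no edge leaves it inside
the window. -/
lemma componentCount_restrict {L : PreAbstractSimplicialComplex Y} (hL : IsConnected L)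
    (K : PreAbstractSimplicialComplex X) (S : Set X) :
    componentCount L (restrict K S) = (compSets (Edge K) (copies K L) S).ncard := by
  classical
  rw [componentCount, ← Set.InjOn.ncard_image (f := restrict K)
    (s := compSets (Edge K) (copies K L) S)]
  · congr 2
    ext K'
    simp only [Set.mem_ofPred_eq, Set.mem_image]
    constructor
    · rintro ⟨⟨C, rfl⟩, hiso⟩
      have hCV : Subtype.val '' C.supp ⊆ vertexSet K ∩ S := by
        rintro _ ⟨v, -, rfl⟩
        exact vertexSet_restrict K S ▸ v.2
      rw [restrict_restrict, Set.inter_eq_right.2 (hCV.trans Set.inter_subset_right)] at hiso ⊢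
      refine ⟨_, ⟨⟨hCV.trans Set.inter_subset_left, hiso⟩, hCV.trans Set.inter_subset_right,
        ?_⟩, rfl⟩
      rintro _ ⟨v, hv, rfl⟩ w hw hvw
      by_cases hne : (v : X) = w
      · exact ⟨v, hv, hne⟩
      · have hwV : w ∈ vertexSet (restrict K S) := by
          rw [vertexSet_restrict]; exact ⟨hvw.mem_right, hw⟩
        have hadj : (skeletonGraph (restrict K S)).Adj v ⟨w, hwV⟩ :=
          ⟨fun h => hne (congrArg Subtype.val h),
            edge_restrict.2 ⟨hvw, (hCV ⟨v, hv, rfl⟩).2, hw⟩⟩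
        exact ⟨⟨w, hwV⟩, C.mem_supp_of_adj_mem_supp hv hadj, rfl⟩
    · rintro ⟨I, ⟨hI, hIS, hcl⟩, rfl⟩
      refine ⟨?_, hI.2⟩
      obtain ⟨v, hv⟩ := copies_nonempty hL hI
      have hV : ∀ u ∈ I, u ∈ vertexSet (restrict K S) := fun u hu => by
        rw [vertexSet_restrict]; exact ⟨hI.1 hu, hIS hu⟩
      refine ⟨(skeletonGraph (restrict K S)).connectedComponentMk ⟨v, hV v hv⟩, ?_⟩
      -- A path starting in `I` stays in `I` because `I` is closed. Conversely the component
      -- exhausts `I`, as otherwise an edge would cross the cut inside `I`.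
      have hsupp : Subtype.val '' ((skeletonGraph (restrict K S)).connectedComponentMk
          ⟨v, hV v hv⟩).supp = I := by
        apply Set.Subset.antisymm
        · rintro _ ⟨u, hu, rfl⟩
          obtain ⟨p⟩ := SimpleGraph.ConnectedComponent.eq.1 hu
          by_contra huI
          obtain ⟨δ, -, h1, h2⟩ := p.reverse.exists_boundary_dart {y | y.1 ∈ I} hv huI
          have hadj := δ.adj.2
          have hE : Edge (restrict K S) δ.fst.1 δ.snd.1 := hadj
          obtain ⟨h3, -, h4⟩ := edge_restrict.1 hE
          exact h2 (hcl _ h1 _ h4 h3)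
        · by_contra hnot
          obtain ⟨a, ha, b, hb, hab⟩ := spans_of_mem_copies hL hI
            (Subtype.val '' ((skeletonGraph (restrict K S)).connectedComponentMk
              ⟨v, hV v hv⟩).supp ∩ I) Set.inter_subset_right ⟨⟨⟨v, hV v hv⟩, rfl, rfl⟩, hv⟩
            (fun h => hnot (Set.inter_eq_right.1 h))
          obtain ⟨⟨a', ha', rfl⟩, haI⟩ := ha
          refine hb.2 ⟨⟨⟨b, hV b hb.1⟩, ?_, rfl⟩, hb.1⟩
          have hne : a'.1 ≠ b := fun h => hb.2 (h ▸ ⟨⟨a', ha', rfl⟩, haI⟩)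
          exact SimpleGraph.ConnectedComponent.mem_supp_of_adj_mem_supp _ ha'
            ⟨fun h => hne (congrArg Subtype.val h), edge_restrict.2 ⟨hab, hIS haI, hIS hb.1⟩⟩
      rw [hsupp, restrict_restrict, Set.inter_eq_right.2 hIS]
  · exact (restrict_injOn K).mono fun I hI => hI.1.1

/-! ### Behaviour of the functionals under injective relabelling of the vertices -/

section Map

variable [DecidableEq Z] {f : X → Z}

lemma mem_map_image_iff (hf : Function.Injective f) (K : PreAbstractSimplicialComplex X)
    {σ : Finset X} : σ.image f ∈ (K.map f).faces ↔ σ ∈ K.faces := by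
  simp only [PreAbstractSimplicialComplex.map]
  constructor
  · rintro ⟨τ, hτ, h⟩
    rwa [← Finset.image_injective hf h]
  · exact fun h => ⟨σ, h, rfl⟩

lemma vertexSet_map (K : PreAbstractSimplicialComplex X)
    : vertexSet (K.map f) = f '' vertexSet K := by
  ext z
  constructor
  · rintro ⟨τ, hτ, h⟩
    obtain ⟨v, hv⟩ := face_nonempty hτ
    have : f v ∈ ({z} : Finset Z) := h ▸ Finset.mem_image_of_mem f hv
    exact ⟨v, mem_vertexSet_of_mem hτ hv, by simpa using this⟩
  · rintro ⟨v, hv, rfl⟩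
    exact ⟨{v}, hv, by simp⟩

lemma edge_map (hf : Function.Injective f) (K : PreAbstractSimplicialComplex X)
    {v w : X} : Edge (K.map f) (f v) (f w) ↔ Edge K v w := by
  classical
  rw [edge_iff, edge_iff, ← mem_map_image_iff hf K]
  simp [Finset.image_insert]

lemma copies_map (hf : Function.Injective f) (K : PreAbstractSimplicialComplex X)
    (L : PreAbstractSimplicialComplex Y) : copies (K.map f) L = Set.image f '' copies K L := by
  classical
  have hiso : ∀ I : Set X, I ⊆ vertexSet K →
      Isomorphic (restrict K I) (restrict (K.map f) (f '' I)) := fun I hI => by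
    refine isomorphic_of_injOn f hf.injOn ?_ fun σ _ => ?_
    · rw [vertexSet_restrict, vertexSet_restrict, vertexSet_map, Set.image_inter hf]
    · simp only [restrict, Set.mem_ofPred_eq, mem_map_image_iff hf, Finset.coe_image,
        Set.image_subset_image_iff hf]
  ext J
  constructor
  · rintro ⟨hJ, hL⟩
    rw [vertexSet_map] at hJ
    obtain ⟨I, hI, rfl⟩ := Set.subset_image_iff.1 hJ
    exact ⟨I, ⟨hI, (hiso I hI).trans hL⟩, rfl⟩
  · rintro ⟨I, ⟨hI, hL⟩, rfl⟩
    exact ⟨by rw [vertexSet_map]; exact Set.image_mono hI, (hiso I hI).symm.trans hL⟩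

lemma inducedCount_map (hf : Function.Injective f) (K : PreAbstractSimplicialComplex X)
    (L : PreAbstractSimplicialComplex Y) : inducedCount L (K.map f) = inducedCount L K := by
  rw [← restrict_univ (K.map f), inducedCount_restrict, ← restrict_univ K, inducedCount_restrict,
    restrict_univ]
  simp only [Set.subset_univ, and_true, Set.ofPred_mem_eq]
  rw [copies_map hf, Set.ncard_image_of_injective _ hf.image_injective]

lemma componentCount_map (hf : Function.Injective f) (K : PreAbstractSimplicialComplex X)
    (L : PreAbstractSimplicialComplex Y) (hL : IsConnected L) :
    componentCount L (K.map f) = componentCount L K := by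
  rw [← restrict_univ (K.map f), componentCount_restrict hL, ← restrict_univ K,
    componentCount_restrict hL, restrict_univ,
    ← Set.ncard_image_of_injective (compSets (Edge K) (copies K L) _) hf.image_injective]
  congr 2
  ext J
  simp only [compSets, Set.subset_univ, true_and, copies_map hf, Set.mem_ofPred_eq, Set.mem_image]
  constructor
  · rintro ⟨⟨I, hI, rfl⟩, hcl⟩
    refine ⟨I, ⟨hI, fun v hv w _ hvw => ?_⟩, rfl⟩
    exact hf.mem_set_image.1 (hcl (f v) ⟨v, hv, rfl⟩ (f w) trivial ((edge_map hf K).2 hvw))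
  · rintro ⟨I, ⟨hI, hcl⟩, rfl⟩
    refine ⟨⟨I, hI, rfl⟩, ?_⟩
    rintro _ ⟨v, hv, rfl⟩ w _ hvw
    have hw := hvw.mem_right
    rw [vertexSet_map] at hw
    obtain ⟨w, -, rfl⟩ := hw
    exact ⟨w, hcl v hv w trivial ((edge_map hf K).1 hvw), rfl⟩

end Map

end ComplexFacts

/-! ### Translation invariance of the two functionals -/

section Translation

variable {d : ℕ} {A : Type*} {Y : Type*} (L : PreAbstractSimplicialComplex Y)

lemma translate_injective (t : Loc d) :
    Function.Injective fun v : Loc d × A => (v.1 + t, v.2) := fun v w h => by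
  simp only [Prod.mk.injEq, add_left_inj] at h
  exact Prod.ext h.1 h.2

lemma translationInvariant_inducedCount :
    TranslationInvariant (inducedCount (X := Loc d × A) L) := fun K _ t => by
  classical
  exact (inducedCount_map (translate_injective t) K L).symm

lemma translationInvariant_componentCount (hL : IsConnected L) :
    TranslationInvariant (componentCount (X := Loc d × A) L) := fun K _ t => by
  classical
  exact (componentCount_map (translate_injective t) K L hL).symm

end Translation

/-! ### Measurable descriptions of the random complex -/

section MeasurableModel

variable {d : ℕ} {A : Type u} [MeasurableSpace A] {α : ℕ} {z : ℕ ≃ (Fin d → ℤ)}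
  {φ : ∀ j : Fin α, (Fin (j + 2) → Loc d × A) → unitInterval}

/-- Locally finite counting measures of marked points. -/
abbrev Config (d : ℕ) (A : Type u) [MeasurableSpace A] (α : ℕ) : Type u :=
  LocFin d (A × (unitInterval × AuxMark α))

@[fun_prop]
lemma measurable_vertexOf : Measurable (vertexOf : Pt d A α → Loc d × A) := by
  unfold vertexOf; fun_prop

@[fun_prop]
lemma measurable_timeOf : Measurable (timeOf : Pt d A α → unitInterval) := by
  unfold timeOf; fun_prop

@[fun_prop]
lemma measurable_auxOf : Measurable (auxOf : Pt d A α → AuxMark α) := by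
  unfold auxOf; fun_prop

@[fun_prop]
lemma measurable_cubeIndex : Measurable (cubeIndex z) := by
  have h : Measurable fun x : Loc d => fun i => ⌊x i⌋ :=
    measurable_pi_lambda _ fun i => Int.measurable_floor.comp (measurable_pi_apply i)
  exact (Measurable.of_discrete (f := z.symm)).comp h

lemma isBounded_cubeIndex (k : ℕ) : Bornology.IsBounded {x : Loc d | cubeIndex z x = k} := by
  refine (Metric.isBounded_Icc (fun i => ((z k i : ℤ) : ℝ)) fun i => ((z k i : ℤ) : ℝ) + 1).subset
    fun x hx => ?_
  have hx' : (fun i => ⌊x i⌋) = z k := by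
    rw [← (show cubeIndex z x = k from hx)]; simp [cubeIndex]
  constructor <;> intro i
  · have := congrFun hx' i
    beta_reduce
    rw [← this]
    exact Int.floor_le _
  · have := congrFun hx' i
    beta_reduce
    rw [← this]
    exact (Int.lt_floor_add_one _).le

/-- The points over the same unit cube as `p` whose time is at most that of `p`. -/
def earlier (z : ℕ ≃ (Fin d → ℤ)) (p : Pt d A α) : Set (Pt d A α) :=
  {q | cubeIndex z q.1 = cubeIndex z p.1 ∧ timeOf q ≤ timeOf p}

lemma measurableSet_earlier (p : Pt d A α) : MeasurableSet (earlier z p) := by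
  have h : MeasurableSet {q : Pt d A α | timeOf q ≤ timeOf p} :=
    measurableSet_le measurable_timeOf measurable_const
  refine MeasurableSet.inter ?_ h
  exact (measurable_cubeIndex.comp measurable_fst) (measurableSet_singleton (cubeIndex z p.1))

lemma earlier_lt_top (η : Config d A α) (p : Pt d A α) : η.1 (earlier z p) < ∞ := by
  refine (measure_mono fun q hq => ?_).trans_lt (η.2.2 {x | cubeIndex z x = cubeIndex z p.1}
    (measurable_cubeIndex (measurableSet_singleton _)) (isBounded_cubeIndex _))
  exact ⟨hq.1, trivial⟩

/-- A version of the coordinates that is measurable in the point and the configuration. -/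
noncomputable def rank (z : ℕ ≃ (Fin d → ℤ)) (η : Config d A α) (p : Pt d A α) : ℕ × ℕ :=
  (cubeIndex z p.1, ⌊(η.1 (earlier z p)).toReal⌋₊)

lemma measurable_rank :
    Measurable fun q : Config d A α × Pt d A α => rank z q.1 q.2 := by
  refine Measurable.prodMk (measurable_cubeIndex.comp (measurable_fst.comp measurable_snd)) ?_
  refine (Measurable.ennreal_toReal ?_).nat_floor
  refine measurable_apply_locFin (Γ := Config d A α × Pt d A α) (η := Prod.fst) measurable_fst
    (B := {r | cubeIndex z r.2.1 = cubeIndex z r.1.2.1 ∧ timeOf r.2 ≤ timeOf r.1.2}) ?_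
  refine MeasurableSet.inter (measurableSet_eq_fun ?_ ?_) (measurableSet_le ?_ ?_)
  all_goals fun_prop

/-- Configurations of simple points with distinct times and distinct positions. -/
structure IsNice (ψ : Measure (Pt d A α)) : Prop where
  simple : IsSimple ψ
  time_injOn : Set.InjOn timeOf (points ψ)
  position_injOn : Set.InjOn Prod.fst (points ψ)

lemma IsNice.vertexOf_injOn {ψ : Measure (Pt d A α)} (h : IsNice ψ) :
    Set.InjOn vertexOf (points ψ) := fun _ hp _ hq hpq =>
  h.position_injOn hp hq (congrArg (fun v : Loc d × A => v.1) hpq :)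

/-- For infinite sets both sides take the default value 0. -/
lemma toReal_encard {X : Type*} (s : Set X) : (s.encard : ℝ≥0∞).toReal = s.ncard := by
  by_cases h : s.Finite
  · rw [← h.cast_ncard_eq]; simp
  · rw [Set.not_finite] at h
    simp [h.encard_eq, h.ncard]

/-- The passing of the test of the simplex with the points `x i`, `i ∈ s`, for a tuple `x` in the
order of time. -/
def Passes (z : ℕ ≃ (Fin d → ℤ)) (φ : ∀ j : Fin α, (Fin (j + 2) → Loc d × A) → unitInterval)
    (η : Config d A α) {m : ℕ} (x : Fin m → Pt d A α) (s : Finset (Fin m)) : Prop :=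
  ∃ (j : Fin α) (h : s.card = j + 2),
    auxOf (x (s.orderEmbOfFin h (Fin.last (j + 1))))
      ⟨j, fun i => rank z η (x (s.orderEmbOfFin h i.castSucc))⟩ ≤
      φ j (fun i => vertexOf (x (s.orderEmbOfFin h i)))

/-- The complex on the indices of a tuple in which a set of at least two indices has to satisfy
the condition `Q` with all its subsets. -/
def modelComplex {m : ℕ} (Q : Finset (Fin m) → Prop) : PreAbstractSimplicialComplex (Fin m) where
  faces := {s | s.Nonempty ∧ ∀ ρ ⊆ s, 2 ≤ ρ.card → Q ρ}
  isRelLowerSet_faces := fun _ h =>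
    ⟨h.1, fun _ hts ht => ⟨ht, fun ρ hρ => h.2 ρ (hρ.trans hts)⟩⟩

lemma vertexSet_modelComplex {m : ℕ} (Q : Finset (Fin m) → Prop) :
    vertexSet (modelComplex Q) = Set.univ := by
  refine Set.eq_univ_of_forall fun i => ⟨Finset.singleton_nonempty i, fun ρ hρ h2 => ?_⟩
  have := Finset.card_le_card hρ
  rw [Finset.card_singleton] at this
  omega

lemma vertexSet_complexOf (ψ : Measure (Pt d A α)) :
    vertexSet (complexOf z φ ψ) = vertexOf '' points ψ := by
  ext v
  constructor
  · rintro ⟨-, h, -⟩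
    obtain ⟨p, hp, rfl⟩ := h v (Finset.mem_singleton_self v)
    exact ⟨p, hp, rfl⟩
  · rintro ⟨p, hp, rfl⟩
    refine ⟨Finset.singleton_nonempty _, fun v hv => ⟨p, hp, (Finset.mem_singleton.1 hv).symm⟩,
      fun ρ hρ h2 => ?_⟩
    have := Finset.card_le_card hρ
    rw [Finset.card_singleton] at this
    omega

/-- The connection of two points, where `p` is the earlier one. -/
def Links (z : ℕ ≃ (Fin d → ℤ)) (hα : 0 < α)
    (φ : ∀ j : Fin α, (Fin (j + 2) → Loc d × A) → unitInterval)
    (η : Config d A α) (p q : Pt d A α) : Prop :=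
  timeOf p < timeOf q ∧ auxOf q ⟨⟨0, hα⟩, fun _ => rank z η p⟩ ≤
    φ ⟨0, hα⟩ ![vertexOf p, vertexOf q]

/-- The connection of two points. -/
def Adjacent (z : ℕ ≃ (Fin d → ℤ)) (hα : 0 < α)
    (φ : ∀ j : Fin α, (Fin (j + 2) → Loc d × A) → unitInterval)
    (η : Config d A α) (p q : Pt d A α) : Prop := Links z hα φ η p q ∨ Links z hα φ η q p

/-! ### The complex of a configuration in general position -/

section Standard

variable [StandardBorelSpace A] {η : Config d A α}

/-- For simple points, mass is the number of points. This replaces the coordinates by a version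
whose joint measurability is clear. -/
lemma rank_eq (hη : IsNice η.1) (p : Pt d A α) : rank z η p = coords z η.1 p := by
  have : (η.1 (earlier z p)).toReal = (points η.1 ∩ earlier z p).ncard := by
    rw [η.measure_eq_encard hη.simple (measurableSet_earlier p), toReal_encard]; rfl
  rw [rank, coords, this, Nat.floor_natCast]
  rfl

lemma strictMono_of_comp {m k : ℕ} {x : Fin m → Pt d A α}
    (hx : StrictMono fun i => timeOf (x i)) {e : Fin k → Fin m}
    (he : StrictMono fun i => timeOf (x (e i))) : StrictMono e := fun _ _ hij =>
  hx.lt_iff_lt.1 (he hij)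

/-- A simplex determines its points, and the order of time determines their enumeration, so the
witness in `Accepted` can only be the increasing enumeration of `s`. -/
lemma accepted_image_iff [DecidableEq (Loc d × A)] (hη : IsNice η.1) {m : ℕ}
    {x : Fin m → Pt d A α} (hx : ∀ i, x i ∈ points η.1) (hmono : StrictMono fun i => timeOf (x i))
    (s : Finset (Fin m)) :
    Accepted z φ η.1 (s.image fun i => vertexOf (x i)) ↔ Passes z φ η x s := by
  have hxinj : Function.Injective x := fun i j hij => hmono.injective (congrArg timeOf hij)
  have hvinj : Function.Injective fun i => vertexOf (x i) := fun i j hij =>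
    hxinj (hη.vertexOf_injOn (hx i) (hx j) hij)
  have hcard : (s.image fun i => vertexOf (x i)).card = s.card :=
    Finset.card_image_of_injective _ hvinj
  constructor
  · rintro ⟨j, p, hp, hpm, hc, hr, ha⟩
    have hex : ∀ i, ∃ k ∈ s, x k = p i := fun i => by
      have : vertexOf (p i) ∈ ((s.image fun i => vertexOf (x i) : Finset _) : Set (Loc d × A)) := by
        rw [hr]; exact ⟨i, rfl⟩
      obtain ⟨k, hk, hkp⟩ := Finset.mem_image.1 (Finset.mem_coe.1 this)
      exact ⟨k, hk, hη.vertexOf_injOn (hx k) (hp i) hkp⟩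
    choose e hes hep using hex
    obtain rfl : (fun i => x (e i)) = p := funext hep
    have h : s.card = j + 2 := by rw [← hcard, hc]
    have he := Finset.orderEmbOfFin_unique h hes (strictMono_of_comp hmono hpm)
    refine ⟨j, h, ?_⟩
    rw [← he]
    simpa only [rank_eq hη] using ha
  · rintro ⟨j, h, ha⟩
    refine ⟨j, fun i => x (s.orderEmbOfFin h i), fun i => hx _,
      hmono.comp (s.orderEmbOfFin h).strictMono, by rw [hcard, h], ?_, ?_⟩
    · rw [Finset.coe_image, ← Finset.range_orderEmbOfFin s h, ← Set.range_comp]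
      rfl
    · simpa only [rank_eq hη] using ha

/-- The isomorphism type of the complex spanned by a tuple is thus a function of finitely many truth
values, which makes it measurable. -/
lemma isomorphic_modelComplex (hη : IsNice η.1) {m : ℕ} {x : Fin m → Pt d A α}
    (hx : ∀ i, x i ∈ points η.1) (hmono : StrictMono fun i => timeOf (x i)) :
    Isomorphic (modelComplex (Passes z φ η x))
      (restrict (complexOf z φ η.1) (Set.range fun i => vertexOf (x i))) := by
  classical
  have hxinj : Function.Injective x := fun i j hij => hmono.injective (congrArg timeOf hij)
  have hvinj : Function.Injective fun i => vertexOf (x i) := fun i j hij =>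
    hxinj (hη.vertexOf_injOn (hx i) (hx j) hij)
  refine isomorphic_of_injOn (fun i => vertexOf (x i)) hvinj.injOn ?_ fun σ _ => ?_
  · rw [vertexSet_modelComplex, Set.image_univ, vertexSet_restrict, vertexSet_complexOf,
      Set.inter_eq_right.2]
    rintro _ ⟨i, rfl⟩
    exact ⟨x i, hx i, rfl⟩
  · constructor
    · rintro ⟨hne, hQ⟩
      refine ⟨⟨hne.image _, ?_, ?_⟩, ?_⟩
      · intro v hv
        obtain ⟨i, -, rfl⟩ := Finset.mem_image.1 hv
        exact ⟨x i, hx i, rfl⟩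
      · intro ρ hρ h2
        obtain ⟨ρ', hρ', rfl⟩ := Finset.subset_image_iff.1 hρ
        rw [accepted_image_iff hη hx hmono]
        exact hQ ρ' hρ' (by rwa [Finset.card_image_of_injective _ hvinj] at h2)
      · rw [Finset.coe_image]
        exact Set.image_subset_range _ _
    · rintro ⟨⟨hne, -, hQ⟩, -⟩
      refine ⟨Finset.image_nonempty.1 hne, fun ρ hρ h2 => ?_⟩
      rw [← accepted_image_iff hη hx hmono]
      exact hQ _ (Finset.image_subset_image hρ)
        (by rwa [Finset.card_image_of_injective _ hvinj])

/-- The only subset of a pair with at least two elements is the pair itself, so an edge involves a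
single test, that of `φ_1`. -/
lemma edge_of_links (hη : IsNice η.1) (hα : 0 < α) {p q : Pt d A α} (hp : p ∈ points η.1)
    (hq : q ∈ points η.1) (ht : timeOf p < timeOf q) :
    Edge (complexOf z φ η.1) (vertexOf p) (vertexOf q) ↔ Links z hα φ η p q := by
  classical
  have hx : ∀ i, (![p, q] : Fin 2 → Pt d A α) i ∈ points η.1 := by
    intro i; fin_cases i; exacts [hp, hq]
  have hmono : StrictMono fun i => timeOf ((![p, q] : Fin 2 → Pt d A α) i) := by
    rw [Fin.strictMono_iff_lt_succ]
    intro i; fin_cases i; exact ht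
  have himg : (Finset.univ.image fun i => vertexOf ((![p, q] : Fin 2 → Pt d A α) i)) =
      {vertexOf p, vertexOf q} := by
    ext v; simp [Fin.exists_fin_two, eq_comm]
  have hne : vertexOf p ≠ vertexOf q := fun h => by
    rw [hη.vertexOf_injOn hp hq h] at ht
    exact lt_irrefl _ ht
  have hemb : ∀ h : (Finset.univ : Finset (Fin 2)).card = 2,
      ((Finset.univ : Finset (Fin 2)).orderEmbOfFin h : Fin 2 → Fin 2) = id := fun h =>
    (Finset.orderEmbOfFin_unique h (fun _ => Finset.mem_univ _) strictMono_id).symm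
  have hpass : Passes z φ η (![p, q] : Fin 2 → Pt d A α) Finset.univ ↔ Links z hα φ η p q := by
    have hvec : (fun i : Fin 2 => vertexOf ((![p, q] : Fin 2 → Pt d A α) i)) =
        ![vertexOf p, vertexOf q] := by
      funext i; fin_cases i <;> rfl
    have hrk : (fun i : Fin 1 => rank z η ((![p, q] : Fin 2 → Pt d A α) i.castSucc)) =
        fun _ => rank z η p := by
      funext i; fin_cases i; rfl
    constructor
    · rintro ⟨⟨j, hj⟩, h, ha⟩
      obtain rfl : j = 0 := by simpa using h
      have he := hemb h
      refine ⟨ht, ?_⟩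
      simp only [Nat.reduceAdd] at ha
      erw [he] at ha
      change auxOf q ⟨⟨0, hα⟩, fun i : Fin 1 => rank z η ((![p, q] : Fin 2 → Pt d A α) i.castSucc)⟩ ≤
        φ ⟨0, hα⟩ (fun i : Fin 2 => vertexOf ((![p, q] : Fin 2 → Pt d A α) i)) at ha
      rw [hvec, hrk] at ha
      exact ha
    · rintro ⟨-, ha⟩
      refine ⟨⟨0, hα⟩, by simp, ?_⟩
      have he := hemb (by simp)
      erw [he]
      change auxOf q ⟨⟨0, hα⟩, fun i : Fin 1 => rank z η ((![p, q] : Fin 2 → Pt d A α) i.castSucc)⟩ ≤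
        φ ⟨0, hα⟩ (fun i : Fin 2 => vertexOf ((![p, q] : Fin 2 → Pt d A α) i))
      rw [hvec, hrk]
      exact ha
  rw [edge_iff, ← hpass, ← accepted_image_iff hη hx hmono, himg]
  constructor
  · rintro ⟨-, -, h⟩
    exact h _ le_rfl (by rw [Finset.card_pair hne])
  · intro h
    refine ⟨by simp, ?_, fun ρ hρ h2 => ?_⟩
    · intro v hv
      rcases Finset.mem_insert.1 hv with rfl | hv
      · exact ⟨p, hp, rfl⟩
      · exact ⟨q, hq, (Finset.mem_singleton.1 hv).symm⟩
    · rwa [Finset.eq_of_subset_of_card_le hρ (by rwa [Finset.card_pair hne])]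

lemma edge_iff_adjacent (hη : IsNice η.1) (hα : 0 < α) {p q : Pt d A α} (hp : p ∈ points η.1)
    (hq : q ∈ points η.1) (hpq : p ≠ q) :
    Edge (complexOf z φ η.1) (vertexOf p) (vertexOf q) ↔ Adjacent z hα φ η p q := by
  rcases lt_trichotomy (timeOf p) (timeOf q) with h | h | h
  · rw [edge_of_links hη hα hp hq h, Adjacent, or_iff_left]
    exact fun h' => lt_asymm h h'.1
  · exact absurd (hη.time_injOn hp hq h) hpq
  · rw [Adjacent, or_iff_right fun h' : Links z hα φ η p q => lt_asymm h h'.1,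
      ← edge_of_links hη hα hq hp h]
    exact ⟨Edge.symm, Edge.symm⟩

end Standard

/-! ### Measurability -/

/-- A component with random index is measurable because there are only countably many indices. -/
lemma measurable_apply_index {α : ℕ} (j : Fin α) :
    Measurable fun q : AuxMark α × (Fin (j + 1) → ℕ × ℕ) => q.1 ⟨j, q.2⟩ :=
  measurable_from_prod_countable_left fun c =>
    measurable_pi_apply (X := fun _ => unitInterval)
      (⟨j, c⟩ : Σ j : Fin α, (Fin (j + 1) → ℕ × ℕ))

variable {Γ : Type*} [MeasurableSpace Γ] {η : Γ → Config d A α}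

lemma measurable_passes (hφ : IsConnectionFamily φ) (hη : Measurable η) {m : ℕ}
    {x : Γ → Fin m → Pt d A α} (hx : Measurable x) (s : Finset (Fin m)) :
    Measurable fun γ => Passes z φ (η γ) (x γ) s := by
  have hxi : ∀ i, Measurable fun γ => x γ i := fun i => (measurable_pi_apply i).comp hx
  refine Measurable.exists fun j => Measurable.exists fun h => measurableSet_setOfPred.1 ?_
  refine measurableSet_le ?_ ?_
  · refine (measurable_apply_index j).comp ((measurable_auxOf.comp (hxi _)).prodMk ?_)
    exact measurable_pi_lambda _ fun i => measurable_rank.comp (hη.prodMk (hxi _))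
  · exact (hφ.measurable j).comp (measurable_pi_lambda _ fun i => measurable_vertexOf.comp (hxi _))

lemma measurable_links (hα : 0 < α) (hφ : IsConnectionFamily φ) (hη : Measurable η)
    {p q : Γ → Pt d A α} (hp : Measurable p) (hq : Measurable q) :
    Measurable fun γ => Links z hα φ (η γ) (p γ) (q γ) := by
  refine Measurable.and (measurableSet_setOfPred.1 (measurableSet_lt (by fun_prop) (by fun_prop)))
    (measurableSet_setOfPred.1 (measurableSet_le ?_ ?_))
  · refine (measurable_apply_index ⟨0, hα⟩).comp ((measurable_auxOf.comp hq).prodMk ?_)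
    exact measurable_pi_lambda _ fun i => measurable_rank.comp (hη.prodMk hp)
  · refine (hφ.measurable _).comp (measurable_pi_lambda _ fun i => ?_)
    have h : ∀ i : Fin 2, Measurable fun γ => (![vertexOf (p γ), vertexOf (q γ)] :
        Fin 2 → Loc d × A) i := by
      intro i; fin_cases i
      · exact measurable_vertexOf.comp hp
      · exact measurable_vertexOf.comp hq
    exact h i

lemma measurable_adjacent (hα : 0 < α) (hφ : IsConnectionFamily φ) (hη : Measurable η)
    {p q : Γ → Pt d A α} (hp : Measurable p) (hq : Measurable q) :
    Measurable fun γ => Adjacent z hα φ (η γ) (p γ) (q γ) :=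
  (measurable_links hα hφ hη hp hq).or (measurable_links hα hφ hη hq hp)

end MeasurableModel

/-! ### The counting functionals as integrals over tuples -/

lemma LocFin.tupleInt_indicator {d : ℕ} {S : Type u} [MeasurableSpace S] [StandardBorelSpace S]
    (η : LocFin d S) (hs : IsSimple η.1) (m : ℕ) (T : Set (Fin m → Loc d × S)) :
    tupleInt m (T.indicator 1) η.1 = (({x ∈ T | ∀ i, x i ∈ atoms η.1}.encard : ℕ∞) : ℝ≥0∞) := by
  classical
  rw [η.tupleInt_eq_tsum hs, ← ENNReal.tsum_set_one]
  let e : {x ∈ T | ∀ i, x i ∈ atoms η.1} → (Fin m → atoms η.1) := fun x i => ⟨x.1 i, x.2.2 i⟩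
  have he : Function.Injective e := fun x y hxy => Subtype.ext <| funext fun i =>
    congrArg Subtype.val (congrFun hxy i)
  rw [← he.tsum_eq]
  · exact tsum_congr fun x => by simp [e, Set.indicator_of_mem x.2.1]
  · intro x hx
    have hxT : (fun i => (x i : Loc d × S)) ∈ T := by
      by_contra h
      exact hx (Set.indicator_of_notMem h _)
    exact ⟨⟨_, hxT, fun i => (x i).2⟩, rfl⟩

section Counting

variable {d : ℕ} {A : Type u} [MeasurableSpace A] {α : ℕ} {z : ℕ ≃ (Fin d → ℤ)}
  {φ : ∀ j : Fin α, (Fin (j + 2) → Loc d × A) → unitInterval}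
  {Y : Type*} {L : PreAbstractSimplicialComplex Y}

/-- The tuples of points over `W` in the order of time that span a complex isomorphic to `L`. -/
def copyTuples (z : ℕ ≃ (Fin d → ℤ))
    (φ : ∀ j : Fin α, (Fin (j + 2) → Loc d × A) → unitInterval)
    (L : PreAbstractSimplicialComplex Y) (m : ℕ) (W : Set (Loc d)) (η : Config d A α) :
    Set (Fin m → Pt d A α) :=
  {x | StrictMono (fun i => timeOf (x i)) ∧ (∀ i, (x i).1 ∈ W) ∧
    Isomorphic (modelComplex (Passes z φ η x)) L}

/-- The points over `W` outside a tuple that are connected with a member of the tuple. -/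
def neighbours (z : ℕ ≃ (Fin d → ℤ)) (hα : 0 < α)
    (φ : ∀ j : Fin α, (Fin (j + 2) → Loc d × A) → unitInterval) {m : ℕ}
    (W : Set (Loc d)) (η : Config d A α) (x : Fin m → Pt d A α) : Set (Pt d A α) :=
  {q | q.1 ∈ W ∧ (∀ i, q ≠ x i) ∧ ∃ i, Adjacent z hα φ η (x i) q}

/-- The tuples in `copyTuples` without connections to other points over `W`. -/
def compTuples (z : ℕ ≃ (Fin d → ℤ)) (hα : 0 < α)
    (φ : ∀ j : Fin α, (Fin (j + 2) → Loc d × A) → unitInterval)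
    (L : PreAbstractSimplicialComplex Y) (m : ℕ) (W : Set (Loc d)) (η : Config d A α) :
    Set (Fin m → Pt d A α) :=
  {x ∈ copyTuples z φ L m W η | η.1 (neighbours z hα φ W η x) = 0}

/-! ### Vertex sets correspond to tuples sorted by time. -/

section Bijection

variable [StandardBorelSpace A] {η : Config d A α}

/-- Times are distinct, so a finite vertex set has exactly one enumeration in the order of time, and
every copy is counted once. -/
lemma bijOn_copyTuples (hη : IsNice η.1) (hL : (vertexSet L).Finite) (W : Set (Loc d)) :
    Set.BijOn (fun x : Fin (vertexSet L).ncard → Pt d A α => Set.range fun i => vertexOf (x i))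
      {x ∈ copyTuples z φ L _ W η | ∀ i, x i ∈ points η.1}
      {I ∈ copies (complexOf z φ η.1) L | I ⊆ W ×ˢ Set.univ} := by
  classical
  refine ⟨?_, ?_, ?_⟩
  · rintro x ⟨⟨hmono, hW, hiso⟩, hx⟩
    refine ⟨⟨?_, (isomorphic_modelComplex hη hx hmono).symm.trans hiso⟩, ?_⟩
    · rw [vertexSet_complexOf]
      rintro _ ⟨i, rfl⟩
      exact ⟨x i, hx i, rfl⟩
    · rintro _ ⟨i, rfl⟩
      exact ⟨hW i, trivial⟩
  · rintro x ⟨⟨hmono, -, -⟩, hx⟩ y ⟨⟨hmono', -, -⟩, hy⟩ hxy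
    have hsub : ∀ {x y : Fin (vertexSet L).ncard → Pt d A α}, (∀ i, x i ∈ points η.1) →
        (∀ i, y i ∈ points η.1) → Set.range (fun i => vertexOf (x i)) =
          Set.range (fun i => vertexOf (y i)) →
        Set.range (fun i => timeOf (x i)) ⊆ Set.range (fun i => timeOf (y i)) := by
      rintro x y hx hy hxy _ ⟨i, rfl⟩
      have : vertexOf (x i) ∈ Set.range fun i => vertexOf (y i) := hxy ▸ ⟨i, rfl⟩
      obtain ⟨j, hj⟩ := this
      exact ⟨j, congrArg timeOf (hη.vertexOf_injOn (hy j) (hx i) hj)⟩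
    have := (StrictMono.range_inj hmono hmono').1
      ((hsub hx hy hxy).antisymm (hsub hy hx hxy.symm))
    exact funext fun i => hη.time_injOn (hx i) (hy i) (congrFun this i)
  · rintro I ⟨hI, hIW⟩
    obtain ⟨hIfin, hIcard⟩ := ncard_of_mem_copies hL hI
    have hIV := hI.1
    rw [vertexSet_complexOf] at hIV
    obtain ⟨Q, hQ, hQI⟩ := Set.subset_image_iff.1 hIV
    have hQinj : Set.InjOn vertexOf Q := hη.vertexOf_injOn.mono hQ
    have hQfin : Q.Finite := Set.Finite.of_finite_image (hQI ▸ hIfin) hQinj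
    let T : Finset unitInterval := hQfin.toFinset.image timeOf
    have hT : T.card = (vertexSet L).ncard := by
      rw [Finset.card_image_of_injOn, ← Set.ncard_eq_toFinset_card Q hQfin, ← hIcard, ← hQI,
        Set.InjOn.ncard_image hQinj]
      simpa using hη.time_injOn.mono hQ
    have hex : ∀ i, ∃ p ∈ Q, timeOf p = T.orderEmbOfFin hT i := fun i => by
      obtain ⟨p, hp, hpt⟩ := Finset.mem_image.1 (Finset.orderEmbOfFin_mem T hT i)
      exact ⟨p, hQfin.mem_toFinset.1 hp, hpt⟩
    choose x hxQ hxt using hex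
    have hmono : StrictMono fun i => timeOf (x i) := by
      simp only [hxt]
      exact (T.orderEmbOfFin hT).strictMono
    have hrange : Set.range (fun i => vertexOf (x i)) = I := by
      rw [← hQI]
      apply Set.Subset.antisymm
      · rintro _ ⟨i, rfl⟩
        exact ⟨x i, hxQ i, rfl⟩
      · rintro _ ⟨q, hq, rfl⟩
        have : timeOf q ∈ (T : Set unitInterval) :=
          Finset.mem_coe.2 (Finset.mem_image_of_mem _ (hQfin.mem_toFinset.2 hq))
        rw [← Finset.range_orderEmbOfFin T hT] at this
        obtain ⟨i, hi⟩ := this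
        exact ⟨i, congrArg vertexOf (hη.time_injOn (hQ (hxQ i)) (hQ hq) ((hxt i).trans hi))⟩
    refine ⟨x, ⟨⟨hmono, fun i => ?_, ?_⟩, fun i => hQ (hxQ i)⟩, hrange⟩
    · have : vertexOf (x i) ∈ I := hrange ▸ ⟨i, rfl⟩
      exact (hIW this).1
    · refine (isomorphic_modelComplex hη (fun i => hQ (hxQ i)) hmono).trans ?_
      rw [hrange]
      exact hI.2

/-- Expresses closedness by the mass of a set, which depends measurably on the configuration and the
tuple. -/
lemma closedIn_iff (hη : IsNice η.1) (hα : 0 < α) {m : ℕ} {x : Fin m → Pt d A α}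
    (hx : ∀ i, x i ∈ points η.1) {W : Set (Loc d)}
    (hmeas : MeasurableSet (neighbours z hα φ W η x)) :
    ClosedIn (Edge (complexOf z φ η.1)) (W ×ˢ Set.univ) (Set.range fun i => vertexOf (x i)) ↔
      η.1 (neighbours z hα φ W η x) = 0 := by
  rw [η.measure_eq_encard hη.simple hmeas]
  have : ((atoms η.1 ∩ neighbours z hα φ W η x).encard : ℝ≥0∞) = 0 ↔
      ∀ q ∈ points η.1, q ∉ neighbours z hα φ W η x := by
    rw [ENat.toENNReal_eq_zero, Set.encard_eq_zero, Set.eq_empty_iff_forall_notMem]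
    simp only [Set.mem_inter_iff, not_and]
    rfl
  rw [this]
  constructor
  · rintro h q hq ⟨hqW, hqx, i, hadj⟩
    obtain ⟨k, hk⟩ := h _ ⟨i, rfl⟩ (vertexOf q) ⟨hqW, trivial⟩
      ((edge_iff_adjacent hη hα (hx i) hq (hqx i).symm).2 hadj)
    exact hqx k (hη.vertexOf_injOn (hx k) hq hk).symm
  · rintro h _ ⟨i, rfl⟩ w hw hE
    have hwV := hE.mem_right
    rw [vertexSet_complexOf] at hwV
    obtain ⟨q, hq, rfl⟩ := hwV
    by_contra hnot
    have hqx : ∀ i, q ≠ x i := fun i hi => hnot ⟨i, congrArg vertexOf hi.symm⟩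
    exact h q hq ⟨hw.1, hqx, i, (edge_iff_adjacent hη hα (hx i) hq (hqx i).symm).1 hE⟩

lemma inducedCount_eq_tupleInt (hη : IsNice η.1) (hL : (vertexSet L).Finite) (W : Set (Loc d)) :
    inducedCount L (restrict (complexOf z φ η.1) (W ×ˢ Set.univ)) =
      (tupleInt _ ((copyTuples z φ L (vertexSet L).ncard W η).indicator 1) η.1).toReal := by
  rw [inducedCount_restrict, η.tupleInt_indicator hη.simple, toReal_encard,
    ← (bijOn_copyTuples hη hL W).ncard_eq]
  rfl

lemma componentCount_eq_tupleInt (hη : IsNice η.1) (hα : 0 < α) (hLc : IsConnected L)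
    (hL : (vertexSet L).Finite) (W : Set (Loc d))
    (hmeas : ∀ x : Fin (vertexSet L).ncard → Pt d A α,
      MeasurableSet (neighbours z hα φ W η x)) :
    componentCount L (restrict (complexOf z φ η.1) (W ×ˢ Set.univ)) =
      (tupleInt _ ((compTuples z hα φ L (vertexSet L).ncard W η).indicator 1) η.1).toReal := by
  rw [componentCount_restrict hLc, η.tupleInt_indicator hη.simple, toReal_encard]
  congr 1
  have hb := bijOn_copyTuples (z := z) (φ := φ) hη hL W
  have hsub : {x ∈ compTuples z hα φ L (vertexSet L).ncard W η | ∀ i, x i ∈ points η.1} ⊆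
      {x ∈ copyTuples z φ L _ W η | ∀ i, x i ∈ points η.1} := fun x hx => ⟨hx.1.1, hx.2⟩
  change _ = Set.ncard {x ∈ compTuples z hα φ L (vertexSet L).ncard W η | ∀ i, x i ∈ points η.1}
  rw [← Set.InjOn.ncard_image (hb.injOn.mono hsub)]
  symm
  congr 1
  ext I
  constructor
  · rintro ⟨x, ⟨⟨hx, h0⟩, hp⟩, rfl⟩
    obtain ⟨h1, h2⟩ := hb.mapsTo ⟨hx, hp⟩
    exact ⟨h1, h2, (closedIn_iff hη hα hp (hmeas x)).2 h0⟩
  · rintro ⟨h1, h2, h3⟩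
    obtain ⟨x, ⟨hx, hp⟩, rfl⟩ := hb.surjOn ⟨h1, h2⟩
    exact ⟨x, ⟨⟨hx, (closedIn_iff hη hα hp (hmeas x)).1 h3⟩, hp⟩, rfl⟩

end Bijection

section Meas

lemma measurable_mem_copyTuples (hφ : IsConnectionFamily φ) {m : ℕ} {W : Set (Loc d)}
    (hW : MeasurableSet W) :
    Measurable fun q : Config d A α × (Fin m → Pt d A α) => q.2 ∈ copyTuples z φ L m W q.1 := by
  have hx : ∀ i, Measurable fun q : Config d A α × (Fin m → Pt d A α) => q.2 i := fun i =>
    (measurable_pi_apply i).comp measurable_snd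
  refine Measurable.and ?_ (Measurable.and ?_ ?_)
  · refine Measurable.forall fun i => Measurable.forall fun j => Measurable.imp measurable_const ?_
    exact measurableSet_setOfPred.1 (measurableSet_lt (measurable_timeOf.comp (hx i))
      (measurable_timeOf.comp (hx j)))
  · exact Measurable.forall fun i => measurableSet_setOfPred.1
      ((measurable_fst.comp (hx i)) hW)
  · have h : Measurable fun q : Config d A α × (Fin m → Pt d A α) => Passes z φ q.1 q.2 :=
      measurable_pi_lambda _ fun s => measurable_passes hφ measurable_fst measurable_snd s
    exact (Measurable.of_discrete (f := fun Q : Finset (Fin m) → Prop =>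
      Isomorphic (modelComplex Q) L)).comp h

lemma measurable_mem_neighbours [StandardBorelSpace A] (hα : 0 < α) (hφ : IsConnectionFamily φ)
    {m : ℕ} {W : Set (Loc d)} (hW : MeasurableSet W) :
    MeasurableSet {r : (Config d A α × (Fin m → Pt d A α)) × Pt d A α |
      r.2 ∈ neighbours z hα φ W r.1.1 r.1.2} := by
  have hx : ∀ i, Measurable fun r : (Config d A α × (Fin m → Pt d A α)) × Pt d A α => r.1.2 i :=
    fun i => (measurable_pi_apply i).comp (measurable_snd.comp measurable_fst)
  refine measurableSet_setOfPred.2 (Measurable.and ?_ (Measurable.and ?_ ?_))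
  · exact measurableSet_setOfPred.1 ((measurable_fst.comp measurable_snd) hW)
  · exact Measurable.forall fun i => measurableSet_setOfPred.1
      (measurableSet_eq_fun measurable_snd (hx i)).compl
  · exact Measurable.exists fun i =>
      measurable_adjacent hα hφ (measurable_fst.comp measurable_fst) (hx i) measurable_snd

lemma measurableSet_neighbours [StandardBorelSpace A] (hα : 0 < α) (hφ : IsConnectionFamily φ)
    {m : ℕ} {W : Set (Loc d)} (hW : MeasurableSet W) (η : Config d A α)
    (x : Fin m → Pt d A α) : MeasurableSet (neighbours z hα φ W η x) :=
  (measurable_prodMk_left (x := ((η, x) : Config d A α × (Fin m → Pt d A α))))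
    (measurable_mem_neighbours hα hφ hW)

lemma measurable_mem_compTuples [StandardBorelSpace A] (hα : 0 < α) (hφ : IsConnectionFamily φ)
    {m : ℕ} {W : Set (Loc d)} (hW : MeasurableSet W) :
    Measurable fun q : Config d A α × (Fin m → Pt d A α) =>
      q.2 ∈ compTuples z hα φ L m W q.1 := by
  refine Measurable.and (measurable_mem_copyTuples hφ hW) (measurableSet_setOfPred.1 ?_)
  exact measurable_apply_locFin (Γ := Config d A α × (Fin m → Pt d A α)) (η := Prod.fst)
    measurable_fst (measurable_mem_neighbours hα hφ hW) (measurableSet_singleton 0)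

lemma measurable_tupleInt_indicator {d : ℕ} {S : Type u} [MeasurableSpace S] {m : ℕ}
    {T : LocFin d S → Set (Fin m → Loc d × S)}
    (hT : Measurable fun q : LocFin d S × (Fin m → Loc d × S) => q.2 ∈ T q.1) :
    Measurable fun η => tupleInt m ((T η).indicator 1) η.1 := by
  classical
  refine measurable_tupleInt m measurable_id (h := fun η => (T η).indicator 1) ?_
  have : (Function.uncurry fun η => (T η).indicator (1 : (Fin m → Loc d × S) → ℝ≥0∞)) =
      {q : LocFin d S × (Fin m → Loc d × S) | q.2 ∈ T q.1}.indicator 1 := by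
    ext ⟨η, x⟩
    by_cases h : x ∈ T η <;> simp [Function.uncurry, h]
  rw [this]
  exact measurable_one.indicator (measurableSet_setOfPred.2 hT)

end Meas

end Counting

/-! ### Integrals over trees -/

section TreeIntegral

variable {X : Type*} [MeasurableSpace X] (ν : Measure X) [SigmaFinite ν] {k : X → X → ℝ≥0∞}

lemma measurable_cons_apply {m : ℕ} (o : X) (j : Fin (m + 1)) :
    Measurable fun x : Fin m → X => (Fin.cons o x : Fin (m + 1) → X) j :=
  (measurable_pi_apply j).comp ((measurable_finCons m).comp (measurable_const.prodMk measurable_id))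

lemma measurable_treeProd (hk : Measurable (Function.uncurry k)) (o : X) {m : ℕ}
    (p : Fin m → Fin (m + 1)) :
    Measurable fun x : Fin m → X => ∏ i, k ((Fin.cons o x : Fin (m + 1) → X) (p i)) (x i) :=
  Finset.measurable_prod _ fun i _ =>
    hk.comp ((measurable_cons_apply o (p i)).prodMk (measurable_pi_apply i))

/-- The integral of a product over the edges of a tree is bounded by integrating the leaves
successively. -/
lemma lintegral_tree_le (hk : Measurable (Function.uncurry k)) {C : ℝ≥0∞}
    (hC : ∀ᵐ x ∂ν, ∫⁻ y, k x y ∂ν ≤ C) {o : X} (ho : ∫⁻ y, k o y ∂ν ≤ C) (m : ℕ) :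
    ∀ (p : Fin m → Fin (m + 1)) (_ : ∀ i, p i < i.succ),
      ∫⁻ x, ∏ i, k ((Fin.cons o x : Fin (m + 1) → X) (p i)) (x i)
        ∂(Measure.pi fun _ : Fin m => ν) ≤ C ^ m := by
  induction m with
  | zero => intro p _; simp
  | succ m ih =>
    intro p hp
    -- Parents precede their children, so the last point is a leaf and the remaining parents are
    -- labels of the shorter tree.
    have hp' : ∀ i : Fin m, ∃ q : Fin (m + 1), q.castSucc = p i.castSucc ∧ q < i.succ := fun i => by
      have h := hp i.castSucc
      refine ⟨⟨p i.castSucc, ?_⟩, rfl, ?_⟩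
      · have := i.2
        simp only [Fin.lt_def, Fin.val_succ, Fin.val_castSucc] at h
        omega
      · simpa [Fin.lt_def] using h
    choose q hq hqlt using hp'
    obtain ⟨l, hl⟩ : ∃ l : Fin (m + 1), l.castSucc = p (Fin.last m) := by
      have h := hp (Fin.last m)
      rw [Fin.succ_last] at h
      exact ⟨(p (Fin.last m)).castLT (by simpa [Fin.lt_def] using h), by simp⟩
    have hsplit : ∀ (y : X) (x : Fin m → X),
        ∏ i, k ((Fin.cons o ((Fin.last m).insertNth y x : Fin (m + 1) → X) : Fin (m + 2) → X) (p i))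
          (((Fin.last m).insertNth y x : Fin (m + 1) → X) i) =
        (∏ i, k ((Fin.cons o x : Fin (m + 1) → X) (q i)) (x i)) *
          k ((Fin.cons o x : Fin (m + 1) → X) l) y := fun y x => by
      rw [Fin.insertNth_last', Fin.prod_univ_castSucc, Fin.cons_snoc_eq_snoc_cons]
      simp only [← hq, ← hl, Fin.snoc_castSucc, Fin.snoc_last]
    rw [lintegral_pi_insertNth ν (Fin.last m) (measurable_treeProd hk o p)]
    simp_rw [hsplit]
    rw [lintegral_lintegral_swap]
    -- The leaf may hang at any earlier point. The kernel bound holds at almost every position of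
    -- these, and at the root by `ho`.
    · have hmark : ∀ᵐ x ∂(Measure.pi fun _ : Fin m => ν), ∀ i, ∫⁻ y, k (x i) y ∂ν ≤ C :=
        ae_all_iff.2 fun i => (Measure.tendsto_eval_ae_ae (μ := fun _ : Fin m => ν) (i := i)) hC
      calc ∫⁻ x, ∫⁻ y, (∏ i, k ((Fin.cons o x : Fin (m + 1) → X) (q i)) (x i)) *
              k ((Fin.cons o x : Fin (m + 1) → X) l) y ∂ν ∂(Measure.pi fun _ : Fin m => ν)
          ≤ ∫⁻ x, (∏ i, k ((Fin.cons o x : Fin (m + 1) → X) (q i)) (x i)) * C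
              ∂(Measure.pi fun _ : Fin m => ν) := by
            refine lintegral_mono_ae (hmark.mono fun x hx => ?_)
            have hkl : Measurable (k ((Fin.cons o x : Fin (m + 1) → X) l)) :=
              hk.comp measurable_prodMk_left
            rw [lintegral_const_mul _ hkl]
            gcongr
            refine Fin.cases ?_ (fun i => ?_) l
            · simpa using ho
            · simpa using hx i
        _ ≤ C ^ m * C := by
            rw [lintegral_mul_const _ (measurable_treeProd hk o q)]
            gcongr
            exact ih q hqlt
        _ = C ^ (m + 1) := (pow_succ _ _).symm
    · refine Measurable.aemeasurable ?_
      exact ((measurable_treeProd hk o q).comp measurable_snd).mul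
        (hk.comp (((measurable_cons_apply o l).comp measurable_snd).prodMk measurable_fst))

lemma lintegral_star (f : X → ℝ≥0∞) (hf : Measurable f) (m : ℕ) :
    ∫⁻ x, ∏ i, f (x i) ∂(Measure.pi fun _ : Fin m => ν) = (∫⁻ y, f y ∂ν) ^ m := by
  induction m with
  | zero => simp
  | succ m ih =>
    have hm : ∀ n, Measurable fun x : Fin n → X => ∏ i, f (x i) := fun n =>
      Finset.measurable_prod _ fun i _ => hf.comp (measurable_pi_apply i)
    rw [lintegral_pi_cons ν m (hm _)]
    simp_rw [Fin.prod_univ_succ, Fin.cons_zero, Fin.cons_succ]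
    simp_rw [lintegral_const_mul _ (hm m), ih]
    rw [lintegral_mul_const _ hf, pow_succ']

/-- With `X` for base points and `Y` for auxiliary marks, the mark of the root joins the other marks
while its base point `o` stays fixed. -/
lemma lintegral_pi_cons_swap {Y : Type*} [MeasurableSpace Y] (lam : Measure Y) [SigmaFinite lam]
    {m : ℕ} {F : (Fin (m + 1) → X) → (Fin (m + 1) → Y) → ℝ≥0∞}
    (hF : Measurable (Function.uncurry F)) (o : X) :
    ∫⁻ y, ∫⁻ x, ∫⁻ w, F (Fin.cons o x) (Fin.cons y w) ∂(Measure.pi fun _ : Fin m => lam)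
        ∂(Measure.pi fun _ : Fin m => ν) ∂lam =
      ∫⁻ x, ∫⁻ w, F (Fin.cons o x) w ∂(Measure.pi fun _ => lam)
        ∂(Measure.pi fun _ : Fin m => ν) := by
  have ho : Measurable fun x : Fin m → X => (Fin.cons o x : Fin (m + 1) → X) :=
    (measurable_finCons m).comp (measurable_const.prodMk measurable_id)
  rw [lintegral_lintegral_swap]
  · refine lintegral_congr fun x => ?_
    exact (lintegral_pi_cons lam m (hF.comp measurable_prodMk_left)).symm
  · refine (Measurable.lintegral_prod_right' (f := fun q : (Y × (Fin m → X)) × (Fin m → Y) =>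
        F (Fin.cons o q.1.2) (Fin.cons q.1.1 q.2)) ?_).aemeasurable
    exact hF.comp ((ho.comp (measurable_snd.comp measurable_fst)).prodMk
      ((measurable_finCons m).comp ((measurable_fst.comp measurable_fst).prodMk measurable_snd)))

end TreeIntegral

/-! ### Auxiliary marks -/

instance (α : ℕ) : IsProbabilityMeasure (auxLaw α) := by unfold auxLaw; infer_instance

/-- The marks of all points together are one family of independent uniform variables; injectivity of
`f` selects pairwise different members of it. -/
lemma pi_auxLaw {α n m : ℕ}
    (f : Fin m → Fin n × (Σ j : Fin α, (Fin (j + 1) → ℕ × ℕ))) (hf : Function.Injective f)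
    (c : Fin m → unitInterval) :
    Measure.pi (fun _ : Fin n => auxLaw α) {u | ∀ i, u (f i).1 (f i).2 ≤ c i} =
      ∏ i, ENNReal.ofReal (c i) := by
  rw [← Measure.infinitePi_eq_pi]
  have h := Measure.infinitePi_map_curry (ι := Fin n)
    (κ := Σ j : Fin α, (Fin (j + 1) → ℕ × ℕ)) (X := unitInterval)
    (fun _ _ => (volume : Measure unitInterval))
  have hset : MeasurableSet {u : Fin n → AuxMark α | ∀ i, u (f i).1 (f i).2 ≤ c i} := by
    refine measurableSet_setOfPred.2 (Measurable.forall fun i => measurableSet_setOfPred.1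
      (measurableSet_le ?_ measurable_const))
    exact (measurable_pi_apply _).comp (measurable_pi_apply _)
  have hset' : MeasurableSet (Set.pi Set.univ fun i => Set.Iic (c i)) :=
    MeasurableSet.univ_pi fun _ => measurableSet_Iic
  have h2 := Measure.map_infinitePi_infinitePi_of_inj
    (P := fun _ : Fin n × (Σ j : Fin α, (Fin (j + 1) → ℕ × ℕ)) => (volume : Measure unitInterval)) hf
  have h3 : (Measure.infinitePi fun _ : Fin n => auxLaw α) = _ := h.symm
  rw [h3, Measure.map_apply (MeasurableEquiv.measurable _) hset]
  trans (Measure.pi fun _ : Fin m => (volume : Measure unitInterval))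
    (Set.pi Set.univ fun i => Set.Iic (c i))
  · rw [← Measure.infinitePi_eq_pi]
    have h4 : (Measure.infinitePi fun _ : Fin m => (volume : Measure unitInterval)) = _ := h2.symm
    have hmeas : Measurable fun (ω : Fin n × (Σ j : Fin α, (Fin (j + 1) → ℕ × ℕ)) → unitInterval)
        (i : Fin m) => ω (f i) := measurable_pi_lambda _ fun i => measurable_pi_apply _
    rw [h4, Measure.map_apply hmeas hset']
    congr 1
    ext u
    simp
    rfl
  · rw [Measure.pi_pi]
    simp_rw [unitInterval.volume_Iic]


/-! ### Edge probabilities and the expected number of trees -/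

section TreeBound

variable {d : ℕ} {A : Type u} [MeasurableSpace A] {α : ℕ} {z : ℕ ≃ (Fin d → ℤ)}
  {φ : ∀ j : Fin α, (Fin (j + 2) → Loc d × A) → unitInterval}

/-- Positions with a mark and a time. -/
abbrev Base (d : ℕ) (A : Type u) : Type u := Loc d × (A × unitInterval)

/-- The point with a given auxiliary mark. -/
def pt (b : Base d A) (u : AuxMark α) : Pt d A α := (b.1, (b.2.1, (b.2.2, u)))

@[fun_prop]
lemma measurable_pt : Measurable fun q : Base d A × AuxMark α => pt q.1 q.2 := by
  unfold pt; fun_prop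

/-- The intensity measure without the auxiliary marks. -/
noncomputable def baseIntensity (γ : ℝ≥0) (Θ : Measure A) : Measure (Base d A) :=
  (γ • (volume : Measure (Loc d))).prod (Θ.prod (volume : Measure unitInterval))

instance (γ : ℝ≥0) (Θ : Measure A) [IsProbabilityMeasure Θ] :
    SigmaFinite (baseIntensity (d := d) γ Θ) := by unfold baseIntensity; infer_instance

instance (γ : ℝ≥0) (Θ : Measure A) [IsProbabilityMeasure Θ] :
    SigmaFinite (intensity d α γ Θ) := by unfold intensity; infer_instance

lemma measurePreserving_pt (γ : ℝ≥0) (Θ : Measure A) [IsProbabilityMeasure Θ] :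
    MeasurePreserving (fun q : Base d A × AuxMark α => pt q.1 q.2)
      ((baseIntensity γ Θ).prod (auxLaw α)) (intensity d α γ Θ) := by
  have h1 := measurePreserving_prodAssoc (γ • (volume : Measure (Loc d)))
    (Θ.prod (volume : Measure unitInterval)) (auxLaw α)
  have h2 := (MeasurePreserving.id (γ • (volume : Measure (Loc d)))).prod
    (measurePreserving_prodAssoc Θ (volume : Measure unitInterval) (auxLaw α))
  exact h2.comp h1

lemma lintegral_pi_intensity (γ : ℝ≥0) (Θ : Measure A) [IsProbabilityMeasure Θ] (m : ℕ)
    {f : (Fin m → Pt d A α) → ℝ≥0∞} (hf : Measurable f) :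
    ∫⁻ x, f x ∂(Measure.pi fun _ => intensity d α γ Θ) =
      ∫⁻ b, ∫⁻ u, f (fun i => pt (b i) (u i)) ∂(Measure.pi fun _ => auxLaw α)
        ∂(Measure.pi fun _ => baseIntensity γ Θ) := by
  have h1 := measurePreserving_pi (fun _ : Fin m => (baseIntensity (d := d) γ Θ).prod (auxLaw α))
    (fun _ => intensity d α γ Θ) (fun _ => measurePreserving_pt γ Θ)
  have h2 := (measurePreserving_arrowProdEquivProdArrow (Base d A) (AuxMark α) (Fin m)
    (fun _ => baseIntensity (d := d) γ Θ) fun _ => auxLaw α).symm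
  rw [← (h1.comp h2).lintegral_comp hf]
  exact lintegral_prod _ (hf.comp (h1.comp h2).measurable).aemeasurable

section Ranks

variable [StandardBorelSpace A]

/-- Within the same unit cube the rank of the later point `q` counts every point counted for `p`,
and in addition `q` itself. -/
lemma rank_ne_of_lt (η : Config d A α) {p q : Pt d A α} (hq : q ∈ points η.1)
    (ht : timeOf p < timeOf q) : rank z η p ≠ rank z η q := by
  intro h
  have h1 : cubeIndex z p.1 = cubeIndex z q.1 := congrArg Prod.fst h
  have h2 : ⌊(η.1 (earlier z p)).toReal⌋₊ = ⌊(η.1 (earlier z q)).toReal⌋₊ := congrArg Prod.snd h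
  have hdisj : Disjoint (earlier z p) {q} :=
    Set.disjoint_singleton_right.2 fun hq' => not_le.2 ht hq'.2
  have hle : η.1 (earlier z p) + 1 ≤ η.1 (earlier z q) := by
    calc η.1 (earlier z p) + 1 ≤ η.1 (earlier z p) + η.1 {q} := by
          gcongr; exact η.one_le (measurableSet_singleton q) hq
      _ = η.1 (earlier z p ∪ {q}) := (measure_union hdisj (measurableSet_singleton q)).symm
      _ ≤ η.1 (earlier z q) := measure_mono (Set.union_subset
          (fun r hr => ⟨hr.1.trans h1, hr.2.trans ht.le⟩)
          (Set.singleton_subset_iff.2 ⟨rfl, le_rfl⟩))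
  have hreal : (η.1 (earlier z p)).toReal + 1 ≤ (η.1 (earlier z q)).toReal := by
    rw [← ENNReal.toReal_one, ← ENNReal.toReal_add (earlier_lt_top η p).ne ENNReal.one_ne_top]
    exact ENNReal.toReal_mono (earlier_lt_top η q).ne hle
  have := Nat.floor_mono hreal
  rw [Nat.floor_add_one ENNReal.toReal_nonneg] at this
  omega

lemma rank_ne (η : Config d A α) {p q : Pt d A α} (hp : p ∈ points η.1) (hq : q ∈ points η.1)
    (ht : timeOf p ≠ timeOf q) : rank z η p ≠ rank z η q := by
  rcases lt_or_gt_of_ne ht with h | h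
  · exact rank_ne_of_lt η hq h
  · exact (rank_ne_of_lt η hp h).symm

lemma mem_points_addTuple (η : Config d A α) {n : ℕ} (y : Fin n → Pt d A α) (i : Fin n) :
    y i ∈ points (η.addTuple y).1 := by
  rw [points, Set.mem_ofPred_eq, η.addTuple_val]
  intro h
  rw [Measure.add_apply, add_eq_zero, Measure.finsetSum_apply] at h
  have := (Finset.sum_eq_zero_iff.1 h.2) i (Finset.mem_univ i)
  simp at this

/-- Coordinates depend on positions and times only. Given these, the components used in the tests
have deterministic indices, also for the added points. -/
lemma rank_addTuple (η : Config d A α) {n : ℕ} (b : Fin n → Base d A) (u u' : Fin n → AuxMark α)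
    (i : Fin n) :
    rank z (η.addTuple fun k => pt (b k) (u k)) (pt (b i) (u i)) =
      rank z (η.addTuple fun k => pt (b k) (u' k)) (pt (b i) (u' i)) := by
  have hset : earlier z (pt (b i) (u i) : Pt d A α) = earlier z (pt (b i) (u' i)) := rfl
  have hmass : (η.addTuple fun k => pt (b k) (u k)).1 (earlier z (pt (b i) (u i))) =
      (η.addTuple fun k => pt (b k) (u' k)).1 (earlier z (pt (b i) (u' i))) := by
    rw [hset, η.addTuple_val, η.addTuple_val, Measure.add_apply, Measure.add_apply,
      Measure.finsetSum_apply, Measure.finsetSum_apply]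
    congr 1
    refine Finset.sum_congr rfl fun k _ => ?_
    rw [Measure.dirac_apply' _ (measurableSet_earlier _),
      Measure.dirac_apply' _ (measurableSet_earlier _)]
    rfl
  rw [rank, rank, hmass]
  rfl

end Ranks

/-- The tuples of points with distinct times in which every point is connected to its parent. -/
def treeTuples (z : ℕ ≃ (Fin d → ℤ)) (hα : 0 < α)
    (φ : ∀ j : Fin α, (Fin (j + 2) → Loc d × A) → unitInterval) {m : ℕ}
    (par : Fin m → Fin (m + 1)) (η : Config d A α) : Set (Fin (m + 1) → Pt d A α) :=
  {y | Function.Injective (fun i => timeOf (y i)) ∧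
    ∀ i, Adjacent z hα φ η (y (par i)) (y i.succ)}

lemma measurable_mem_treeTuples (hα : 0 < α) (hφ : IsConnectionFamily φ) {m : ℕ}
    (par : Fin m → Fin (m + 1)) :
    Measurable fun q : Config d A α × (Fin (m + 1) → Pt d A α) =>
      q.2 ∈ treeTuples z hα φ par q.1 := by
  have hx : ∀ i, Measurable fun q : Config d A α × (Fin (m + 1) → Pt d A α) => q.2 i := fun i =>
    (measurable_pi_apply i).comp measurable_snd
  refine Measurable.and ?_ (Measurable.forall fun i =>
    measurable_adjacent hα hφ measurable_fst (hx _) (hx _))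
  refine Measurable.forall fun i => Measurable.forall fun j => Measurable.imp ?_ measurable_const
  exact measurableSet_setOfPred.1 (measurableSet_eq_fun (measurable_timeOf.comp (hx i))
    (measurable_timeOf.comp (hx j)))

/-- The edge probability as a kernel on positions with a mark and a time. -/
noncomputable def edgeKernel (hα : 0 < α)
    (φ : ∀ j : Fin α, (Fin (j + 2) → Loc d × A) → unitInterval) (b b' : Base d A) : ℝ≥0∞ :=
  ENNReal.ofReal (φ ⟨0, hα⟩ ![(b.1, b.2.1), (b'.1, b'.2.1)])

lemma symmetric_pair (hφ : IsConnectionFamily φ) (hα : 0 < α) (v w : Loc d × A) :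
    φ ⟨0, hα⟩ ![v, w] = φ ⟨0, hα⟩ ![w, v] := by
  rw [← hφ.symmetric ⟨0, hα⟩ (Equiv.swap (0 : Fin 2) 1) ![v, w]]
  congr 1
  funext i
  revert i
  exact Fin.forall_fin_two.2 ⟨rfl, rfl⟩

/-- An edge is tested with the component of the later endpoint's mark that is indexed by the
coordinates of the earlier endpoint. Distinct tree edges use distinct components, so the tests are
independent. -/
lemma pi_auxLaw_treeTuples_le [StandardBorelSpace A] (hα : 0 < α) (hφ : IsConnectionFamily φ)
    {m : ℕ} {par : Fin m → Fin (m + 1)} (hpar : ∀ i, par i < i.succ) (η : Config d A α)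
    (b : Fin (m + 1) → Base d A) :
    Measure.pi (fun _ => auxLaw α) {u : Fin (m + 1) → AuxMark α | (fun k => pt (b k) (u k)) ∈
      treeTuples z hα φ par (η.addTuple fun k => pt (b k) (u k))} ≤
      ∏ i : Fin m, edgeKernel hα φ (b (par i)) (b i.succ) := by
  classical
  by_cases ht : Function.Injective fun i => (b i).2.2
  swap
  · refine le_of_eq_of_le (b := 0) (measure_mono_null (t := ∅) (fun u hu => ?_) measure_empty)
      zero_le
    exact ht hu.1
  -- Reference marks: by `rank_addTuple` the coordinates may be computed with any marks.
  let u₀ : Fin (m + 1) → AuxMark α := fun _ _ => 0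
  let y₀ : Fin (m + 1) → Pt d A α := fun k => pt (b k) (u₀ k)
  let rk : Fin (m + 1) → ℕ × ℕ := fun k => rank z (η.addTuple y₀) (y₀ k)
  have hrk : Function.Injective rk := fun k l hkl => by
    by_contra hne
    exact rank_ne (η.addTuple y₀) (mem_points_addTuple η y₀ k) (mem_points_addTuple η y₀ l)
      (fun h => hne (ht h)) hkl
  let early : Fin m → Fin (m + 1) := fun i =>
    if (b (par i)).2.2 < (b i.succ).2.2 then par i else i.succ
  let late : Fin m → Fin (m + 1) := fun i =>
    if (b (par i)).2.2 < (b i.succ).2.2 then i.succ else par i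
  -- The child has the larger label, so it is recovered from the pair of endpoints; this gives
  -- injectivity of `f`.
  have hmax : ∀ i, max (early i) (late i) = i.succ := fun i => by
    by_cases h : (b (par i)).2.2 < (b i.succ).2.2
    · simp only [early, late, if_pos h]; exact max_eq_right (hpar i).le
    · simp only [early, late, if_neg h]; exact max_eq_left (hpar i).le
  let f : Fin m → Fin (m + 1) × (Σ j : Fin α, (Fin (j + 1) → ℕ × ℕ)) := fun i =>
    (late i, ⟨⟨0, hα⟩, fun _ => rk (early i)⟩)
  have hf : Function.Injective f := fun i j hij => by
    have h1 : late i = late j := congrArg Prod.fst hij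
    have h2 := congrArg Prod.snd hij
    simp only [f, Sigma.mk.injEq, heq_eq_eq, true_and] at h2
    have h3 : early i = early j := hrk (congrFun h2 0)
    have h4 : i.succ = j.succ := by rw [← hmax i, ← hmax j, h1, h3]
    exact Fin.succ_injective _ h4
  have hp := pi_auxLaw f hf fun i =>
    φ ⟨0, hα⟩ ![((b (par i)).1, (b (par i)).2.1), ((b i.succ).1, (b i.succ).2.1)]
  refine le_of_le_of_eq ?_ hp
  refine measure_mono fun u hu => ?_
  intro i
  have hr : ∀ k, rank z (η.addTuple fun k => pt (b k) (u k)) (pt (b k) (u k)) = rk k := fun k =>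
    rank_addTuple η b u u₀ k
  rcases hu.2 i with ⟨hlt, hle⟩ | ⟨hlt, hle⟩
  · have hlt' : (b (par i)).2.2 < (b i.succ).2.2 := hlt
    rw [hr] at hle
    simp only [f, early, late, if_pos hlt']
    exact hle
  · have hlt' : ¬ (b (par i)).2.2 < (b i.succ).2.2 := not_lt.2 (le_of_lt hlt)
    rw [hr, symmetric_pair hφ] at hle
    simp only [f, early, late, if_neg hlt']
    exact hle

lemma measurable_edgeKernel (hα : 0 < α) (hφ : IsConnectionFamily φ) :
    Measurable (Function.uncurry (edgeKernel hα φ)) := by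
  refine ENNReal.measurable_ofReal.comp (measurable_subtype_coe.comp
    ((hφ.measurable _).comp (measurable_pi_lambda _ fun i => ?_)))
  have h : ∀ i : Fin 2, Measurable fun q : Base d A × Base d A =>
      (![(q.1.1, q.1.2.1), (q.2.1, q.2.2.1)] : Fin 2 → Loc d × A) i :=
    Fin.forall_fin_two.2 ⟨by simp; fun_prop, by simp; fun_prop⟩
  exact h i

/-- Translation invariance moves the base point to the origin, and the time, which the kernel
ignores, integrates to 1. -/
lemma lintegral_edgeKernel (hα : 0 < α) (hφ : IsConnectionFamily φ) (γ : ℝ≥0) (Θ : Measure A)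
    [IsProbabilityMeasure Θ] (b : Base d A) :
    ∫⁻ b', edgeKernel hα φ b b' ∂(baseIntensity γ Θ) = mixingParameter hα γ φ Θ b.2.1 := by
  have hm : Measurable (edgeKernel hα φ b) := (measurable_edgeKernel hα hφ).comp measurable_prodMk_left
  have hshift : ∀ (x : Loc d) (a : A), edgeKernel hα φ b (x, a, 0) =
      edgeKernel hα φ (0, b.2) (x - b.1, a, 0) := fun x a => by
    have := hφ.translation_invariant ⟨0, hα⟩ ![((0 : Loc d), b.2.1), (x - b.1, a)] b.1
    rw [edgeKernel, edgeKernel, ← this]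
    congr 3
    funext i
    revert i
    exact Fin.forall_fin_two.2 ⟨by simp, by simp⟩
  rw [baseIntensity, lintegral_prod _ hm.aemeasurable, lintegral_smul_measure, mixingParameter,
    edgeIntegral, ENNReal.smul_def, smul_eq_mul]
  congr 1
  have hinner : ∀ x : Loc d, ∫⁻ c, edgeKernel hα φ b (x, c) ∂(Θ.prod (volume : Measure unitInterval)) =
      ∫⁻ a, edgeKernel hα φ (0, b.2) (x - b.1, a, 0) ∂Θ := fun x => by
    have hmx : Measurable fun c : A × unitInterval => edgeKernel hα φ b (x, c) :=
      hm.comp measurable_prodMk_left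
    rw [lintegral_prod _ hmx.aemeasurable]
    refine lintegral_congr fun a => ?_
    have : ∀ t : unitInterval, edgeKernel hα φ b (x, a, t) = edgeKernel hα φ b (x, a, 0) :=
      fun _ => rfl
    simp_rw [this, lintegral_const, measure_univ, mul_one]
    exact hshift x a
  simp_rw [hinner]
  exact lintegral_sub_right_eq_self
    (fun x : Loc d => ∫⁻ a, edgeKernel hα φ (0, b.2) (x, a, 0) ∂Θ) b.1

variable [StandardBorelSpace A] {Ω : Type*} [MeasurableSpace Ω] {P : Measure Ω}
  [IsProbabilityMeasure P] {Ψ : Ω → Measure (Pt d A α)} {γ : ℝ≥0} {Θ : Measure A}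
  [IsProbabilityMeasure Θ]

lemma intensity_box (n : ℕ) : intensity d α γ Θ (box d _ n) < ∞ := by
  rw [intensity, box, Measure.prod_prod, measure_univ, mul_one]
  exact (IsFiniteMeasureOnCompacts.lt_top_of_isCompact (isCompact_closedBall (0 : Loc d) n)).trans_le'
    (measure_mono Metric.ball_subset_closedBall)

/-- The expected number of embedded trees rooted at an additional point at the origin. -/
lemma lintegral_treeTuples_le (hΨ : IsPoissonProcess P Ψ (intensity d α γ Θ)) (hα : 0 < α)
    (hφ : IsConnectionFamily φ) {m : ℕ} {par : Fin m → Fin (m + 1)} (hpar : ∀ i, par i < i.succ)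
    (o : Base d A) :
    ∫⁻ u, ∫⁻ ω, tupleInt m ({x : Fin m → Pt d A α | Fin.cons (pt o u) x ∈
        treeTuples z hα φ par ((hΨ.toLocFin ω).add (pt o u))}.indicator 1) (Ψ ω) ∂P ∂(auxLaw α) ≤
      ∫⁻ b, ∏ i, edgeKernel hα φ ((Fin.cons o b : Fin (m + 1) → Base d A) (par i)) (b i)
        ∂(Measure.pi fun _ => baseIntensity γ Θ) := by
  classical
  let T : Set (Config d A α × (Fin (m + 1) → Pt d A α)) := {q | q.2 ∈ treeTuples z hα φ par q.1}
  have hT : MeasurableSet T := measurableSet_setOfPred.2 (measurable_mem_treeTuples hα hφ par)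
  obtain ⟨G, hGdef⟩ : ∃ G : (Fin (m + 1) → Base d A) → (Fin (m + 1) → AuxMark α) → Ω → ℝ≥0∞,
    G = fun b u ω => T.indicator 1
      ((hΨ.toLocFin ω).addTuple fun k => pt (b k) (u k), fun k => pt (b k) (u k)) := ⟨_, rfl⟩
  have hpts : Measurable fun q : (Fin (m + 1) → Base d A) × (Fin (m + 1) → AuxMark α) =>
      (fun k => pt (q.1 k) (q.2 k) : Fin (m + 1) → Pt d A α) :=
    measurable_pi_lambda _ fun k => measurable_pt.comp
      (f := fun q : (Fin (m + 1) → Base d A) × (Fin (m + 1) → AuxMark α) => (q.1 k, q.2 k))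
      (((measurable_pi_apply k).comp measurable_fst).prodMk
        ((measurable_pi_apply k).comp measurable_snd))
  have hG : Measurable fun q : ((Fin (m + 1) → Base d A) × (Fin (m + 1) → AuxMark α)) × Ω =>
      G q.1.1 q.1.2 q.2 := by
    rw [hGdef]
    refine (measurable_one.indicator hT).comp (Measurable.prodMk ?_ (hpts.comp measurable_fst))
    exact (measurable_addTuple (m + 1)).comp ((hΨ.measurable_toLocFin.comp measurable_snd).prodMk
      (hpts.comp measurable_fst))
  have hGω : Measurable fun q : (Fin (m + 1) → Base d A) × (Fin (m + 1) → AuxMark α) =>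
      ∫⁻ ω, G q.1 q.2 ω ∂P := Measurable.lintegral_prod_right' hG
  have hcons : ∀ (b : Fin m → Base d A) (u₀ : AuxMark α) (u : Fin m → AuxMark α),
      (Fin.cons (pt o u₀) (fun i => pt (b i) (u i)) : Fin (m + 1) → Pt d A α) =
      fun k => pt ((Fin.cons o b : Fin (m + 1) → Base d A) k)
        ((Fin.cons u₀ u : Fin (m + 1) → AuxMark α) k) := fun b u₀ u => by
    funext k
    refine Fin.cases ?_ (fun i => ?_) k <;> simp
  -- The Mecke equation applies because a repeated point would repeat a time, which `treeTuples`
  -- excludes.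
  have hmecke : ∀ u₀ : AuxMark α,
      ∫⁻ ω, tupleInt m ({x : Fin m → Pt d A α | Fin.cons (pt o u₀) x ∈
        treeTuples z hα φ par ((hΨ.toLocFin ω).add (pt o u₀))}.indicator 1) (Ψ ω) ∂P =
      ∫⁻ b, ∫⁻ u, ∫⁻ ω, G (Fin.cons o b) (Fin.cons u₀ u) ω ∂P ∂(Measure.pi fun _ => auxLaw α)
        ∂(Measure.pi fun _ => baseIntensity γ Θ) := fun u₀ => by
    obtain ⟨H, hHdef⟩ : ∃ H : Config d A α → (Fin m → Pt d A α) → ℝ≥0∞, H = fun η x =>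
      T.indicator 1 (η.add (pt o u₀), Fin.cons (pt o u₀) x) := ⟨_, rfl⟩
    have hH : Measurable (Function.uncurry H) := by
      rw [hHdef]
      refine (measurable_one.indicator hT).comp (Measurable.prodMk ?_ ?_)
      · exact measurable_locFin_add.comp (measurable_fst.prodMk measurable_const)
      · exact (measurable_finCons m).comp (measurable_const.prodMk measurable_snd)
    have h0 : ∀ η x, ¬ Function.Injective x → H η x = 0 := fun η x hx => by
      rw [hHdef]
      refine Set.indicator_of_notMem (fun hmem => hx fun i j hij => ?_) _
      have := hmem.1 (a₁ := i.succ) (a₂ := j.succ) (by simp [hij])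
      exact Fin.succ_injective _ this
    have h1 := hΨ.mecke_tuple intensity_box m hH h0
    have h2 : ∀ ω, {x : Fin m → Pt d A α | Fin.cons (pt o u₀) x ∈
        treeTuples z hα φ par ((hΨ.toLocFin ω).add (pt o u₀))}.indicator 1 = H (hΨ.toLocFin ω) :=
      fun _ => by rw [hHdef]; rfl
    simp_rw [h2]
    rw [h1, lintegral_pi_intensity γ Θ m]
    -- Adding the tuple first and the root afterwards is, by definition of `addTuple`, adding the
    -- tuple with the root in front.
    · refine lintegral_congr fun b => lintegral_congr fun u => lintegral_congr fun ω => ?_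
      simp only [hHdef, hGdef, ← hcons]
      rfl
    · refine Measurable.lintegral_prod_right' (f := fun q : (Fin m → Pt d A α) × Ω =>
        H ((hΨ.toLocFin q.2).addTuple q.1) q.1) ?_
      exact hH.comp (((measurable_addTuple m).comp
        ((hΨ.measurable_toLocFin.comp measurable_snd).prodMk measurable_fst)).prodMk measurable_fst)
  simp_rw [hmecke]
  rw [lintegral_pi_cons_swap (baseIntensity γ Θ) (auxLaw α) (F := fun b u => ∫⁻ ω, G b u ω ∂P) hGω o]
  refine lintegral_mono fun b => ?_
  rw [lintegral_lintegral_swap]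
  swap
  · exact (hG.comp (f := fun q : (Fin (m + 1) → AuxMark α) × Ω => ((Fin.cons o b, q.1), q.2))
      ((measurable_const.prodMk measurable_fst).prodMk measurable_snd)).aemeasurable
  -- With the Poisson configuration and the base points fixed, only the auxiliary marks of the tree
  -- are random.
  have hbound : ∀ ω, ∫⁻ u, G (Fin.cons o b) u ω ∂(Measure.pi fun _ => auxLaw α) ≤
      ∏ i, edgeKernel hα φ ((Fin.cons o b : Fin (m + 1) → Base d A) (par i)) (b i) := fun ω => by
    refine le_of_eq_of_le ?_ (pi_auxLaw_treeTuples_le (z := z) hα hφ hpar (hΨ.toLocFin ω)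
      (Fin.cons o b))
    rw [hGdef, ← lintegral_indicator_one]
    · rfl
    · exact ((measurable_addTuple (m + 1)).comp (measurable_const.prodMk
        (hpts.comp measurable_prodMk_left))).prodMk (hpts.comp measurable_prodMk_left) hT
  calc _ ≤ ∫⁻ _, ∏ i, edgeKernel hα φ ((Fin.cons o b : Fin (m + 1) → Base d A) (par i)) (b i) ∂P :=
        lintegral_mono hbound
    _ = _ := by rw [lintegral_const, measure_univ, mul_one]

end TreeBound

/-! ### Trees in the random complex -/

section TreeVertices

variable {X : Type*} {E : X → X → Prop}

/-- Tuples of distinct points different from `o`, each of them joined to its parent. -/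
def treeVertices (E : X → X → Prop) (o : X) {m : ℕ} (par : Fin m → Fin (m + 1)) :
    Set (Fin m → X) :=
  {x | Function.Injective (Fin.cons o x : Fin (m + 1) → X) ∧
    ∀ i, E ((Fin.cons o x : Fin (m + 1) → X) (par i)) (x i)}

/-- The parent maps of trees in which parents precede their children. -/
def parentMaps (m : ℕ) : Finset (Fin m → Fin (m + 1)) := {par | ∀ i, par i < i.succ}

lemma encard_growTuples_le (E : X → X → Prop) (o : X) (m : ℕ) :
    (growTuples E o m).encard ≤ ∑ par ∈ parentMaps m, (treeVertices E o par).encard := by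
  have hsub : growTuples E o m ⊆ ⋃ par ∈ parentMaps m, treeVertices E o par := by
    rintro x ⟨hx, hp⟩
    choose par hlt hE using hp
    exact Set.mem_biUnion (x := par) (by simpa [parentMaps] using hlt) ⟨hx, hE⟩
  exact (Set.encard_le_encard hsub).trans (Finset.set_encard_biUnion_le _ _)

/-- The general bound with `r = 1` is applied to the pairs `{o, v}` and to the relation `E'` that
keeps only edges starting at `o`. Its growing tuples are stars, which keeps moments of other
vertices out of the bound. -/
lemma encard_neighbours_pow_three_le (hE : ∀ v w, E v w → E w v) (o : X) :
    {v | v ≠ o ∧ E v o}.encard ^ 3 ≤ ∑ m ∈ Finset.range 4,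
      (treeVertices E o (fun _ : Fin m => (0 : Fin (m + 1)))).encard * (8 : ℕ∞) ^ m := by
  let E' : X → X → Prop := fun v w => v = o ∧ E v w
  have hinj : Set.InjOn (fun v => ({o, v} : Set X)) {v | v ≠ o ∧ E v o} := fun v hv w _ hvw => by
    have : v ∈ ({o, w} : Set X) := by
      rw [← show ({o, v} : Set X) = {o, w} from hvw]; exact Or.inr rfl
    rcases this with h | h
    · exact absurd h hv.1
    · exact h
  rw [← hinj.encard_image]
  refine (encard_pow_three_le (E := E') (o := o) (r := 1) _ ?_).trans ?_
  · rintro _ ⟨v, ⟨hvo, hv⟩, rfl⟩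
    refine ⟨Or.inl rfl, ?_, Set.toFinite _, Set.ncard_pair hvo.symm⟩
    have := (spans_singleton (E := E') o).insert rfl rfl (w := v) ⟨rfl, hE _ _ hv⟩
    rwa [Set.pair_comm] at this
  · refine Finset.sum_le_sum fun m _ => mul_le_mul' (Set.encard_le_encard ?_) le_rfl
    rintro x ⟨hx, hp⟩
    refine ⟨hx, fun i => ?_⟩
    obtain ⟨j, -, h1, h2⟩ := hp i
    obtain rfl : j = 0 := hx (h1.trans (Fin.cons_zero (α := fun _ => X) o x).symm)
    exact h2

lemma compSets_congr {L : Set (Set X)} {V S S' : Set X} (hL : ∀ I ∈ L, I ⊆ V)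
    (hV : ∀ v w, E v w → w ∈ V) (h : ∀ v ∈ V, v ∈ S ↔ v ∈ S') :
    compSets E L S = compSets E L S' := by
  ext I
  refine and_congr_right fun hI => and_congr ?_ ?_
  · exact forall₂_congr fun v hv => h v (hL I hI hv)
  · refine forall₂_congr fun v _ => ⟨fun hc w hw hvw => ?_, fun hc w hw hvw => ?_⟩
    · exact hc w ((h w (hV v w hvw)).2 hw) hvw
    · exact hc w ((h w (hV v w hvw)).1 hw) hvw

end TreeVertices

/-! ### Bounds and stabilization for a fixed configuration -/

section Pathwise

variable {d : ℕ} {A : Type u} [MeasurableSpace A] [StandardBorelSpace A] {α : ℕ}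
  {z : ℕ ≃ (Fin d → ℤ)} {φ : ∀ j : Fin α, (Fin (j + 2) → Loc d × A) → unitInterval}
  {Y : Type*} {L : PreAbstractSimplicialComplex Y} {ψ : Config d A α} {o : Pt d A α}

lemma mem_points_add (ψ : Config d A α) (o p : Pt d A α) :
    p ∈ points (ψ.add o).1 ↔ p = o ∨ p ∈ points ψ.1 := by
  simp only [points, LocFin.add, Set.mem_ofPred_eq, Measure.add_apply, ne_eq, add_eq_zero,
    not_and_or]
  rw [Measure.dirac_apply' _ (measurableSet_singleton p), or_comm]
  by_cases h : o = p
  · simp [h]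
  · simp [h, Ne.symm h]

/-- The number of trees with a given parent map in the configuration with the additional root `o`. -/
noncomputable def treeCount (z : ℕ ≃ (Fin d → ℤ)) (hα : 0 < α)
    (φ : ∀ j : Fin α, (Fin (j + 2) → Loc d × A) → unitInterval) {m : ℕ}
    (par : Fin m → Fin (m + 1)) (o : Pt d A α) (ψ : Config d A α) : ℝ≥0∞ :=
  tupleInt m ({x : Fin m → Pt d A α | Fin.cons o x ∈
    treeTuples z hα φ par (ψ.add o)}.indicator 1) ψ.1

/-- The vertices are lifted to points. Being different from the root, these belong to `ψ` itself, so
the trees are counted by an integral with respect to `ψ`. -/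
lemma encard_treeVertices_le (hs : IsSimple ψ.1) (hη : IsNice (ψ.add o).1) (hα : 0 < α) {m : ℕ}
    {par : Fin m → Fin (m + 1)} (hpar : ∀ i, par i < i.succ) :
    ((treeVertices (Edge (complexOf z φ (ψ.add o).1)) (vertexOf o) par).encard : ℝ≥0∞) ≤
      treeCount z hα φ par o ψ := by
  let T : Set (Fin m → Pt d A α) :=
    {y | (∀ i, y i ∈ atoms ψ.1) ∧ Fin.cons o y ∈ treeTuples z hα φ par (ψ.add o)}
  have hsub : treeVertices (Edge (complexOf z φ (ψ.add o).1)) (vertexOf o) par ⊆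
      (fun (y : Fin m → Pt d A α) i => vertexOf (y i)) '' T := by
    rintro x ⟨hx, hE⟩
    have hex : ∀ i, ∃ p ∈ points (ψ.add o).1, vertexOf p = x i := fun i => by
      have := (hE i).mem_right
      rwa [vertexSet_complexOf] at this
    choose y hy hyx using hex
    have hcons : (Fin.cons (vertexOf o) x : Fin (m + 1) → Loc d × A) =
        fun k => vertexOf ((Fin.cons o y : Fin (m + 1) → Pt d A α) k) := by
      funext k
      refine Fin.cases ?_ (fun i => ?_) k
      · simp
      · simp [hyx]
    rw [hcons] at hx hE
    have hpts : ∀ k, (Fin.cons o y : Fin (m + 1) → Pt d A α) k ∈ points (ψ.add o).1 := fun k => by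
      refine Fin.cases ?_ (fun i => ?_) k
      · exact (mem_points_add ψ o _).2 (Or.inl (by simp))
      · simpa using hy i
    have hinj : Function.Injective (Fin.cons o y : Fin (m + 1) → Pt d A α) := fun k l h =>
      hx (congrArg vertexOf h)
    refine ⟨y, ⟨fun i => ?_, fun k l h => hinj (hη.time_injOn (hpts k) (hpts l) h), fun i => ?_⟩,
      funext hyx⟩
    · refine ((mem_points_add ψ o _).1 (hy i)).resolve_left fun h => ?_
      have := hinj (a₁ := i.succ) (a₂ := 0) (by simp [h])
      exact Fin.succ_ne_zero i this
    · have hEi := hE i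
      rw [← hyx i] at hEi
      have hy' : y i = (Fin.cons o y : Fin (m + 1) → Pt d A α) i.succ := by simp
      rw [hy'] at hEi
      exact (edge_iff_adjacent hη hα (hpts _) (hpts _) fun h => (hpar i).ne (hinj h)).1 hEi
  calc ((treeVertices (Edge (complexOf z φ (ψ.add o).1)) (vertexOf o) par).encard : ℝ≥0∞)
      ≤ (T.encard : ℝ≥0∞) := by
        exact ENat.toENNReal_mono ((Set.encard_le_encard hsub).trans (Set.encard_image_le _ _))
    _ ≤ _ := ψ.encard_le_tupleInt hs m _ T fun y hy =>
        ⟨hy.1, (Set.indicator_of_mem (s := {x : Fin m → Pt d A α | Fin.cons o x ∈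
          treeTuples z hα φ par (ψ.add o)}) hy.2 1).ge⟩

/-- Since positions are distinct, removing the position of `o` from the window removes no other
vertex. -/
lemma mem_diff_origin_iff (hη : IsNice (ψ.add o).1) (W : Set (Loc d)) {v : Loc d × A}
    (hv : v ∈ vertexSet (complexOf z φ (ψ.add o).1)) :
    v ∈ (W \ {o.1}) ×ˢ (Set.univ : Set A) ↔ v ∈ W ×ˢ (Set.univ : Set A) \ {vertexOf o} := by
  rw [vertexSet_complexOf] at hv
  obtain ⟨p, hp, rfl⟩ := hv
  have : p.1 = o.1 ↔ vertexOf p = vertexOf o := by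
    constructor
    · intro h
      rw [hη.position_injOn hp ((mem_points_add ψ o o).2 (Or.inl rfl)) h]
    · exact fun h => congrArg (fun v : Loc d × A => v.1) h
  change (p.1 ∈ W ∧ ¬ p.1 = o.1) ∧ True ↔ (p.1 ∈ W ∧ True) ∧ ¬ vertexOf p = vertexOf o
  rw [this]
  tauto

lemma finite_copies (η : Config d A α) {W : Set (Loc d)} (hW : MeasurableSet W)
    (hb : Bornology.IsBounded W) :
    {I ∈ copies (complexOf z φ η.1) L | I ⊆ W ×ˢ Set.univ}.Finite := by
  have h := ((η.finite_atoms_inter (η.2.2 W hW hb)).image vertexOf).finite_subsets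
  refine h.subset fun I hI v hv => ?_
  have hv' := hI.1.1 hv
  rw [vertexSet_complexOf] at hv'
  obtain ⟨p, hp, rfl⟩ := hv'
  exact ⟨p, ⟨hp, hI.2 hv⟩, rfl⟩

lemma diffOp_inducedCount (hη : IsNice (ψ.add o).1) {W : Set (Loc d)} (hW : MeasurableSet W)
    (hb : Bornology.IsBounded W) :
    diffOp z φ (inducedCount L) ψ.1 o W = {I ∈ copies (complexOf z φ (ψ.add o).1) L |
      I ⊆ W ×ˢ Set.univ ∧ vertexOf o ∈ I}.ncard := by
  have hdiff : {I ∈ copies (complexOf z φ (ψ.add o).1) L | I ⊆ (W \ {o.1}) ×ˢ Set.univ} =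
      {I ∈ copies (complexOf z φ (ψ.add o).1) L | I ⊆ W ×ˢ Set.univ \ {vertexOf o}} := by
    ext I
    exact and_congr_right fun hI =>
      forall₂_congr fun v hv => mem_diff_origin_iff hη W (hI.1 hv)
  rw [← ncard_sub_ncard_of_subset (finite_copies (ψ.add o) hW hb), ← hdiff,
    ← inducedCount_restrict, ← inducedCount_restrict]
  rfl

lemma diffOp_componentCount (hL : IsConnected L) (hη : IsNice (ψ.add o).1) (W : Set (Loc d)) :
    diffOp z φ (componentCount L) ψ.1 o W =
      (compSets (Edge (complexOf z φ (ψ.add o).1)) (copies (complexOf z φ (ψ.add o).1) L)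
        (W ×ˢ Set.univ)).ncard -
      (compSets (Edge (complexOf z φ (ψ.add o).1)) (copies (complexOf z φ (ψ.add o).1) L)
        (W ×ˢ Set.univ \ {vertexOf o})).ncard := by
  rw [← compSets_congr (E := Edge (complexOf z φ (ψ.add o).1)) (S := (W \ {o.1}) ×ˢ Set.univ)
    (V := vertexSet (complexOf z φ (ψ.add o).1)) (fun I hI => hI.1) (fun v w h => h.mem_right)
    fun v hv => mem_diff_origin_iff hη W hv, ← componentCount_restrict hL,
    ← componentCount_restrict hL]
  rfl

lemma finite_compSets (η : Config d A α) {W : Set (Loc d)} (hW : MeasurableSet W)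
    (hb : Bornology.IsBounded W) (E : Loc d × A → Loc d × A → Prop) {S : Set (Loc d × A)}
    (hS : S ⊆ W ×ˢ Set.univ) : (compSets E (copies (complexOf z φ η.1) L) S).Finite :=
  (finite_copies η hW hb).subset fun _ hI => ⟨hI.1, hI.2.1.trans hS⟩

/-- The bound for the number of copies of a connected complex at a vertex. -/
noncomputable def copyBound (z : ℕ ≃ (Fin d → ℤ)) (hα : 0 < α)
    (φ : ∀ j : Fin α, (Fin (j + 2) → Loc d × A) → unitInterval) (r : ℕ) (o : Pt d A α)
    (ψ : Config d A α) : ℝ≥0∞ :=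
  ∑ m ∈ Finset.range (3 * r + 1), (∑ par ∈ parentMaps m, treeCount z hα φ par o ψ) * 8 ^ m

/-- The bound for the degree of a vertex. -/
noncomputable def degreeBound (z : ℕ ≃ (Fin d → ℤ)) (hα : 0 < α)
    (φ : ∀ j : Fin α, (Fin (j + 2) → Loc d × A) → unitInterval) (o : Pt d A α)
    (ψ : Config d A α) : ℝ≥0∞ :=
  ∑ m ∈ Finset.range 4, treeCount z hα φ (fun _ : Fin m => (0 : Fin (m + 1))) o ψ * 8 ^ m

lemma encard_copies_le (hL : IsConnected L) (hLfin : L.faces.Finite) (hs : IsSimple ψ.1)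
    (hη : IsNice (ψ.add o).1) (hα : 0 < α) :
    ({I ∈ copies (complexOf z φ (ψ.add o).1) L | vertexOf o ∈ I}.encard : ℝ≥0∞) ^ 3 ≤
      copyBound z hα φ ((vertexSet L).ncard - 1) o ψ := by
  have hV := finite_vertexSet hLfin
  have hpos : 0 < (vertexSet L).ncard := by
    rw [Set.ncard_pos hV]
    obtain ⟨y⟩ := hL.nonempty
    exact ⟨_, y.2⟩
  have h := encard_pow_three_le (E := Edge (complexOf z φ (ψ.add o).1)) (o := vertexOf o)
    (r := (vertexSet L).ncard - 1) {I ∈ copies (complexOf z φ (ψ.add o).1) L | vertexOf o ∈ I}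
    fun I hI => by
      have hc := ncard_of_mem_copies hV hI.1
      exact ⟨hI.2, spans_of_mem_copies hL hI.1, hc.1, by rw [hc.2]; omega⟩
  have h' : ENat.toENNRealRingHom _ ≤ ENat.toENNRealRingHom _ := ENat.toENNReal_mono h
  rw [map_pow, map_sum] at h'
  refine h'.trans (Finset.sum_le_sum fun m _ => ?_)
  rw [map_mul, map_pow, map_ofNat]
  refine mul_le_mul' ?_ le_rfl
  have h2 : ENat.toENNRealRingHom _ ≤ ENat.toENNRealRingHom _ := ENat.toENNReal_mono
    (encard_growTuples_le (Edge (complexOf z φ (ψ.add o).1)) (vertexOf o) m)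
  rw [map_sum] at h2
  exact h2.trans (Finset.sum_le_sum fun par hpar =>
    encard_treeVertices_le hs hη hα (by simpa [parentMaps] using hpar))

lemma encard_neighbours_le (hs : IsSimple ψ.1) (hη : IsNice (ψ.add o).1) (hα : 0 < α) :
    ({v | v ≠ vertexOf o ∧ Edge (complexOf z φ (ψ.add o).1) v (vertexOf o)}.encard : ℝ≥0∞) ^ 3 ≤
      degreeBound z hα φ o ψ := by
  have h' : ENat.toENNRealRingHom _ ≤ ENat.toENNRealRingHom _ := ENat.toENNReal_mono
    (encard_neighbours_pow_three_le (E := Edge (complexOf z φ (ψ.add o).1))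
      (fun _ _ => Edge.symm) (vertexOf o))
  rw [map_pow, map_sum] at h'
  refine h'.trans (Finset.sum_le_sum fun m _ => ?_)
  rw [map_mul, map_pow, map_ofNat]
  exact mul_le_mul' (encard_treeVertices_le hs hη hα fun i => Fin.succ_pos i) le_rfl

lemma finite_of_encard_pow_lt_top {X : Type*} {s : Set X} {b : ℝ≥0∞}
    (h : (s.encard : ℝ≥0∞) ^ 3 ≤ b) (hb : b < ∞) : s.Finite := by
  rw [← Set.encard_ne_top_iff]
  intro htop
  rw [htop] at h
  simp at h
  exact hb.ne h

/-- The exponent of the moment condition is used as 2 + ε with ε = 1. -/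
lemma ofReal_natCast_pow (n : ℕ) :
    ENNReal.ofReal (|(n : ℝ)| ^ ((2 : ℝ) + 1)) = (n : ℝ≥0∞) ^ 3 := by
  rw [abs_of_nonneg (Nat.cast_nonneg n), show (2 : ℝ) + 1 = ((3 : ℕ) : ℝ) by norm_num,
    Real.rpow_natCast, ENNReal.ofReal_pow (Nat.cast_nonneg n), ENNReal.ofReal_natCast]

/-- The moments of the difference operator for the number of induced copies. -/
lemma diffOp_inducedCount_pow_le (hL : IsConnected L) (hLfin : L.faces.Finite)
    (hs : IsSimple ψ.1) (hη : IsNice (ψ.add o).1) (hα : 0 < α)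
    {W : Set (Loc d)} (hW : MeasurableSet W) (hb : Bornology.IsBounded W) :
    ENNReal.ofReal (|diffOp z φ (inducedCount L) ψ.1 o W| ^ ((2 : ℝ) + 1)) ≤
      copyBound z hα φ ((vertexSet L).ncard - 1) o ψ := by
  rw [diffOp_inducedCount hη hW hb, ofReal_natCast_pow]
  refine le_trans ?_ (encard_copies_le hL hLfin hs hη hα)
  gcongr
  rw [← ENat.toENNReal_coe]
  refine ENat.toENNReal_mono ((Set.ncard_le_encard _).trans (Set.encard_le_encard ?_))
  exact fun I hI => ⟨hI.1, hI.2.2⟩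

/-- The difference operator for the number of induced copies is eventually constant. -/
lemma exists_diffOp_inducedCount_eq (hL : IsConnected L) (hLfin : L.faces.Finite)
    (hs : IsSimple ψ.1) (hη : IsNice (ψ.add o).1) (hα : 0 < α)
    (hfin : copyBound z hα φ ((vertexSet L).ncard - 1) o ψ < ∞) :
    ∃ (c : ℝ) (B : Set (Loc d)), Bornology.IsBounded B ∧ ∀ W, MeasurableSet W →
      Bornology.IsBounded W → B ⊆ W → diffOp z φ (inducedCount L) ψ.1 o W = c := by
  have hF := finite_of_encard_pow_lt_top (encard_copies_le (z := z) (φ := φ) hL hLfin hs hη hα) hfin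
  refine ⟨{I ∈ copies (complexOf z φ (ψ.add o).1) L | vertexOf o ∈ I}.ncard,
    Prod.fst '' ⋃₀ {I ∈ copies (complexOf z φ (ψ.add o).1) L | vertexOf o ∈ I}, ?_,
    fun W hW hb hBW => ?_⟩
  · refine Set.Finite.isBounded (Set.Finite.image _ (hF.sUnion fun I hI => ?_))
    exact (ncard_of_mem_copies (finite_vertexSet hLfin) hI.1).1
  · rw [diffOp_inducedCount hη hW hb]
    congr 2
    ext I
    refine ⟨fun hI => ⟨hI.1, hI.2.2⟩, fun hI => ⟨hI.1, fun v hv => ⟨hBW ?_, trivial⟩, hI.2⟩⟩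
    exact ⟨v, ⟨I, hI, hv⟩, rfl⟩

/-- The moments of the difference operator for the number of components. -/
lemma diffOp_componentCount_pow_le (hL : IsConnected L)
    (hs : IsSimple ψ.1) (hη : IsNice (ψ.add o).1) (hα : 0 < α)
    {W : Set (Loc d)} (hW : MeasurableSet W) (hb : Bornology.IsBounded W) (ho : o.1 ∈ W) :
    ENNReal.ofReal (|diffOp z φ (componentCount L) ψ.1 o W| ^ ((2 : ℝ) + 1)) ≤
      8 * (1 + degreeBound z hα φ o ψ) := by
  -- If the bound is infinite, nothing is to be shown. Otherwise the neighbourhood is finite, and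
  -- `ncard` is its true size and not the default 0.
  by_cases hfin : degreeBound z hα φ o ψ = ∞
  · simp [hfin]
  have hN := finite_of_encard_pow_lt_top (encard_neighbours_le (z := z) (φ := φ) hs hη hα)
    (lt_top_iff_ne_top.2 hfin)
  have hsub : {v ∈ W ×ˢ Set.univ \ {vertexOf o} | Edge (complexOf z φ (ψ.add o).1) v (vertexOf o)} ⊆
      {v | v ≠ vertexOf o ∧ Edge (complexOf z φ (ψ.add o).1) v (vertexOf o)} :=
    fun v hv => ⟨hv.1.2, hv.2⟩
  have h := abs_compSets_sub_le (E := Edge (complexOf z φ (ψ.add o).1))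
    (L := copies (complexOf z φ (ψ.add o).1) L) (S := W ×ˢ Set.univ) (o := vertexOf o)
    ⟨ho, trivial⟩ (fun I hI v _ => spans_of_mem_copies hL hI)
    (finite_compSets _ hW hb _ le_rfl) (finite_compSets _ hW hb _ Set.sdiff_subset)
    (hN.subset hsub)
  rw [← diffOp_componentCount hL hη] at h
  have hle := h.trans (add_le_add_right (Nat.cast_le (α := ℝ).2 (Set.ncard_le_ncard hsub hN)) 1)
  set N := {v | v ≠ vertexOf o ∧ Edge (complexOf z φ (ψ.add o).1) v (vertexOf o)}
  have hcast : (1 : ℝ) + N.ncard = ((1 + N.ncard : ℕ) : ℝ) := by push_cast; ring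
  calc ENNReal.ofReal (|diffOp z φ (componentCount L) ψ.1 o W| ^ ((2 : ℝ) + 1))
      ≤ ENNReal.ofReal (|((1 + N.ncard : ℕ) : ℝ)| ^ ((2 : ℝ) + 1)) := by
        refine ENNReal.ofReal_le_ofReal (Real.rpow_le_rpow (abs_nonneg _) ?_ (by norm_num))
        rw [Nat.abs_cast, ← hcast]
        exact hle
    _ = ((1 + N.ncard : ℕ) : ℝ≥0∞) ^ 3 := ofReal_natCast_pow _
    -- For n ≥ 1 one has 1 + n ≤ 2n, whence the factor 2^3.
    _ ≤ 8 * (1 + (N.ncard : ℝ≥0∞) ^ 3) := by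
        have : (1 + N.ncard) ^ 3 ≤ 8 * (1 + N.ncard ^ 3) := by
          generalize N.ncard = n
          rcases Nat.eq_zero_or_pos n with rfl | hn
          · norm_num
          · calc (1 + n) ^ 3 ≤ (2 * n) ^ 3 := Nat.pow_le_pow_left (by omega) 3
              _ ≤ _ := by rw [mul_pow]; omega
        exact_mod_cast this
    _ ≤ 8 * (1 + degreeBound z hα φ o ψ) := by
        gcongr
        refine le_trans ?_ (encard_neighbours_le hs hη hα)
        gcongr
        rw [← ENat.toENNReal_coe]
        exact ENat.toENNReal_mono (Set.ncard_le_encard _)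

/-- The difference operator for the number of components is eventually constant. -/
lemma exists_diffOp_componentCount_eq (hL : IsConnected L) (hLfin : L.faces.Finite)
    (hs : IsSimple ψ.1) (hη : IsNice (ψ.add o).1) (hα : 0 < α)
    (hfin : degreeBound z hα φ o ψ < ∞) :
    ∃ (c : ℝ) (B : Set (Loc d)), Bornology.IsBounded B ∧ ∀ W, MeasurableSet W →
      Bornology.IsBounded W → B ⊆ W → diffOp z φ (componentCount L) ψ.1 o W = c := by
  have hN := finite_of_encard_pow_lt_top (encard_neighbours_le (z := z) (φ := φ) hs hη hα) hfin
  obtain ⟨D, hD, c, hc⟩ := exists_compSets_sub_eq (E := Edge (complexOf z φ (ψ.add o).1))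
    (L := copies (complexOf z φ (ψ.add o).1) L) (o := vertexOf o)
    (fun I hI v _ => spans_of_mem_copies hL hI)
    (fun I hI => ncard_of_mem_copies (finite_vertexSet hLfin) hI) hN
  refine ⟨c, Prod.fst '' D, (hD.image _).isBounded, fun W hW hb hBW => ?_⟩
  rw [diffOp_componentCount hL hη]
  exact hc _ (fun v hv => ⟨hBW ⟨v, hv, rfl⟩, trivial⟩) (finite_compSets _ hW hb _ le_rfl)
    (finite_compSets _ hW hb _ Set.sdiff_subset)

end Pathwise

/-! ### Weak stabilization and the moment condition -/

lemma IsCube.measurableSet {d : ℕ} {W : Set (Loc d)} (hW : IsCube W) : MeasurableSet W := by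
  obtain ⟨c, s, -, rfl⟩ := hW
  refine measurableSet_setOfPred.2 (Measurable.forall fun i => measurableSet_setOfPred.1 ?_)
  exact (measurableSet_le measurable_const (measurable_pi_apply i)).inter
    (measurableSet_lt (measurable_pi_apply i) measurable_const)

lemma IsCube.isBounded {d : ℕ} {W : Set (Loc d)} (hW : IsCube W) : Bornology.IsBounded W := by
  obtain ⟨c, s, -, rfl⟩ := hW
  exact (Metric.isBounded_Icc c fun i => c i + s).subset fun x hx =>
    ⟨fun i => (hx i).1, fun i => (hx i).2.le⟩

/-- The cube with side length `2 (n + 1)` around the origin. -/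
def centredCube (d n : ℕ) : Set (Loc d) :=
  {x | ∀ i, -((n : ℝ) + 1) ≤ x i ∧ x i < -((n : ℝ) + 1) + 2 * ((n : ℝ) + 1)}

lemma isCube_centredCube (d n : ℕ) : IsCube (centredCube d n) :=
  ⟨fun _ => -((n : ℝ) + 1), 2 * ((n : ℝ) + 1), by positivity, rfl⟩

lemma tendsToSpace_centredCube (d : ℕ) : TendsToSpace (centredCube d) := fun B hB => by
  obtain ⟨R, hR⟩ := hB.subset_closedBall (0 : Loc d)
  obtain ⟨N, hN⟩ := exists_nat_ge R
  refine ⟨N, fun n hn x hx i => ?_⟩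
  have h1 : ‖x‖ ≤ R := by simpa using hR hx
  have h2 : |x i| ≤ R := (norm_le_pi_norm x i).trans h1
  have h3 : (N : ℝ) ≤ n := by exact_mod_cast hn
  constructor <;> linarith [abs_le.1 h2]

section Stabilization

variable {d : ℕ} {A : Type u} [MeasurableSpace A] {α : ℕ} {z : ℕ ≃ (Fin d → ℤ)}
  {φ : ∀ j : Fin α, (Fin (j + 2) → Loc d × A) → unitInterval}
  {Ω : Type*} [MeasurableSpace Ω] {P : Measure Ω} [IsProbabilityMeasure P]
  {Ψ : Ω → Measure (Pt d A α)} {V : Ω → A} {U : Ω → AuxMark α}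

/-- A functional whose differences are almost surely constant for large cubes is weakly
stabilizing. -/
lemma weaklyStabilizing_of_eventually_const
    {f : PreAbstractSimplicialComplex (Loc d × A) → ℝ} (hf : TranslationInvariant f)
    (hmeas : ∀ W, IsCube W → AEMeasurable (originDiff z φ Ψ V U f W) P)
    (hconst : ∀ᵐ ω ∂P, ∃ (c : ℝ) (B : Set (Loc d)), Bornology.IsBounded B ∧
      ∀ W, IsCube W → B ⊆ W → originDiff z φ Ψ V U f W ω = c) :
    WeaklyStabilizing P z φ Ψ V U f := by
  have hlim : ∀ W : ℕ → Set (Loc d), (∀ n, IsCube (W n)) → TendsToSpace W → ∀ ω (c : ℝ),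
      (∃ B : Set (Loc d), Bornology.IsBounded B ∧
        ∀ W, IsCube W → B ⊆ W → originDiff z φ Ψ V U f W ω = c) →
      Tendsto (fun n => originDiff z φ Ψ V U f (W n) ω) atTop (𝓝 c) := by
    rintro W hW hWs ω c ⟨B, hB, hc⟩
    obtain ⟨N, hN⟩ := hWs B hB
    refine tendsto_const_nhds.congr' (eventually_atTop.2 ⟨N, fun n hn => ?_⟩)
    exact (hc (W n) (hW n) (hN n hn)).symm
  -- The limit is taken along one fixed sequence; the eventual value `c` does not depend on the
  -- sequence, so all others have the same limit.
  obtain ⟨Z, hZ, hZlim⟩ := measurable_limit_of_tendsto_metrizable_ae (L := atTop)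
    (fun n => hmeas _ (isCube_centredCube d n))
    (hconst.mono fun ω ⟨c, h⟩ =>
      ⟨c, hlim _ (isCube_centredCube d) (tendsToSpace_centredCube d) ω c h⟩)
  refine ⟨hf, hmeas, Z, hZ, fun W hW hWs => ?_⟩
  refine tendstoInMeasure_of_tendsto_ae (fun n => (hmeas _ (hW n)).aestronglyMeasurable) ?_
  filter_upwards [hconst, hZlim] with ω ⟨c, h⟩ hω
  rw [tendsto_nhds_unique hω
    (hlim _ (isCube_centredCube d) (tendsToSpace_centredCube d) ω c h)]
  exact hlim W hW hWs ω c h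

end Stabilization

/-! ### Expectations at the typical point -/

section Typical

variable {d : ℕ} {A : Type u} [MeasurableSpace A] [StandardBorelSpace A] {α : ℕ}
  {z : ℕ ≃ (Fin d → ℤ)} {φ : ∀ j : Fin α, (Fin (j + 2) → Loc d × A) → unitInterval}
  {Ω : Type*} [MeasurableSpace Ω] {P : Measure Ω} [IsProbabilityMeasure P]
  {Ψ : Ω → Measure (Pt d A α)} {V : Ω → A} {U : Ω → AuxMark α} {γ : ℝ≥0} {Θ : Measure A}
  [IsProbabilityMeasure Θ] {Y : Type*} {L : PreAbstractSimplicialComplex Y}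

lemma measurable_tupleInt_cons {m : ℕ} {T : Config d A α → Set (Fin (m + 1) → Pt d A α)}
    (hT : Measurable fun q : Config d A α × (Fin (m + 1) → Pt d A α) => q.2 ∈ T q.1) :
    Measurable fun q : Pt d A α × Config d A α =>
      tupleInt m ({x : Fin m → Pt d A α | Fin.cons q.1 x ∈ T (q.2.add q.1)}.indicator 1) q.2.1 := by
  classical
  refine measurable_tupleInt m (Γ := Pt d A α × Config d A α) (η := Prod.snd) measurable_snd
    (h := fun q => {x : Fin m → Pt d A α | Fin.cons q.1 x ∈ T (q.2.add q.1)}.indicator 1) ?_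
  have hg : Measurable fun r : (Pt d A α × Config d A α) × (Fin m → Pt d A α) =>
      (r.1.2.add r.1.1, (Fin.cons r.1.1 r.2 : Fin (m + 1) → Pt d A α)) :=
    (measurable_locFin_add.comp
      ((measurable_snd.comp measurable_fst).prodMk (measurable_fst.comp measurable_fst))).prodMk
      ((measurable_finCons m).comp ((measurable_fst.comp measurable_fst).prodMk measurable_snd))
  exact measurable_one.indicator (hg (measurableSet_setOfPred.2 hT))

lemma measurable_treeCount (hα : 0 < α) (hφ : IsConnectionFamily φ) {m : ℕ}
    (par : Fin m → Fin (m + 1)) :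
    Measurable fun q : Pt d A α × Config d A α => treeCount z hα φ par q.1 q.2 :=
  measurable_tupleInt_cons (measurable_mem_treeTuples hα hφ par)

lemma measurable_copyBound (hα : 0 < α) (hφ : IsConnectionFamily φ) (r : ℕ) :
    Measurable fun q : Pt d A α × Config d A α => copyBound z hα φ r q.1 q.2 :=
  Finset.measurable_sum _ fun _ _ => (Finset.measurable_sum _ fun par _ =>
    measurable_treeCount hα hφ par).mul_const _

lemma measurable_degreeBound (hα : 0 < α) (hφ : IsConnectionFamily φ) :
    Measurable fun q : Pt d A α × Config d A α => degreeBound z hα φ q.1 q.2 :=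
  Finset.measurable_sum _ fun _ _ => (measurable_treeCount hα hφ _).mul_const _

/-- The Poisson process together with an independent typical point. -/
structure IsTypical (P : Measure Ω) (Ψ : Ω → Measure (Pt d A α)) (V : Ω → A)
    (U : Ω → AuxMark α) (γ : ℝ≥0) (Θ : Measure A) : Prop where
  poisson : IsPoissonProcess P Ψ (intensity d α γ Θ)
  measurable_mark : Measurable V
  map_mark : P.map V = Θ
  measurable_aux : Measurable U
  map_aux : P.map U = auxLaw α
  indep_mark_aux : IndepFun V U P
  indep_poisson : IndepFun (fun ω => (V ω, U ω)) Ψ P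

namespace IsTypical

/-- The typical point at the origin. -/
noncomputable def origin (_ : IsTypical P Ψ V U γ Θ) (ω : Ω) : Pt d A α := (0, V ω, 1, U ω)

lemma measurable_origin (h : IsTypical P Ψ V U γ Θ) : Measurable h.origin :=
  measurable_const.prodMk (h.measurable_mark.prodMk (measurable_const.prodMk h.measurable_aux))

/-- The Poisson process as a random configuration. -/
noncomputable def config (h : IsTypical P Ψ V U γ Θ) (ω : Ω) : Config d A α := h.poisson.toLocFin ω

lemma measurable_config (h : IsTypical P Ψ V U γ Θ) : Measurable h.config :=
  h.poisson.measurable_toLocFin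

/-- The configuration and `Ψ` generate the same σ-algebra, as configurations carry the trace
σ-algebra. -/
lemma indepFun_config (h : IsTypical P Ψ V U γ Θ) :
    IndepFun (fun ω => (V ω, U ω)) h.config P := by
  have hcomap : MeasurableSpace.comap h.config inferInstance =
      MeasurableSpace.comap Ψ inferInstance := by
    change MeasurableSpace.comap h.config (MeasurableSpace.comap Subtype.val inferInstance) = _
    rw [MeasurableSpace.comap_comp]
    rfl
  rw [IndepFun_iff_Indep, hcomap]
  exact h.indep_poisson

lemma lintegral_eq (h : IsTypical P Ψ V U γ Θ) {F : Pt d A α → Config d A α → ℝ≥0∞}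
    (hF : Measurable (Function.uncurry F)) :
    ∫⁻ ω, F (h.origin ω) (h.config ω) ∂P =
      ∫⁻ v, ∫⁻ u, ∫⁻ ω, F (pt (0, v, 1) u) (h.config ω) ∂P ∂(auxLaw α) ∂Θ := by
  have hVU : Measurable fun ω => (V ω, U ω) := h.measurable_mark.prodMk h.measurable_aux
  have hlaw := (indepFun_iff_map_prod_eq_prod_map_map hVU.aemeasurable
    h.measurable_config.aemeasurable).1 h.indepFun_config
  have hlaw' := (indepFun_iff_map_prod_eq_prod_map_map h.measurable_mark.aemeasurable
    h.measurable_aux.aemeasurable).1 h.indep_mark_aux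
  rw [hlaw', h.map_mark, h.map_aux] at hlaw
  have : IsProbabilityMeasure (P.map h.config) :=
    Measure.isProbabilityMeasure_map h.measurable_config.aemeasurable
  let G : (A × AuxMark α) × Config d A α → ℝ≥0∞ := fun q => F (pt (0, q.1.1, 1) q.1.2) q.2
  have hG : Measurable G := hF.comp (Measurable.prodMk
    (measurable_pt.comp (f := fun q : (A × AuxMark α) × Config d A α =>
      (((0, q.1.1, 1), q.1.2) : Base d A × AuxMark α)) (by fun_prop)) measurable_snd)
  calc ∫⁻ ω, F (h.origin ω) (h.config ω) ∂P
      = ∫⁻ q, G q ∂(P.map fun ω => ((V ω, U ω), h.config ω)) :=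
        (lintegral_map hG (hVU.prodMk h.measurable_config)).symm
    _ = ∫⁻ q, ∫⁻ η, G (q, η) ∂(P.map h.config) ∂(Θ.prod (auxLaw α)) := by
        rw [hlaw, lintegral_prod _ hG.aemeasurable]
    _ = ∫⁻ q, ∫⁻ ω, G (q, h.config ω) ∂P ∂(Θ.prod (auxLaw α)) := by
        refine lintegral_congr fun q => ?_
        exact lintegral_map (f := fun η => G (q, η)) (hG.comp measurable_prodMk_left)
          h.measurable_config
    _ = _ := by
        rw [lintegral_prod]
        exact (Measurable.lintegral_prod_right' (f := fun q : (A × AuxMark α) × Ω =>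
          G (q.1, h.config q.2)) (hG.comp (measurable_fst.prodMk
            (h.measurable_config.comp measurable_snd)))).aemeasurable

lemma lintegral_treeCount_le (h : IsTypical P Ψ V U γ Θ) (hα : 0 < α)
    (hφ : IsConnectionFamily φ) {m : ℕ} {par : Fin m → Fin (m + 1)} (hpar : ∀ i, par i < i.succ) :
    ∫⁻ ω, treeCount z hα φ par (h.origin ω) (h.config ω) ∂P ≤
      ∫⁻ v, ∫⁻ b, ∏ i, edgeKernel hα φ
        ((Fin.cons (0, v, 1) b : Fin (m + 1) → Base d A) (par i)) (b i)
        ∂(Measure.pi fun _ => baseIntensity γ Θ) ∂Θ := by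
  rw [h.lintegral_eq (F := treeCount z hα φ par) (measurable_treeCount hα hφ par)]
  exact lintegral_mono fun v => lintegral_treeTuples_le h.poisson hα hφ hpar (0, v, 1)

attribute [local irreducible] treeCount

/-- Each tree with `m` edges contributes at most `C ^ m`, where `C` is γ times the essential
supremum. The root's mark has law `Θ`, so the bound also holds at almost every root. -/
lemma lintegral_copyBound_lt_top (h : IsTypical P Ψ V U γ Θ) (hα : 0 < α)
    (hφ : IsConnectionFamily φ) (hess : essSup (edgeIntegral hα φ Θ) Θ < ∞) (r : ℕ) :
    ∫⁻ ω, copyBound z hα φ r (h.origin ω) (h.config ω) ∂P < ∞ := by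
  have hoc : Measurable fun ω => (h.origin ω, h.config ω) :=
    h.measurable_origin.prodMk h.measurable_config
  have hmt : ∀ {m : ℕ} (par : Fin m → Fin (m + 1)),
      Measurable fun ω => treeCount z hα φ par (h.origin ω) (h.config ω) := fun par =>
    (measurable_treeCount hα hφ par).comp hoc
  set C : ℝ≥0∞ := γ * essSup (edgeIntegral hα φ Θ) Θ
  have hC : C < ∞ := ENNReal.mul_lt_top ENNReal.coe_lt_top hess
  have hae : ∀ᵐ a ∂Θ, mixingParameter hα γ φ Θ a ≤ C :=
    (ENNReal.ae_le_essSup _).mono fun a ha => mul_le_mul' le_rfl ha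
  have hbase : ∀ᵐ b ∂(baseIntensity (d := d) γ Θ),
      ∫⁻ b', edgeKernel hα φ b b' ∂(baseIntensity γ Θ) ≤ C := by
    simp_rw [lintegral_edgeKernel hα hφ γ Θ]
    exact Measure.quasiMeasurePreserving_snd.ae
      (Measure.quasiMeasurePreserving_fst.ae hae)
  have htree : ∀ m, ∀ par ∈ parentMaps m,
      ∫⁻ ω, treeCount z hα φ par (h.origin ω) (h.config ω) ∂P ≤ C ^ m := fun m par hpar => by
    refine (h.lintegral_treeCount_le hα hφ (by simpa [parentMaps] using hpar)).trans ?_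
    calc _ ≤ ∫⁻ _, C ^ m ∂Θ := by
          refine lintegral_mono_ae (hae.mono fun v hv => ?_)
          refine lintegral_tree_le _ (measurable_edgeKernel hα hφ) hbase ?_ m par
            (by simpa [parentMaps] using hpar)
          rw [lintegral_edgeKernel hα hφ γ Θ]
          exact hv
      _ = C ^ m := by rw [lintegral_const, measure_univ, mul_one]
  simp only [copyBound]
  rw [lintegral_finsetSum _ fun m _ =>
    (Finset.measurable_sum _ fun par _ => hmt par).mul_const _]
  refine ENNReal.sum_lt_top.2 fun m _ => ?_
  rw [lintegral_mul_const _ (Finset.measurable_sum _ fun par _ => hmt par),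
    lintegral_finsetSum _ fun par _ => hmt par]
  refine ENNReal.mul_lt_top (ENNReal.sum_lt_top.2 fun par hpar => ?_)
    (ENNReal.pow_lt_top (by simp))
  exact (htree m par hpar).trans_lt (ENNReal.pow_lt_top hC)

/-- In a star all edges start at the root, so a star with `m` leaves contributes the moment of order
`m` of π(V), and only `m ≤ 3` occurs. -/
lemma lintegral_degreeBound_lt_top (h : IsTypical P Ψ V U γ Θ) (hα : 0 < α)
    (hφ : IsConnectionFamily φ) (hmix : ∫⁻ ω, mixingParameter hα γ φ Θ (V ω) ^ 3 ∂P < ∞) :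
    ∫⁻ ω, degreeBound z hα φ (h.origin ω) (h.config ω) ∂P < ∞ := by
  have hoc : Measurable fun ω => (h.origin ω, h.config ω) :=
    h.measurable_origin.prodMk h.measurable_config
  have hmt : ∀ {m : ℕ} (par : Fin m → Fin (m + 1)),
      Measurable fun ω => treeCount z hα φ par (h.origin ω) (h.config ω) := fun par =>
    (measurable_treeCount hα hφ par).comp hoc
  have hmeas : Measurable (mixingParameter hα γ φ Θ) := by
    have h2 : Measurable fun a : A =>
        ∫⁻ b', edgeKernel hα φ (0, a, 0) b' ∂(baseIntensity (d := d) γ Θ) :=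
      (Measurable.lintegral_prod_right' (measurable_edgeKernel hα hφ)).comp
        (f := fun a : A => ((0, a, 0) : Base d A)) (by fun_prop)
    simpa only [lintegral_edgeKernel hα hφ γ Θ] using h2
  rw [← lintegral_map (f := fun a => mixingParameter hα γ φ Θ a ^ 3) (hmeas.pow_const 3)
    h.measurable_mark, h.map_mark] at hmix
  have hstar : ∀ m, m ≤ 3 → ∫⁻ ω, treeCount z hα φ (fun _ : Fin m => (0 : Fin (m + 1)))
      (h.origin ω) (h.config ω) ∂P < ∞ := fun m hm => by
    refine (h.lintegral_treeCount_le hα hφ fun i => Fin.succ_pos i).trans_lt ?_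
    calc _ = ∫⁻ v, mixingParameter hα γ φ Θ v ^ m ∂Θ := by
          refine lintegral_congr fun v => ?_
          simp only [Fin.cons_zero]
          rw [lintegral_star _ (edgeKernel hα φ (0, v, 1))
            ((measurable_edgeKernel hα hφ).comp measurable_prodMk_left),
            lintegral_edgeKernel hα hφ γ Θ]
      -- t^m ≤ 1 + t^3 for m ≤ 3, by the cases t ≤ 1 and t ≥ 1.
      _ ≤ ∫⁻ v, 1 + mixingParameter hα γ φ Θ v ^ 3 ∂Θ := by
          refine lintegral_mono fun v => ?_
          rcases le_total (mixingParameter hα γ φ Θ v) 1 with h1 | h1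
          · exact (pow_le_one' h1 m).trans le_self_add
          · exact (pow_le_pow_right₀ h1 hm).trans le_add_self
      _ < ∞ := by
          rw [lintegral_add_left measurable_const, lintegral_const, measure_univ, mul_one]
          exact ENNReal.add_lt_top.2 ⟨ENNReal.one_lt_top, hmix⟩
  simp only [degreeBound]
  rw [lintegral_finsetSum _ fun m _ => (hmt _).mul_const _]
  refine ENNReal.sum_lt_top.2 fun m hm => ?_
  rw [lintegral_mul_const _ (hmt _)]
  exact ENNReal.mul_lt_top (hstar m (by simpa using Finset.mem_range_succ_iff.1 hm))
    (ENNReal.pow_lt_top (by simp))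

end IsTypical

end Typical

/-! ### Almost sure properties of the configuration -/

section Nice

variable {d : ℕ} {A : Type u} [MeasurableSpace A] [StandardBorelSpace A] {α : ℕ}
  {z : ℕ ≃ (Fin d → ℤ)} {φ : ∀ j : Fin α, (Fin (j + 2) → Loc d × A) → unitInterval}
  {Ω : Type*} [MeasurableSpace Ω] {P : Measure Ω} [IsProbabilityMeasure P]
  {Ψ : Ω → Measure (Pt d A α)} {V : Ω → A} {U : Ω → AuxMark α} {γ : ℝ≥0} {Θ : Measure A}
  [IsProbabilityMeasure Θ] {Y : Type*} {L : PreAbstractSimplicialComplex Y}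

lemma isSimple_of_fiber (η : Config d A α) {T : Type*} {τ : Pt d A α → T}
    (h : ∀ p ∈ atoms η.1, η.1 {q | τ q = τ p} = 1) : IsSimple η.1 := fun p hp =>
  ((measure_mono (t := {q | τ q = τ p}) (Set.singleton_subset_iff.2 rfl)).trans (h p hp).le).antisymm
    (η.one_le (measurableSet_singleton p) hp)

lemma injOn_of_fiber (η : Config d A α) {T : Type*} {τ : Pt d A α → T}
    (h : ∀ p ∈ atoms η.1, η.1 {q | τ q = τ p} = 1) : Set.InjOn τ (points η.1) := by
  intro p hp q hq hpq
  by_contra hne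
  have hsub : ({p} ∪ {q} : Set (Pt d A α)) ⊆ {r | τ r = τ p} := by
    rintro r (rfl | rfl)
    exacts [rfl, hpq.symm]
  have h2 : (1 : ℝ≥0∞) + 1 ≤ 1 := by
    calc (1 : ℝ≥0∞) + 1 ≤ η.1 {p} + η.1 {q} := add_le_add
          (η.one_le (measurableSet_singleton p) hp) (η.one_le (measurableSet_singleton q) hq)
      _ = η.1 ({p} ∪ {q}) := (measure_union (Set.disjoint_singleton.2 hne)
          (measurableSet_singleton q)).symm
      _ ≤ 1 := (measure_mono hsub).trans (h p hp).le
  norm_num at h2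

lemma isNice_add {η : Config d A α} (h : IsNice η.1) {o : Pt d A α}
    (ho : ∀ p ∈ points η.1, p.1 ≠ o.1 ∧ timeOf p ≠ timeOf o) : IsNice (η.add o).1 := by
  have hval : ∀ p, (η.add o).1 {p} = η.1 {p} + Measure.dirac o {p} := fun _ => rfl
  have hinj : ∀ {T : Type _} {τ : Pt d A α → T}, Set.InjOn τ (points η.1) →
      (∀ p ∈ points η.1, τ p ≠ τ o) → Set.InjOn τ (points (η.add o).1) := by
    intro T τ hτ hne p hp q hq hpq
    rcases (mem_points_add η o p).1 hp with hp | hp <;>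
      rcases (mem_points_add η o q).1 hq with hq | hq
    · rw [hp, hq]
    · exact absurd (hp ▸ hpq.symm) (hne q hq)
    · exact absurd (hq ▸ hpq) (hne p hp)
    · exact hτ hp hq hpq
  refine ⟨fun p hp => ?_, hinj h.time_injOn fun p hp => (ho p hp).2,
    hinj h.position_injOn fun p hp => (ho p hp).1⟩
  rw [hval, Measure.dirac_apply' _ (measurableSet_singleton p)]
  by_cases hpo : o = p
  · have : η.1 {p} = 0 := by
      by_contra h0
      exact (ho p h0).1 (by rw [hpo])
    simp [hpo, this]
  · have := ((mem_points_add η o p).1 hp).resolve_left (Ne.symm hpo)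
    simp [hpo, h.simple p this]

lemma intensity_position (hd : 0 < d) (x : Loc d) :
    intensity d α γ Θ {q | q.1 = x} = 0 := by
  have : Nonempty (Fin d) := Fin.pos_iff_nonempty.1 hd
  have hset : {q : Pt d A α | q.1 = x} = {x} ×ˢ Set.univ := by ext q; simp
  rw [hset, intensity, Measure.prod_prod, Measure.smul_apply, measure_singleton]
  simp

lemma intensity_time (t : unitInterval) : intensity d α γ Θ {q | timeOf q = t} = 0 := by
  have hset : {q : Pt d A α | timeOf q = t} = Set.univ ×ˢ (Set.univ ×ˢ ({t} ×ˢ Set.univ)) := by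
    ext q; simp [timeOf]
  rw [hset, intensity, Measure.prod_prod, Measure.prod_prod, Measure.prod_prod, measure_singleton]
  simp

lemma ae_notMem_of_null (hΨ : IsPoissonProcess P Ψ (intensity d α γ Θ)) {B : Set (Pt d A α)}
    (hB : MeasurableSet B) (h0 : intensity d α γ Θ B = 0) :
    ∀ᵐ ω ∂P, ∀ p ∈ points (Ψ ω), p ∉ B := by
  have h := hΨ.lintegral_apply intensity_box hB
  have hm : Measurable fun ω => Ψ ω B := (Measure.measurable_coe hB).comp hΨ.measurable
  rw [h0, lintegral_eq_zero_iff hm] at h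
  filter_upwards [h] with ω hω p hp hpB
  exact hp (measure_mono_null (Set.singleton_subset_iff.2 hpB) hω)

namespace IsTypical

/-- Sets of points with a given time or a given position are null for the intensity. Hence distinct
points of the process have distinct times and positions, and neither coincides with the time 1 or
the position 0 of the added point. -/
lemma ae_isNice (h : IsTypical P Ψ V U γ Θ) (hd : 0 < d) :
    ∀ᵐ ω ∂P, IsSimple (h.config ω).1 ∧ IsNice ((h.config ω).add (h.origin ω)).1 := by
  have ht := h.poisson.ae_fiber_eq_one intensity_box measurable_timeOf
    fun p => intensity_time (timeOf p)
  have hx := h.poisson.ae_fiber_eq_one intensity_box measurable_fst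
    fun p => intensity_position hd p.1
  have ht1 := ae_notMem_of_null h.poisson
    (measurable_timeOf (measurableSet_singleton (1 : unitInterval))) (intensity_time 1)
  have hx0 := ae_notMem_of_null h.poisson
    (measurable_fst (measurableSet_singleton (0 : Loc d))) (intensity_position hd 0)
  filter_upwards [ht, hx, ht1, hx0] with ω ht hx ht1 hx0
  have hnice : IsNice (h.config ω).1 := ⟨isSimple_of_fiber (h.config ω) ht,
    injOn_of_fiber (h.config ω) ht, injOn_of_fiber (h.config ω) hx⟩
  exact ⟨hnice.simple, isNice_add hnice fun p hp => ⟨hx0 p hp, ht1 p hp⟩⟩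

/-- The functional has to agree with a measurable function only on configurations in general
position, because exceptions are null; `W \ {0}` is handled as another measurable window. -/
lemma aemeasurable_originDiff (h : IsTypical P Ψ V U γ Θ) (hd : 0 < d)
    {f : PreAbstractSimplicialComplex (Loc d × A) → ℝ}
    (hf : ∀ W : Set (Loc d), MeasurableSet W → ∃ G : Config d A α → ℝ, Measurable G ∧
      ∀ η : Config d A α, IsNice η.1 → f (restrict (complexOf z φ η.1) (W ×ˢ Set.univ)) = G η)
    {W : Set (Loc d)} (hW : MeasurableSet W) : AEMeasurable (originDiff z φ Ψ V U f W) P := by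
  obtain ⟨G, hG, hGf⟩ := hf W hW
  obtain ⟨G', hG', hGf'⟩ := hf (W \ {0}) (hW.diff (measurableSet_singleton 0))
  have hη : Measurable fun ω => (h.config ω).add (h.origin ω) :=
    measurable_locFin_add.comp (h.measurable_config.prodMk h.measurable_origin)
  refine ⟨_, (hG.comp hη).sub (hG'.comp hη), ?_⟩
  filter_upwards [h.ae_isNice hd] with ω hω
  have h1 := hGf _ hω.2
  have h2 := hGf' _ hω.2
  exact congrArg₂ (· - ·) h1 h2

lemma aemeasurable_inducedCount (h : IsTypical P Ψ V U γ Θ) (hd : 0 < d)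
    (hφ : IsConnectionFamily φ) (hL : L.faces.Finite) {W : Set (Loc d)} (hW : MeasurableSet W) :
    AEMeasurable (originDiff z φ Ψ V U (inducedCount L) W) P :=
  h.aemeasurable_originDiff hd (fun W hW => ⟨_,
    (measurable_tupleInt_indicator (measurable_mem_copyTuples (z := z) (L := L) hφ hW)).ennreal_toReal,
    fun _ hη => inducedCount_eq_tupleInt hη (finite_vertexSet hL) W⟩) hW

lemma aemeasurable_componentCount (h : IsTypical P Ψ V U γ Θ) (hd : 0 < d) (hα : 0 < α)
    (hφ : IsConnectionFamily φ) (hL : L.faces.Finite) (hLc : IsConnected L) {W : Set (Loc d)}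
    (hW : MeasurableSet W) : AEMeasurable (originDiff z φ Ψ V U (componentCount L) W) P :=
  h.aemeasurable_originDiff hd (fun W hW => ⟨_,
    (measurable_tupleInt_indicator
      (measurable_mem_compTuples (z := z) (L := L) hα hφ hW)).ennreal_toReal,
    fun η hη => componentCount_eq_tupleInt hη hα hLc (finite_vertexSet hL) W fun x =>
      measurableSet_neighbours hα hφ hW η x⟩) hW

/-- A bound for the differences with finite expectation implies the moment condition. -/
lemma momentCondition_of_le (h : IsTypical P Ψ V U γ Θ) (hd : 0 < d)
    {f : PreAbstractSimplicialComplex (Loc d × A) → ℝ} {b : Pt d A α → Config d A α → ℝ≥0∞}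
    (hb : ∫⁻ ω, b (h.origin ω) (h.config ω) ∂P < ∞)
    (hle : ∀ (ψ : Config d A α) (o : Pt d A α) (W : Set (Loc d)), IsSimple ψ.1 →
      IsNice (ψ.add o).1 → MeasurableSet W → Bornology.IsBounded W → o.1 ∈ W →
      ENNReal.ofReal (|diffOp z φ f ψ.1 o W| ^ ((2 : ℝ) + 1)) ≤ b o ψ) :
    MomentCondition P z φ Ψ V U f := by
  refine ⟨1, one_pos, (iSup₂_le fun W hW => ?_).trans_lt hb⟩
  refine lintegral_mono_ae ((h.ae_isNice hd).mono fun ω hω => ?_)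
  exact hle (h.config ω) (h.origin ω) W hω.1 hω.2 hW.1.measurableSet hW.1.isBounded hW.2

/-- Differences that are constant for large cubes wherever a bound with finite expectation is
finite belong to a weakly stabilizing functional. -/
lemma weaklyStabilizing_of_lt_top (h : IsTypical P Ψ V U γ Θ) (hd : 0 < d)
    {f : PreAbstractSimplicialComplex (Loc d × A) → ℝ} (hf : TranslationInvariant f)
    (hmeas : ∀ W, MeasurableSet W → AEMeasurable (originDiff z φ Ψ V U f W) P)
    {b : Pt d A α → Config d A α → ℝ≥0∞} (hbm : Measurable (Function.uncurry b))
    (hb : ∫⁻ ω, b (h.origin ω) (h.config ω) ∂P < ∞)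
    (hst : ∀ (ψ : Config d A α) (o : Pt d A α), IsSimple ψ.1 → IsNice (ψ.add o).1 → b o ψ < ∞ →
      ∃ (c : ℝ) (B : Set (Loc d)), Bornology.IsBounded B ∧ ∀ W, MeasurableSet W →
        Bornology.IsBounded W → B ⊆ W → diffOp z φ f ψ.1 o W = c) :
    WeaklyStabilizing P z φ Ψ V U f := by
  refine weaklyStabilizing_of_eventually_const hf (fun W hW => hmeas W hW.measurableSet) ?_
  have hfin := ae_lt_top (hbm.comp (h.measurable_origin.prodMk h.measurable_config)) hb.ne
  filter_upwards [h.ae_isNice hd, hfin] with ω hω hω'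
  obtain ⟨c, B, hB, hc⟩ := hst (h.config ω) (h.origin ω) hω.1 hω.2 hω'
  exact ⟨c, B, hB, fun W hW hBW => hc W hW.measurableSet hW.isBounded hBW⟩

end IsTypical

end Nice

end RCM

theorem mainTheorem9
    {d α : ℕ} (hd : 0 < d) (hα : 0 < α)
    {A : Type*} [MeasurableSpace A] [StandardBorelSpace A]
    (Θ : Measure A) [IsProbabilityMeasure Θ] (γ : ℝ≥0) (hγ : 0 < γ)
    (φ : ∀ j : Fin α, (Fin (j + 2) → RCM.Loc d × A) → unitInterval) (hφ : RCM.IsConnectionFamily φ)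
    (z : ℕ ≃ (Fin d → ℤ)) (hz : z 0 = 0)
    {Ω : Type*} [MeasurableSpace Ω] (P : Measure Ω) [IsProbabilityMeasure P]
    (Ψ : Ω → Measure (RCM.Pt d A α)) (hΨ : RCM.IsPoissonProcess P Ψ (RCM.intensity d α γ Θ))
    (V : Ω → A) (hV : Measurable V) (hVlaw : P.map V = Θ)
    (U : Ω → RCM.AuxMark α) (hU : Measurable U) (hUlaw : P.map U = RCM.auxLaw α)
    (hVU : IndepFun V U P) (hVUΨ : IndepFun (fun ω => (V ω, U ω)) Ψ P)
    {Y : Type*} (L : PreAbstractSimplicialComplex Y) (hLfin : L.faces.Finite)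
    (hLconn : RCM.IsConnected L) :
    (essSup (RCM.edgeIntegral hα φ Θ) Θ < ∞ →
      RCM.WeaklyStabilizing P z φ Ψ V U (RCM.inducedCount L) ∧
        RCM.MomentCondition P z φ Ψ V U (RCM.inducedCount L)) ∧
    (∫⁻ ω, RCM.mixingParameter hα γ φ Θ (V ω) ^ 3 ∂P < ∞ →
      RCM.WeaklyStabilizing P z φ Ψ V U (RCM.componentCount L) ∧
        RCM.MomentCondition P z φ Ψ V U (RCM.componentCount L)) := by
  have h : RCM.IsTypical P Ψ V U γ Θ := ⟨hΨ, hV, hVlaw, hU, hUlaw, hVU, hVUΨ⟩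
  refine ⟨fun hess => ?_, fun hmix => ?_⟩
  · have hb := h.lintegral_copyBound_lt_top (z := z) hα hφ hess ((RCM.vertexSet L).ncard - 1)
    exact ⟨h.weaklyStabilizing_of_lt_top hd (RCM.translationInvariant_inducedCount L)
      (fun W hW => h.aemeasurable_inducedCount hd hφ hLfin hW) (b := RCM.copyBound z hα φ _)
      (RCM.measurable_copyBound hα hφ _) hb
      fun ψ o hs hη => RCM.exists_diffOp_inducedCount_eq hLconn hLfin hs hη hα,
      h.momentCondition_of_le hd hb fun ψ o W hs hη hW hbd _ =>
        RCM.diffOp_inducedCount_pow_le hLconn hLfin hs hη hα hW hbd⟩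
  · have hb := h.lintegral_degreeBound_lt_top (z := z) hα hφ hmix
    refine ⟨h.weaklyStabilizing_of_lt_top hd (RCM.translationInvariant_componentCount L hLconn)
      (fun W hW => h.aemeasurable_componentCount hd hα hφ hLfin hLconn hW)
      (b := RCM.degreeBound z hα φ)
      (RCM.measurable_degreeBound hα hφ) hb
      fun ψ o hs hη => RCM.exists_diffOp_componentCount_eq hLconn hLfin hs hη hα,
      h.momentCondition_of_le hd (b := fun o ψ => 8 * (1 + RCM.degreeBound z hα φ o ψ)) ?_
        fun ψ o W hs hη hW hbd ho => RCM.diffOp_componentCount_pow_le hLconn hs hη hα hW hbd ho⟩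
    rw [lintegral_const_mul' _ _ (by simp), lintegral_add_left measurable_const]
    exact ENNReal.mul_lt_top (by simp) (ENNReal.add_lt_top.2 ⟨by simp, hb⟩)
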